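/- Let $n\geqslant 1$ and let $M=\mathbb{H}^{n+1}/\Gamma$ be a compact $(n+1)$-dimensional hyperbolic manifold. Let $\mathcal{H}$ be the set of all $h\in C^\infty(M)$ such that, at every point of $M$, $$ h>\coth\Big(\sqrt{\tfrac{8}{27}}\,\tfrac{1}{(n+1)(n+2)}\Big),\qquad 6\|Dh\|+10<h^2,\qquad \frac{\|D^2h\|}{h}<\frac16, $$ where $\|D^2h\|$ is the operator norm of the Hessian of $h$. Let $\Sigma$ be the standard $n$-sphere. We consider smooth immersions $i:\Sigma\to M$ which lift to immersions $\hat\imath:\Sigma\to\mathbb{H}^{n+1}$ (for $n\geqslant 2$, all immersions do), and we denote by $[i]$ the class of $i$ up to reparametrisation by diffeomorphisms of $\Sigma$. The mean curvature is $H(i)=\frac1n(\lambda_1+\dots+\lambda_n)$, where $\lambda_1\leqslant\dots\leqslant\lambda_n$ are the principal curvatures, that is, the eigenvalues of the shape operator $A=\nabla\mathsf{N}$, $\mathsf{N}$ being the outward unit normal (the unit normal with respect to which $A$ is everywhere nonnegative). The immersion $i$ is locally strictly convex (LSC) if its shape operator with respect to some smooth unit normal field is everywhere positive definite, and pointwise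 strictly $1/2$-pinched if it is LSC and $\lambda_1>\frac12H$ at every point of $\Sigma$. Its outradius is the radius of the smallest geodesic ball of $\mathbb{H}^{n+1}$ containing $\hat\imath(\Sigma)$. Let $\mathcal{C}$ be the set of classes of pointwise strictly $1/2$-pinched immersions with outradius less than $\tanh^{-1}(1/\sqrt3)$, and let $\overline{\mathcal{C}}$ be its closure in the space of classes of immersions, with the quotient of the $C^\infty$ topology. Let $h\in\mathcal{H}$ and let $I:\mathbb{R}\to\overline{\mathcal{C}}$ be an eternal forced mean curvature flow with forcing term $h$. That is, every $t_0\in\mathbb{R}$ lies in an open interval $]a,b[$ on which $I(t)=[i(t,\cdot)]$, where $i:{]a,b[}\times\Sigma\to M$ is a smooth family of immersions such that $$ \langle\partial_t i,\mathsf{N}_t\rangle=h\circ i(t,\cdot)-H(i(t,\cdot)), $$ $\mathsf{N}_t$ being the outward unit normal over $i(t,\cdot)$. Then, for all $t\in\mathbb{R}$, $I(t)$ is locally strictly convex and pointwise strictly $1/2$-pinched. -/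

import Mathlib

open scoped Manifold ContDiff Topology

noncomputable section

/-! ### Hyperbolic space -/

/-- The vector space underlying the Minkowski space of signature `(n+1,1)`; the last factor is the
time coordinate. Only the vector space topology of this normed space is relevant below. -/
abbrev Mink (n : ℕ) : Type := EuclideanSpace ℝ (Fin (n + 1)) × ℝ

/-- The Minkowski form. -/
def mink {n : ℕ} (x y : Mink n) : ℝ := inner ℝ x.1 y.1 - x.2 * y.2

/-- Hyperbolic space of dimension `n+1` (hyperboloid model). Its Riemannian metric is the
restriction of `mink` to its tangent spaces `{v | mink x v = 0}`. -/
def Hyp (n : ℕ) : Type := {x : Mink n // mink x x = -1 ∧ 0 < x.2}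

instance (n : ℕ) : CoeOut (Hyp n) (Mink n) := ⟨Subtype.val⟩

instance (n : ℕ) : TopologicalSpace (Hyp n) := instTopologicalSpaceSubtype

/-- Hyperbolic distance. -/
def hypDist {n : ℕ} (x y : Hyp n) : ℝ := Real.arcosh (-mink (x : Mink n) (y : Mink n))

/-- The global chart of hyperbolic space given by the inverse of `(y, s) ↦ y`. -/
def hypChart {n : ℕ} (y : EuclideanSpace ℝ (Fin (n + 1))) : Hyp n :=
  ⟨(y, Real.sqrt (1 + ‖y‖ ^ 2)), by
    have h : (0 : ℝ) < 1 + ‖y‖ ^ 2 := by positivity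
    constructor
    · simp only [mink, real_inner_self_eq_norm_sq, Real.mul_self_sqrt h.le]
      ring
    · exact Real.sqrt_pos.2 h⟩

/-- Unit tangent vectors to hyperbolic space at `x`. -/
def UnitTangent {n : ℕ} (x : Hyp n) : Type :=
  {v : Mink n // mink (x : Mink n) v = 0 ∧ mink v v = 1}

theorem geod_mem {n : ℕ} (x : Hyp n) (v : UnitTangent x) (s : ℝ) :
    mink (Real.cosh s • (x : Mink n) + Real.sinh s • v.1)
      (Real.cosh s • (x : Mink n) + Real.sinh s • v.1) = -1 ∧
    0 < (Real.cosh s • (x : Mink n) + Real.sinh s • v.1).2 := by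
  obtain ⟨⟨a, b⟩, hx1, hx2⟩ := x
  obtain ⟨⟨c, d⟩, hv1, hv2⟩ := v
  simp only [mink] at hx1 hx2 hv1 hv2 ⊢
  have hcs := Real.cosh_sq s
  have hc := Real.cosh_pos s
  constructor
  · simp only [Prod.smul_mk, Prod.mk_add_mk, inner_add_left, inner_add_right,
      real_inner_smul_left, real_inner_smul_right, smul_eq_mul, real_inner_comm a c]
    linear_combination (Real.cosh s) ^ 2 * hx1 + 2 * Real.cosh s * Real.sinh s * hv1 +
      (Real.sinh s) ^ 2 * hv2 - hcs
  · simp only [Prod.smul_mk, Prod.mk_add_mk, smul_eq_mul]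
    have hC := real_inner_mul_inner_self_le a c
    have e1 : inner ℝ a a = b * b - 1 := by linarith
    have e2 : inner ℝ c c = 1 + d * d := by linarith
    have e3 : inner ℝ a c = b * d := by linarith
    rw [e1, e2, e3] at hC
    have hd : d ^ 2 < b ^ 2 := by nlinarith
    have hdb : |d| < b := abs_lt_of_sq_lt_sq hd hx2.le
    have hs : |Real.sinh s| < Real.cosh s := by
      apply abs_lt_of_sq_lt_sq _ hc.le
      linarith
    have h1 : |Real.sinh s * d| < Real.cosh s * b := by
      rw [abs_mul]
      exact mul_lt_mul'' hs hdb (abs_nonneg _) (abs_nonneg _)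
    have := (abs_lt.1 h1).1
    linarith

/-- The unit speed geodesic of hyperbolic space leaving `x` with velocity `v`. -/
def geod {n : ℕ} (x : Hyp n) (v : UnitTangent x) (s : ℝ) : Hyp n :=
  ⟨Real.cosh s • (x : Mink n) + Real.sinh s • v.1, geod_mem x v s⟩

/-! ### Hyperbolic manifolds -/

/-- A complete hyperbolic manifold of dimension `n+1`, presented as the quotient of hyperbolic space
by a group of isometries (Lorentz transformations preserving the hyperboloid) which acts freely and
properly discontinuously. -/
structure HyperbolicManifold (n : ℕ) where
  /-- The group of deck transformations. -/
  deck : Subgroup (Mink n ≃ₗ[ℝ] Mink n)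
  map_form : ∀ g ∈ deck, ∀ x y, mink (g x) (g y) = mink x y
  map_sheet : ∀ g ∈ deck, ∀ x : Hyp n, 0 < (g (x : Mink n)).2
  free : ∀ g ∈ deck, ∀ x : Hyp n, g (x : Mink n) = x → g = 1
  proper : ∀ K : Set (Hyp n), IsCompact K →
    {g | g ∈ deck ∧ ∃ x ∈ K, ∃ y ∈ K, g (x : Mink n) = (y : Mink n)}.Finite

namespace HyperbolicManifold

variable {n : ℕ} (M : HyperbolicManifold n)

/-- Two points of hyperbolic space are identified if they lie on one orbit of the deck group. -/
def orbitSetoid : Setoid (Hyp n) where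
  r x y := ∃ g ∈ M.deck, g (x : Mink n) = (y : Mink n)
  iseqv :=
    { refl := fun x => ⟨1, M.deck.one_mem, rfl⟩
      symm := by
        rintro x y ⟨g, hg, h⟩
        refine ⟨g⁻¹, M.deck.inv_mem hg, ?_⟩
        rw [← h]
        exact g.symm_apply_apply _
      trans := by
        rintro x y z ⟨g, hg, h⟩ ⟨k, hk, h'⟩
        refine ⟨k * g, M.deck.mul_mem hk hg, ?_⟩
        rw [← h', ← h]
        rfl }

/-- The points of the manifold, with the quotient topology. -/
abbrev Point : Type := Quotient M.orbitSetoid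

/-- The universal covering map. -/
def proj (x : Hyp n) : M.Point := Quotient.mk M.orbitSetoid x

/-- Smooth functions on the manifold. -/
def IsSmooth (h : M.Point → ℝ) : Prop :=
  ContDiff ℝ ∞ (fun y : EuclideanSpace ℝ (Fin (n + 1)) => h (M.proj (hypChart y)))

/-- `‖Dh‖` at the image of `x`: the supremum of `|Dh(v)|` over unit tangent vectors `v`. -/
def gradNorm (h : M.Point → ℝ) (x : Hyp n) : ℝ :=
  ⨆ v : UnitTangent x, |deriv (fun s => h (M.proj (geod x v s))) 0|

/-- `‖D²h‖` at the image of `x`: the operator norm of the Hessian, i.e. the supremum of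
`|D²h(v,v)|` over unit tangent vectors `v`, where `D²h(v,v)` is the second derivative of `h` along
the geodesic with velocity `v`. -/
def hessNorm (h : M.Point → ℝ) (x : Hyp n) : ℝ :=
  ⨆ v : UnitTangent x, |iteratedDeriv 2 (fun s => h (M.proj (geod x v s))) 0|

/-- The space of admissible forcing terms; `cosh r / sinh r` is the hyperbolic cotangent of
`r = √(8/27) / ((n+1)(n+2))`. -/
def forcingTerms : Set (M.Point → ℝ) :=
  {h | M.IsSmooth h ∧ ∀ x : Hyp n,
    Real.cosh (Real.sqrt (8 / 27) * (1 / ((n + 1) * (n + 2)))) /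
        Real.sinh (Real.sqrt (8 / 27) * (1 / ((n + 1) * (n + 2)))) < h (M.proj x) ∧
    6 * M.gradNorm h x + 10 < h (M.proj x) ^ 2 ∧
    M.hessNorm h x / h (M.proj x) < 1 / 6}

end HyperbolicManifold

/-! ### Immersed spheres -/

/-- The standard `n`-dimensional sphere, with Mathlib's smooth structure. -/
abbrev Sph (n : ℕ) : Type := Metric.sphere (0 : EuclideanSpace ℝ (Fin (n + 1))) 1

/-- Smooth immersions of the sphere into hyperbolic space. -/
structure HypImmersion (n : ℕ) where
  toFun : Sph n → Hyp n
  smooth : ContMDiff (𝓡 n) 𝓘(ℝ, Mink n) ∞ (fun p => (toFun p : Mink n))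
  injective_mfderiv : ∀ p : Sph n, Function.Injective
    (mfderiv (𝓡 n) 𝓘(ℝ, Mink n) (fun p => (toFun p : Mink n)) p)

namespace HypImmersion

variable {n : ℕ}

/-- The immersion as a map into the ambient vector space. -/
def amb (f : HypImmersion n) (p : Sph n) : Mink n := (f.toFun p : Mink n)

/-- The differential at `p` of a map from the sphere to Minkowski space. -/
def diff (F : Sph n → Mink n) (p : Sph n) : TangentSpace (𝓡 n) p →ₗ[ℝ] Mink n :=
  (mfderiv (𝓡 n) 𝓘(ℝ, Mink n) F p).toLinearMap

theorem ker_diff (f : HypImmersion n) (p : Sph n) : LinearMap.ker (diff f.amb p) = ⊥ :=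
  LinearMap.ker_eq_bot.2 (f.injective_mfderiv p)

/-- `N` is a smooth unit normal vector field (tangent to hyperbolic space) over `f`. -/
structure IsUnitNormal (f : HypImmersion n) (N : Sph n → Mink n) : Prop where
  smooth : ContMDiff (𝓡 n) 𝓘(ℝ, Mink n) ∞ N
  tangent : ∀ p, mink (f.amb p) (N p) = 0
  unit : ∀ p, mink (N p) (N p) = 1
  normal : ∀ p v, mink (N p) (diff f.amb p v) = 0

/-- The shape operator `A` of `f` at `p` with respect to `N`: the endomorphism of the tangent space
such that `∇_v N = df(A v)`. Since `N` is tangent to hyperbolic space and orthogonal to `df(v)`,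
`∇_v N` is the ordinary derivative `dN(v)`, and it lies in the range of `df`; thus `A` is obtained
by applying any left inverse of `df` to it. -/
def shape (f : HypImmersion n) (N : Sph n → Mink n) (p : Sph n) :
    TangentSpace (𝓡 n) p →ₗ[ℝ] TangentSpace (𝓡 n) p :=
  ((diff f.amb p).exists_leftInverse_of_injective (f.ker_diff p)).choose ∘ₗ diff N p

/-- The mean curvature: the average of the principal curvatures. -/
def meanCurv (f : HypImmersion n) (N : Sph n → Mink n) (p : Sph n) : ℝ :=
  (1 / n) * LinearMap.trace ℝ (TangentSpace (𝓡 n) p) (f.shape N p)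

/-- The first fundamental form. -/
def firstForm (f : HypImmersion n) (p : Sph n) (v w : TangentSpace (𝓡 n) p) : ℝ :=
  mink (diff f.amb p v) (diff f.amb p w)

/-- `N` is the outward unit normal of the locally convex immersion `f`: the unit normal with respect
to which the shape operator is everywhere nonnegative. (An immersed closed hypersurface has at most
one such normal, because at a point furthest from a given point of hyperbolic space the shape
operator with respect to the normal pointing away from it is positive definite.) -/
def IsOutwardNormal (f : HypImmersion n) (N : Sph n → Mink n) : Prop :=
  f.IsUnitNormal N ∧ ∀ p v, 0 ≤ f.firstForm p (f.shape N p v) v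

/-- The shape operator with respect to the unit normal `N` is everywhere positive definite. -/
def IsLSCWith (f : HypImmersion n) (N : Sph n → Mink n) : Prop :=
  f.IsUnitNormal N ∧ ∀ p v, v ≠ 0 → 0 < f.firstForm p (f.shape N p v) v

/-- Locally strictly convex immersions. -/
def IsLSC (f : HypImmersion n) : Prop := ∃ N, f.IsLSCWith N

/-- Pointwise strictly `1/2`-pinched immersions: LSC immersions all of whose principal curvatures
are greater than half of the mean curvature. -/
def IsStrictlyHalfPinched (f : HypImmersion n) : Prop :=
  ∃ N, f.IsLSCWith N ∧ ∀ p (μ : ℝ), Module.End.HasEigenvalue (f.shape N p) μ →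
    (1 / 2) * f.meanCurv N p < μ

/-- The radius of the smallest closed geodesic ball containing the image. -/
def outradius (f : HypImmersion n) : ℝ :=
  sInf {r : ℝ | 0 ≤ r ∧ ∃ o : Hyp n, ∀ p, hypDist o (f.toFun p) ≤ r}

open Classical in
/-- The extension of a map on the sphere to `ℝⁿ⁺¹ ∖ {0}` that is constant along rays. -/
def radialExt (F : Sph n → Mink n) (x : EuclideanSpace ℝ (Fin (n + 1))) : Mink n :=
  if hx : x ≠ 0 then F ⟨‖x‖⁻¹ • x, by simp [norm_smul, hx]⟩ else 0

/-- The `C^∞` topology: uniform convergence over the sphere of all derivatives (of the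
extensions). -/
instance : TopologicalSpace (HypImmersion n) :=
  ⨅ m : ℕ, TopologicalSpace.induced
    (fun f : HypImmersion n => UniformFun.ofFun
      (fun p : Sph n => iteratedFDeriv ℝ m (radialExt f.amb) (p : EuclideanSpace ℝ (Fin (n + 1)))))
    inferInstance

end HypImmersion

/-! ### Immersed spheres in a hyperbolic manifold and forced mean curvature flow -/

namespace HyperbolicManifold

variable {n : ℕ} (M : HyperbolicManifold n)

/-- Two immersions into hyperbolic space are identified if they project to immersions into `M` which
are reparametrisations of one another. -/
def reparamSetoid : Setoid (HypImmersion n) where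
  r f f' := ∃ φ : Diffeomorph (𝓡 n) (𝓡 n) (Sph n) (Sph n) ∞,
    ∀ p, M.proj (f'.toFun p) = M.proj (f.toFun (φ p))
  iseqv :=
    { refl := fun f => ⟨Diffeomorph.refl _ _ _, fun p => rfl⟩
      symm := by
        rintro f f' ⟨φ, h⟩
        exact ⟨φ.symm, fun p => by rw [h, Diffeomorph.apply_symm_apply]⟩
      trans := by
        rintro f f' f'' ⟨φ, h⟩ ⟨ψ, h'⟩
        exact ⟨ψ.trans φ, fun p => by rw [h', h]; rfl⟩ }

/-- Reparametrisation classes `[i]` of immersions `i` of the sphere into `M`, given by their lifts to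
hyperbolic space, with the quotient of the `C^∞` topology. (For `n ≥ 2` the sphere is simply
connected and every immersion into `M` has a lift.) -/
abbrev ImmersionClass : Type := Quotient M.reparamSetoid

/-- The class `[i]` of the projection `i` to `M` of the immersion `f`. -/
def cls (f : HypImmersion n) : M.ImmersionClass := Quotient.mk M.reparamSetoid f

/-- The classes of pointwise strictly `1/2`-pinched immersions of outradius less than
`artanh (1/√3)`. -/
def pinchedSpace : Set M.ImmersionClass :=
  {c | ∃ f, M.cls f = c ∧ f.IsStrictlyHalfPinched ∧ f.outradius < Real.artanh (1 / Real.sqrt 3)}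

/-- `I` is an eternal forced mean curvature flow with forcing term `h`: locally in time, `I` is
represented by a smooth family `F` of immersions with
`⟨∂ₜF, N⟩ = h ∘ F - H(F)`, where `N` is the outward unit normal. -/
def IsTrajectory (h : M.Point → ℝ) (I : ℝ → M.ImmersionClass) : Prop :=
  ∀ t₀ : ℝ, ∃ a b : ℝ, a < t₀ ∧ t₀ < b ∧ ∃ F : ℝ → HypImmersion n,
    ContMDiffOn (𝓘(ℝ, ℝ).prod (𝓡 n)) 𝓘(ℝ, Mink n) ∞
      (fun q : ℝ × Sph n => (F q.1).amb q.2) (Set.Ioo a b ×ˢ Set.univ) ∧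
    ∀ t ∈ Set.Ioo a b, M.cls (F t) = I t ∧
      ∃ N, (F t).IsOutwardNormal N ∧ ∀ p : Sph n,
        mink (deriv (fun s => (F s).amb p) t) (N p) =
          h (M.proj ((F t).toFun p)) - (F t).meanCurv N p

end HyperbolicManifold

end

/-!
The idea is a maximum principle for the second fundamental form, applied at a single point. Every
`I t` is a limit of classes of pinched immersions, hence weakly pinched: `H/2 ≤ l` for every
principal curvature `l`. This passes to the closure because pinching can be tested on the 2-jet of
an immersion, the unit normals of nearby immersions being bounded (`pinchedAt_of_mem_closure`).
It remains to exclude equality for some principal curvature `l i₀` at some time `t₀` and point.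

Near that point the flow is written as a family of graphs over the tangent hyperplane in the Klein
model: in a Lorentz frame `o, e i, ν` formed by the position, the principal directions and the
inward normal, the immersions are `A • (o + ∑ y i • e i + u (t, y) • ν)` with `A` fixed by the
hyperboloid equation (`exists_graph`, by the inverse function theorem). In such coordinates the
second fundamental form is, up to a positive factor, the plain Hessian of `u`, and the flow reads
`∂ₜ u = L - √(W * Q) * κ`. Here `L = traceHess u` is a weighted trace of the Hessian, `κ` is the
forcing term, and `W = normalSq u`, `Q = pointSq u` are explicit in the 1-jet of `u`
(`geometry_of_graph`, `mink_deriv_eq_of_parametrisation`). The pinching inequality says that the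
defect `∂ᵢ∂ᵢ u - L * g i i / 2`, for `i = i₀`, is nonnegative near the base point, where it vanishes.
Since the flow exists before and after `t₀`, the time derivative of the defect vanishes there as well,
and its second space derivatives are nonnegative. Together with the evolution equation this gives an
inequality between the principal curvatures and the forcing term with its Hessian
(`KleinGraph.reaction_le`), which the conditions `2 < h` and `‖D²h‖ < h / 6` contradict
(`reaction_pos`). All derivatives involved are computed from 2-jets along lines (`HasJet`).

So the representatives of the flow are strictly pinched (`isStrictlyPinchedWith_of_flow`). Any other
representative of the same class differs from them by a diffeomorphism of the sphere and a deck
transformation (`exists_deck_of_cls_eq`), which preserve this property.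
-/

noncomputable section

/-! ### Linear algebra of the Minkowski form -/

/-- The Minkowski form as a bilinear form. -/
def minkForm (n : ℕ) : LinearMap.BilinForm ℝ (Mink n) :=
  LinearMap.mk₂ ℝ mink
    (by intros; simp only [mink, Prod.fst_add, Prod.snd_add, inner_add_left]; ring)
    (by intros; simp only [mink, Prod.smul_fst, Prod.smul_snd, real_inner_smul_left, smul_eq_mul]
        ring)
    (by intros; simp only [mink, Prod.fst_add, Prod.snd_add, inner_add_right]; ring)
    (by intros; simp only [mink, Prod.smul_fst, Prod.smul_snd, real_inner_smul_right, smul_eq_mul]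
        ring)

section MinkAlgebra

variable {n : ℕ}

theorem mink_comm (x y : Mink n) : mink x y = mink y x := by
  simp only [mink, real_inner_comm, mul_comm]

@[simp] theorem mink_add_left (x y z : Mink n) : mink (x + y) z = mink x z + mink y z :=
  LinearMap.map_add₂ (minkForm n) x y z

@[simp] theorem mink_add_right (x y z : Mink n) : mink x (y + z) = mink x y + mink x z :=
  map_add (minkForm n x) y z

@[simp] theorem mink_smul_left (c : ℝ) (x y : Mink n) : mink (c • x) y = c * mink x y :=
  LinearMap.map_smul₂ (minkForm n) c x y

@[simp] theorem mink_smul_right (c : ℝ) (x y : Mink n) : mink x (c • y) = c * mink x y :=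
  map_smul (minkForm n x) c y

@[simp] theorem mink_neg_left (x y : Mink n) : mink (-x) y = -mink x y :=
  LinearMap.map_neg₂ (minkForm n) x y

@[simp] theorem mink_neg_right (x y : Mink n) : mink x (-y) = -mink x y :=
  map_neg (minkForm n x) y

@[simp] theorem mink_zero_right (x : Mink n) : mink x 0 = 0 :=
  map_zero (minkForm n x)

/-- The Leibniz rule for the Minkowski form. -/
theorem HasFDerivAt.mink {V : Type*} [NormedAddCommGroup V] [NormedSpace ℝ V]
    {f g : V → Mink n} {f' g' : V →L[ℝ] Mink n} {x : V}
    (hf : HasFDerivAt f f' x) (hg : HasFDerivAt g g' x) :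
    ∃ D : V →L[ℝ] ℝ, HasFDerivAt (fun y => mink (f y) (g y)) D x ∧
      ∀ v, D v = mink (f x) (g' v) + mink (f' v) (g x) := by
  let B : Mink n →L[ℝ] Mink n →L[ℝ] ℝ :=
    LinearMap.toContinuousLinearMap
      ((LinearMap.toContinuousLinearMap : (Mink n →ₗ[ℝ] ℝ) ≃ₗ[ℝ] _).toLinearMap ∘ₗ minkForm n)
  exact ⟨_, B.hasFDerivAt_of_bilinear hf hg, fun v => rfl⟩

theorem HasDerivAt.mink {f g : ℝ → Mink n} {f' g' : Mink n} {x : ℝ}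
    (hf : HasDerivAt f f' x) (hg : HasDerivAt g g' x) :
    HasDerivAt (fun y => mink (f y) (g y)) (mink (f x) g' + mink f' (g x)) x := by
  obtain ⟨D, hD, hD'⟩ := hf.hasFDerivAt.mink hg.hasFDerivAt
  have := hD.hasDerivAt
  rw [hD'] at this
  simpa using this

/-- A vector orthogonal to a point of hyperbolic space has time coordinate controlled by its
Minkowski norm. -/
theorem snd_sq_le_of_mink_eq_zero (x : Hyp n) {v : Mink n} (hv : mink (x : Mink n) v = 0) :
    v.2 ^ 2 ≤ mink v v * ((x : Mink n).2 ^ 2 - 1) := by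
  obtain ⟨⟨a, b⟩, hx1, hx2⟩ := x
  obtain ⟨c, d⟩ := v
  unfold mink at *
  dsimp only at *
  have hC := real_inner_mul_inner_self_le a c
  have e1 : inner ℝ a a = b * b - 1 := by linarith
  have e3 : inner ℝ a c = b * d := by linarith
  rw [e1, e3] at hC
  nlinarith

theorem one_le_snd_sq (x : Hyp n) : 1 ≤ (x : Mink n).2 ^ 2 := by
  obtain ⟨⟨a, b⟩, hx1, hx2⟩ := x
  unfold mink at *
  dsimp only at *
  nlinarith [real_inner_self_nonneg (x := a)]

/-- The Minkowski form is positive definite on the tangent spaces of hyperbolic space. -/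
theorem mink_self_pos (x : Hyp n) {v : Mink n} (hv : mink (x : Mink n) v = 0) (h0 : v ≠ 0) :
    0 < mink v v := by
  have h1 := snd_sq_le_of_mink_eq_zero x hv
  by_contra! hle
  have h2 : v.2 = 0 := by
    have := one_le_snd_sq x
    have : v.2 ^ 2 ≤ 0 := h1.trans (mul_nonpos_of_nonpos_of_nonneg hle (by linarith))
    exact pow_eq_zero_iff (two_ne_zero) |>.1 (le_antisymm this (sq_nonneg _))
  have h3 : v.1 = 0 := by
    simp only [mink, h2] at hle
    have : inner ℝ v.1 v.1 ≤ 0 := by linarith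
    exact inner_self_eq_zero.1 (le_antisymm this real_inner_self_nonneg)
  exact h0 (Prod.ext h3 h2)

theorem finrank_mink : Module.finrank ℝ (Mink n) = n + 2 := by
  simp

/-- A point of hyperbolic space, a unit normal and an `n`-dimensional tangent space orthogonal to
both span Minkowski space. -/
theorem exists_decomposition (x : Hyp n) {N : Mink n} (hxN : mink (x : Mink n) N = 0)
    (hN : mink N N = 1) {V : Type*} [AddCommGroup V] [Module ℝ V] [FiniteDimensional ℝ V]
    (hV : Module.finrank ℝ V = n) (D : V →ₗ[ℝ] Mink n) (hD : Function.Injective D)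
    (hxD : ∀ v, mink (x : Mink n) (D v) = 0) (hND : ∀ v, mink N (D v) = 0) (w : Mink n) :
    ∃ (c : ℝ) (v : V) (z : ℝ), w = c • (x : Mink n) + D v + z • N := by
  let Ψ : (ℝ × V) × ℝ →ₗ[ℝ] Mink n :=
    ((LinearMap.toSpanSingleton ℝ _ (x : Mink n)).coprod D).coprod
      (LinearMap.toSpanSingleton ℝ _ N)
  have hΨ : ∀ c v z, Ψ ((c, v), z) = c • (x : Mink n) + D v + z • N := fun c v z => by
    simp [Ψ]
  have hinj : Function.Injective Ψ := by
    rw [← LinearMap.ker_eq_bot, LinearMap.ker_eq_bot']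
    rintro ⟨⟨c, v⟩, z⟩ h
    rw [hΨ] at h
    have h1 := congrArg (mink (x : Mink n)) h
    have h2 := congrArg (mink N) h
    simp only [mink_add_right, mink_smul_right, mink_zero_right, x.2.1, hxD, hxN, hND, hN,
      mink_comm N (x : Mink n)] at h1 h2
    have hc : c = 0 := by linarith
    have hz : z = 0 := by linarith
    subst hc hz
    have hv : v = 0 := hD (by simpa using h)
    simp [hv]
  have hdim : Module.finrank ℝ ((ℝ × V) × ℝ) = Module.finrank ℝ (Mink n) := by
    rw [finrank_mink]
    simp only [Module.finrank_prod, Module.finrank_self, hV]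
    ring
  obtain ⟨⟨⟨c, v⟩, z⟩, h⟩ := (LinearMap.injective_iff_surjective_of_finrank_eq_finrank hdim).1 hinj w
  exact ⟨c, v, z, by rw [← h, hΨ]⟩

end MinkAlgebra

/-! ### Symmetric endomorphisms -/

section Spectral

variable {V : Type*} [AddCommGroup V] [Module ℝ V] [FiniteDimensional ℝ V] {n : ℕ}

/-- The spectral theorem for an endomorphism which is symmetric with respect to a positive definite
bilinear form. -/
theorem exists_orthonormal_eigenbasis (hV : Module.finrank ℝ V = n) (B : LinearMap.BilinForm ℝ V)
    (hsymm : ∀ v w, B v w = B w v) (hpos : ∀ v, v ≠ 0 → 0 < B v v) (T : V →ₗ[ℝ] V)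
    (hT : ∀ v w, B (T v) w = B v (T w)) :
    ∃ (e : Module.Basis (Fin n) ℝ V) (l : Fin n → ℝ),
      (∀ i j, B (e i) (e j) = if i = j then 1 else 0) ∧ ∀ i, T (e i) = l i • e i := by
  let cd : InnerProductSpace.Core ℝ V :=
    { inner := fun v w => B v w
      conj_inner_symm := fun v w => hsymm w v
      re_inner_nonneg := fun v => by
        rcases eq_or_ne v 0 with rfl | h
        · simp
        · exact (hpos v h).le
      add_left := fun x y z => LinearMap.map_add₂ B x y z
      smul_left := fun x y r => by simp
      definite := fun v h => by
        by_contra h0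
        exact (hpos v h0).ne' h }
  let _ : NormedAddCommGroup V := cd.toNormedAddCommGroup
  let _ : InnerProductSpace ℝ V := InnerProductSpace.ofCore cd.toCore
  have hT' : T.IsSymmetric := fun v w => hT v w
  refine ⟨(hT'.eigenvectorBasis hV).toBasis, hT'.eigenvalues hV, fun i j => ?_, fun i => ?_⟩
  · have := orthonormal_iff_ite.1 (hT'.eigenvectorBasis hV).orthonormal i j
    rw [OrthonormalBasis.coe_toBasis]
    exact this
  · rw [OrthonormalBasis.coe_toBasis]
    exact hT'.apply_eigenvectorBasis hV i

/-- The trace of an endomorphism in terms of the Gram matrix of `n` vectors, `n` being the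
dimension. -/
theorem trace_eq_trace_gram (hV : Module.finrank ℝ V = n) (B : LinearMap.BilinForm ℝ V)
    (T : V →ₗ[ℝ] V) (v : Fin n → V)
    (hdet : (Matrix.of fun i j => B (v i) (v j)).det ≠ 0) :
    LinearMap.trace ℝ V T =
      ((Matrix.of fun i j => B (v i) (v j))⁻¹ * Matrix.of fun i j => B (v i) (T (v j))).trace := by
  set g : Matrix (Fin n) (Fin n) ℝ := Matrix.of fun i j => B (v i) (v j) with hg
  have hunit : IsUnit g.det := isUnit_iff_ne_zero.2 hdet
  have hli : LinearIndependent ℝ v := by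
    rw [Fintype.linearIndependent_iff]
    intro c hc
    have : g.mulVec c = 0 := by
      ext i
      have h1 := congrArg (B (v i)) hc
      simpa [hg, Matrix.mulVec, dotProduct, mul_comm] using h1
    have h2 := Matrix.eq_zero_of_mulVec_eq_zero hdet this
    exact fun i => congrFun h2 i
  let b : Module.Basis (Fin n) ℝ V :=
    basisOfLinearIndependentOfCardEqFinrank' v hli (by rw [hV, Fintype.card_fin])
  have hb : ∀ i, b i = v i := fun i => by simp [b]
  have key : (Matrix.of fun i j => B (v i) (T (v j))) = g * LinearMap.toMatrix b b T := by
    ext i j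
    have h1 := b.sum_repr (T (v j))
    rw [Matrix.of_apply, ← h1]
    simp only [map_sum, map_smul, hb, Matrix.mul_apply, LinearMap.toMatrix_apply, smul_eq_mul, hg,
      Matrix.of_apply]
    exact Finset.sum_congr rfl fun k _ => mul_comm _ _
  rw [key, ← Matrix.mul_assoc, Matrix.nonsing_inv_mul _ hunit, Matrix.one_mul,
    LinearMap.trace_eq_matrix_trace ℝ b]

end Spectral

/-! ### The shape operator of an immersed sphere -/

section Shape

variable {n : ℕ}

instance (p : Sph n) : FiniteDimensional ℝ (TangentSpace (𝓡 n) p) :=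
  inferInstanceAs (FiniteDimensional ℝ (EuclideanSpace ℝ (Fin n)))

theorem finrank_tangentSpace_sph (p : Sph n) :
    Module.finrank ℝ (TangentSpace (𝓡 n) p) = n :=
  finrank_euclideanSpace_fin (𝕜 := ℝ) (n := n)

namespace HypImmersion

theorem mink_diff_add_of_const {F G : Sph n → Mink n} {p : Sph n}
    (hF : MDifferentiableAt (𝓡 n) 𝓘(ℝ, Mink n) F p)
    (hG : MDifferentiableAt (𝓡 n) 𝓘(ℝ, Mink n) G p) {c : ℝ} (h : ∀ q, mink (F q) (G q) = c)
    (v : TangentSpace (𝓡 n) p) :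
    mink (F p) (diff G p v) + mink (diff F p v) (G p) = 0 := by
  -- In the extended chart at `p`, in terms of which `mfderiv` is defined, this is the product rule.
  have h1 : HasFDerivAt (F ∘ (extChartAt (𝓡 n) p).symm) (mfderiv (𝓡 n) 𝓘(ℝ, Mink n) F p)
      (extChartAt (𝓡 n) p p) := by
    refine hasFDerivWithinAt_univ.1 ?_
    simpa [chartAt_self_eq] using hF.hasMFDerivAt.2
  have h2 : HasFDerivAt (G ∘ (extChartAt (𝓡 n) p).symm) (mfderiv (𝓡 n) 𝓘(ℝ, Mink n) G p)
      (extChartAt (𝓡 n) p p) := by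
    refine hasFDerivWithinAt_univ.1 ?_
    simpa [chartAt_self_eq] using hG.hasMFDerivAt.2
  obtain ⟨D, hD, hD'⟩ := h1.mink h2
  have h3 : (fun y => mink ((F ∘ (extChartAt (𝓡 n) p).symm) y)
      ((G ∘ (extChartAt (𝓡 n) p).symm) y)) = fun _ => c := funext fun y => h _
  rw [h3] at hD
  have h4 := hD' v
  rw [hD.unique (hasFDerivAt_const c _)] at h4
  simp only [Function.comp_apply, extChartAt_to_inv] at h4
  exact h4.symm

variable {f : HypImmersion n} {N : Sph n → Mink n}

theorem mdifferentiableAt_amb (f : HypImmersion n) (p : Sph n) :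
    MDifferentiableAt (𝓡 n) 𝓘(ℝ, Mink n) f.amb p :=
  (f.smooth p).mdifferentiableAt (by simp)

theorem IsUnitNormal.mdifferentiableAt (hN : f.IsUnitNormal N) (p : Sph n) :
    MDifferentiableAt (𝓡 n) 𝓘(ℝ, Mink n) N p :=
  (hN.smooth p).mdifferentiableAt (by simp)

theorem mink_amb_self (f : HypImmersion n) (p : Sph n) : mink (f.amb p) (f.amb p) = -1 :=
  (f.toFun p).2.1

theorem mink_amb_diff (f : HypImmersion n) (p : Sph n) (v : TangentSpace (𝓡 n) p) :
    mink (f.amb p) (diff f.amb p v) = 0 := by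
  have h := mink_diff_add_of_const (f.mdifferentiableAt_amb p) (f.mdifferentiableAt_amb p)
    f.mink_amb_self v
  rw [mink_comm (diff f.amb p v)] at h
  linarith

theorem injective_diff (f : HypImmersion n) (p : Sph n) : Function.Injective (diff f.amb p) :=
  f.injective_mfderiv p

theorem IsUnitNormal.exists_decomposition (hN : f.IsUnitNormal N) (p : Sph n) (w : Mink n) :
    ∃ (c : ℝ) (v : TangentSpace (𝓡 n) p) (z : ℝ), w = c • f.amb p + diff f.amb p v + z • N p :=
  _root_.exists_decomposition (f.toFun p) (hN.tangent p) (hN.unit p) (finrank_tangentSpace_sph p)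
    (diff f.amb p) (f.injective_diff p) (f.mink_amb_diff p) (hN.normal p) w

theorem IsUnitNormal.exists_diff_eq (hN : f.IsUnitNormal N) (p : Sph n) {w : Mink n}
    (h1 : mink (f.amb p) w = 0) (h2 : mink (N p) w = 0) : ∃ v, diff f.amb p v = w := by
  obtain ⟨c, v, z, rfl⟩ := hN.exists_decomposition p w
  simp only [mink_add_right, mink_smul_right, f.mink_amb_self, f.mink_amb_diff, hN.tangent,
    hN.normal, hN.unit, mink_comm (N p) (f.amb p)] at h1 h2
  have hc : c = 0 := by linarith
  have hz : z = 0 := by linarith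
  exact ⟨v, by simp [hc, hz]⟩

/-- The Weingarten equation, which characterises the shape operator. -/
theorem IsUnitNormal.diff_shape (hN : f.IsUnitNormal N) (p : Sph n) (v : TangentSpace (𝓡 n) p) :
    diff f.amb p (f.shape N p v) = diff N p v := by
  have h1 := mink_diff_add_of_const (f.mdifferentiableAt_amb p) (hN.mdifferentiableAt p)
    hN.tangent v
  have h2 := mink_diff_add_of_const (hN.mdifferentiableAt p) (hN.mdifferentiableAt p) hN.unit v
  rw [mink_comm _ (N p), hN.normal] at h1
  rw [mink_comm _ (N p)] at h2
  obtain ⟨w, hw⟩ := hN.exists_diff_eq p (by linarith : mink (f.amb p) (diff N p v) = 0)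
    (by linarith)
  have h3 := ((diff f.amb p).exists_leftInverse_of_injective (f.ker_diff p)).choose_spec
  have h4 : f.shape N p v = w := by
    rw [shape, LinearMap.comp_apply, ← hw]
    exact congrArg (fun L => L w) h3
  rw [h4, hw]

theorem IsUnitNormal.firstForm_shape (hN : f.IsUnitNormal N) (p : Sph n)
    (v w : TangentSpace (𝓡 n) p) :
    f.firstForm p (f.shape N p v) w = mink (diff N p v) (diff f.amb p w) := by
  rw [firstForm, hN.diff_shape]

/-- The first fundamental form as a bilinear form. -/
def firstBilin (f : HypImmersion n) (p : Sph n) : LinearMap.BilinForm ℝ (TangentSpace (𝓡 n) p) :=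
  (minkForm n).comp (diff f.amb p) (diff f.amb p)

theorem firstBilin_apply (f : HypImmersion n) (p : Sph n) (v w : TangentSpace (𝓡 n) p) :
    f.firstBilin p v w = f.firstForm p v w := rfl

theorem firstForm_comm (f : HypImmersion n) (p : Sph n) (v w : TangentSpace (𝓡 n) p) :
    f.firstForm p v w = f.firstForm p w v := mink_comm _ _

theorem firstForm_self_pos (f : HypImmersion n) (p : Sph n) {v : TangentSpace (𝓡 n) p}
    (hv : v ≠ 0) : 0 < f.firstForm p v v :=
  mink_self_pos (f.toFun p) (f.mink_amb_diff p v)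
    ((map_ne_zero_iff _ (f.injective_diff p)).2 hv)

/-- A unit vector orthogonal to the point and to the tangent space of an immersion is one of the
two unit normals. -/
theorem IsUnitNormal.eq_or_eq_neg (hN : f.IsUnitNormal N) (p : Sph n) {w : Mink n}
    (h1 : mink (f.amb p) w = 0) (h2 : mink w w = 1) (h3 : ∀ v, mink w (diff f.amb p v) = 0) :
    w = N p ∨ w = -N p := by
  obtain ⟨c, v, z, hw⟩ := hN.exists_decomposition p w
  have hc : c = 0 := by
    have h := h1
    rw [hw] at h
    simp only [mink_add_right, mink_smul_right, f.mink_amb_self, f.mink_amb_diff, hN.tangent] at h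
    linarith
  have hv : v = 0 := by
    by_contra hv
    have h := h3 v
    rw [hw] at h
    simp only [mink_add_left, mink_smul_left, f.mink_amb_diff, hN.normal] at h
    have := f.firstForm_self_pos p hv
    rw [firstForm] at this
    linarith
  have hwz : w = z • N p := by rw [hw, hc, hv]; simp
  rw [hwz, mink_smul_left, mink_smul_right, hN.unit] at h2
  rcases mul_self_eq_one_iff.1 (by linarith : z * z = 1) with rfl | rfl
  · left; simpa using hwz
  · right; simpa using hwz

end HypImmersion

end Shape

/-! ### Radial projection to the sphere -/

section Radial

variable {n : ℕ}

/-- Radial projection of the punctured Euclidean space to the sphere, extended by an arbitrary value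
to the origin. -/
def toSph (x : EuclideanSpace ℝ (Fin (n + 1))) : Sph n :=
  if hx : x ≠ 0 then ⟨‖x‖⁻¹ • x, by simp [norm_smul, hx]⟩
  else ⟨EuclideanSpace.single 0 1, by simp⟩

theorem coe_toSph {x : EuclideanSpace ℝ (Fin (n + 1))} (hx : x ≠ 0) :
    (toSph x : EuclideanSpace ℝ (Fin (n + 1))) = ‖x‖⁻¹ • x := by
  simp [toSph, hx]

theorem coe_sph_ne_zero (p : Sph n) : (p : EuclideanSpace ℝ (Fin (n + 1))) ≠ 0 := by
  have : ‖(p : EuclideanSpace ℝ (Fin (n + 1)))‖ = 1 := by simp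
  intro h
  rw [h] at this
  simp at this

@[simp] theorem toSph_coe (p : Sph n) : toSph (p : EuclideanSpace ℝ (Fin (n + 1))) = p := by
  apply Subtype.ext
  rw [coe_toSph (coe_sph_ne_zero p)]
  simp

theorem HypImmersion.radialExt_eq (F : Sph n → Mink n) {x : EuclideanSpace ℝ (Fin (n + 1))}
    (hx : x ≠ 0) : HypImmersion.radialExt F x = F (toSph x) := by
  simp [HypImmersion.radialExt, toSph, hx]

/-- Near a nonzero point, the radial projection agrees with the radial projection of a globally
defined smooth map without zeros, to which `ContMDiff.codRestrict_sphere` applies. -/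
theorem contMDiffAt_toSph {x : EuclideanSpace ℝ (Fin (n + 1))} (hx : x ≠ 0) :
    ContMDiffAt 𝓘(ℝ, EuclideanSpace ℝ (Fin (n + 1))) (𝓡 n) ∞ toSph x := by
  have hpos : 0 < ‖x‖ := norm_pos_iff.2 hx
  let b : ContDiffBump x := ⟨‖x‖ / 4, ‖x‖ / 2, by positivity, by linarith⟩
  let χ : EuclideanSpace ℝ (Fin (n + 1)) → EuclideanSpace ℝ (Fin (n + 1)) :=
    fun y => x + b y • (y - x)
  have hχ : ContDiff ℝ ∞ χ :=
    contDiff_const.add (b.contDiff.smul (contDiff_id.sub contDiff_const))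
  have hχ0 : ∀ y, χ y ≠ 0 := by
    intro y h
    have h1 : ‖b y • (y - x)‖ ≤ ‖x‖ / 2 := by
      rw [norm_smul, Real.norm_of_nonneg b.nonneg]
      by_cases hy : y ∈ Metric.ball x (‖x‖ / 2)
      · rw [Metric.mem_ball, dist_eq_norm] at hy
        calc b y * ‖y - x‖ ≤ 1 * ‖y - x‖ := by gcongr; exact b.le_one
          _ ≤ _ := by linarith
      · rw [b.zero_of_le_dist (by simpa using hy)]
        simp only [zero_mul]
        positivity
    have h2 : b y • (y - x) = -x := eq_neg_of_add_eq_zero_right h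
    rw [h2, norm_neg] at h1
    linarith
  have hg : ContDiff ℝ ∞ (fun y => ‖χ y‖⁻¹ • χ y) :=
    ((hχ.norm ℝ hχ0).inv fun y => norm_ne_zero_iff.2 (hχ0 y)).smul hχ
  have hmem : ∀ y, ‖χ y‖⁻¹ • χ y ∈ Metric.sphere (0 : EuclideanSpace ℝ (Fin (n + 1))) 1 := by
    intro y
    simp [norm_smul, hχ0 y]
  have := Fact.mk (finrank_euclideanSpace_fin (𝕜 := ℝ) (n := n + 1))
  have h1 := (ContMDiff.codRestrict_sphere (n := n) hg.contMDiff hmem).contMDiffAt (x := x)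
  refine h1.congr_of_eventuallyEq ?_
  have hev : ∀ᶠ y in 𝓝 x, y ≠ 0 := isOpen_ne.mem_nhds hx
  filter_upwards [b.eventuallyEq_one, hev] with y hy hy0
  apply Subtype.ext
  rw [coe_toSph hy0]
  have : χ y = y := by simp [χ, hy]
  simp [this]

end Radial

/-! ### Reparametrisations and deck transformations -/

section Transport

variable {n : ℕ} {M : HyperbolicManifold n}

theorem continuous_amb (f : HypImmersion n) : Continuous f.amb := f.smooth.continuous

theorem HypImmersion.continuous_toFun (f : HypImmersion n) : Continuous f.toFun :=
  continuous_induced_rng.2 (continuous_amb f)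

/-- Two lifts of the same class differ by a single deck transformation and a diffeomorphism of the
sphere. The deck transformation, which a priori depends on the point, is constant since it takes
finitely many values, each of them on a closed set, and the sphere is connected. -/
theorem exists_deck_of_cls_eq (hn : 1 ≤ n) {f f' : HypImmersion n} (h : M.cls f = M.cls f') :
    ∃ g ∈ M.deck, ∃ φ : Diffeomorph (𝓡 n) (𝓡 n) (Sph n) (Sph n) ∞,
      ∀ p, f'.amb p = g (f.amb (φ p)) := by
  obtain ⟨φ, hφ⟩ : M.reparamSetoid.r f f' := Quotient.exact h
  have hex : ∀ p, ∃ g ∈ M.deck, g (f.amb (φ p)) = f'.amb p := fun p =>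
    (Quotient.exact (hφ p).symm : M.orbitSetoid.r (f.toFun (φ p)) (f'.toFun p))
  let S : (Mink n ≃ₗ[ℝ] Mink n) → Set (Sph n) := fun g => {p | g (f.amb (φ p)) = f'.amb p}
  have hclosed : ∀ g, IsClosed (S g) := fun g => by
    refine isClosed_eq ?_ (continuous_amb f')
    have hg : Continuous g := LinearMap.continuous_of_finiteDimensional g.toLinearMap
    exact hg.comp ((continuous_amb f).comp φ.continuous)
  let K : Set (Hyp n) := Set.range f.toFun ∪ Set.range f'.toFun
  have hK : IsCompact K :=
    (isCompact_range f.continuous_toFun).union (isCompact_range f'.continuous_toFun)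
  have hfin := M.proper K hK
  set T : Set (Mink n ≃ₗ[ℝ] Mink n) :=
    {g | g ∈ M.deck ∧ ∃ x ∈ K, ∃ y ∈ K, g (x : Mink n) = (y : Mink n)} with hT
  have hST : ∀ g ∈ M.deck, (S g).Nonempty → g ∈ T := fun g hg ⟨p, hp⟩ =>
    ⟨hg, _, Or.inl ⟨φ p, rfl⟩, _, Or.inr ⟨p, rfl⟩, hp⟩
  have hdisj : ∀ g ∈ M.deck, ∀ g' ∈ M.deck, ∀ p, p ∈ S g → p ∈ S g' → g = g' := by
    intro g hg g' hg' p hp hp'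
    have h1 : (g'⁻¹ * g) (f.amb (φ p)) = f.amb (φ p) := by
      have : g (f.amb (φ p)) = g' (f.amb (φ p)) := Eq.trans hp (Eq.symm hp')
      rw [LinearEquiv.mul_apply, this]
      exact g'.symm_apply_apply _
    have h2 := M.free _ (M.deck.mul_mem (M.deck.inv_mem hg') hg) (f.toFun (φ p)) h1
    exact (inv_mul_eq_one.1 h2).symm
  have hrank : 1 < Module.rank ℝ (EuclideanSpace ℝ (Fin (n + 1))) := by
    rw [rank_eq_card_basis (EuclideanSpace.basisFun (Fin (n + 1)) ℝ).toBasis, Fintype.card_fin]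
    exact_mod_cast (by omega : 1 < n + 1)
  have : PreconnectedSpace (Sph n) :=
    isPreconnected_iff_preconnectedSpace.1 (isPreconnected_sphere hrank 0 1)
  let p₀ : Sph n := toSph 0
  obtain ⟨g, hg, hgp⟩ := hex p₀
  refine ⟨g, hg, φ, ?_⟩
  have hcompl : (S g)ᶜ = ⋃ g' ∈ T \ {g}, S g' := by
    ext p
    simp only [Set.mem_compl_iff, Set.mem_iUnion, exists_prop]
    constructor
    · intro hp
      obtain ⟨g', hg', hp'⟩ := hex p
      refine ⟨g', ⟨hST g' hg' ⟨p, hp'⟩, ?_⟩, hp'⟩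
      rintro rfl
      exact hp hp'
    · rintro ⟨g', ⟨hg', hne⟩, hp'⟩ hp
      exact hne (hdisj g' hg'.1 g hg p hp' hp)
  have hopen : IsOpen (S g) := by
    rw [← isClosed_compl_iff, hcompl]
    exact (hfin.subset Set.sdiff_subset).isClosed_biUnion fun g' _ => hclosed g'
  have huniv : S g = Set.univ := IsClopen.eq_univ ⟨hclosed g, hopen⟩ ⟨p₀, hgp⟩
  intro p
  exact (Set.eq_univ_iff_forall.1 huniv p).symm

namespace HypImmersion

variable {f f' : HypImmersion n} {N : Sph n → Mink n}
  {φ : Diffeomorph (𝓡 n) (𝓡 n) (Sph n) (Sph n) ∞} {g : Mink n ≃ₗ[ℝ] Mink n}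

theorem diff_linear_comp {F F' : Sph n → Mink n} {p : Sph n}
    (hF : MDifferentiableAt (𝓡 n) 𝓘(ℝ, Mink n) F (φ p))
    (h : ∀ q, F' q = g (F (φ q))) (v : TangentSpace (𝓡 n) p) :
    diff F' p v = g (diff F (φ p) (mfderiv (𝓡 n) (𝓡 n) φ p v)) := by
  have hφ : MDifferentiableAt (𝓡 n) (𝓡 n) φ p := φ.mdifferentiable (by simp) p
  let G : Mink n →L[ℝ] Mink n := LinearMap.toContinuousLinearMap g.toLinearMap
  have h1 : HasMFDerivAt (𝓡 n) 𝓘(ℝ, Mink n) (G ∘ F ∘ φ) p _ :=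
    G.hasMFDerivAt.comp p (hF.hasMFDerivAt.comp p hφ.hasMFDerivAt)
  have h2 : F' = G ∘ F ∘ φ := funext h
  rw [diff, h2, h1.mfderiv]
  rfl

theorem bijective_mfderiv_diffeomorph (p : Sph n) :
    Function.Bijective (mfderiv (𝓡 n) (𝓡 n) φ p) :=
  (φ.mfderivToContinuousLinearEquiv (by simp) p).bijective

/-- Transport of a unit normal field by a diffeomorphism and a Lorentz transformation. -/
theorem IsUnitNormal.transport (hN : f.IsUnitNormal N)
    (hg : ∀ x y, mink (g x) (g y) = mink x y) (h : ∀ p, f'.amb p = g (f.amb (φ p))) :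
    f'.IsUnitNormal (fun p => g (N (φ p))) where
  smooth := by
    let G : Mink n →L[ℝ] Mink n := LinearMap.toContinuousLinearMap g.toLinearMap
    exact G.contDiff.contMDiff.comp (hN.smooth.comp φ.contMDiff)
  tangent p := by rw [h, hg, hN.tangent]
  unit p := by rw [hg, hN.unit]
  normal p v := by
    rw [diff_linear_comp (f.mdifferentiableAt_amb _) h, hg, hN.normal]

theorem firstForm_transport (hg : ∀ x y, mink (g x) (g y) = mink x y)
    (h : ∀ p, f'.amb p = g (f.amb (φ p))) (p : Sph n) (v w : TangentSpace (𝓡 n) p) :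
    f'.firstForm p v w = f.firstForm (φ p) (mfderiv (𝓡 n) (𝓡 n) φ p v)
      (mfderiv (𝓡 n) (𝓡 n) φ p w) := by
  simp only [firstForm]
  rw [diff_linear_comp (f.mdifferentiableAt_amb _) h, diff_linear_comp (f.mdifferentiableAt_amb _) h,
    hg]

theorem IsUnitNormal.shape_transport (hN : f.IsUnitNormal N)
    (hg : ∀ x y, mink (g x) (g y) = mink x y) (h : ∀ p, f'.amb p = g (f.amb (φ p))) (p : Sph n)
    (v : TangentSpace (𝓡 n) p) :
    mfderiv (𝓡 n) (𝓡 n) φ p (f'.shape (fun p => g (N (φ p))) p v) =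
      f.shape N (φ p) (mfderiv (𝓡 n) (𝓡 n) φ p v) := by
  apply f.injective_diff (φ p)
  apply g.injective
  rw [hN.diff_shape, ← diff_linear_comp (f.mdifferentiableAt_amb _) h,
    (hN.transport hg h).diff_shape]
  exact diff_linear_comp (hN.mdifferentiableAt _) (fun q => rfl) v

theorem IsUnitNormal.meanCurv_transport (hN : f.IsUnitNormal N)
    (hg : ∀ x y, mink (g x) (g y) = mink x y) (h : ∀ p, f'.amb p = g (f.amb (φ p))) (p : Sph n) :
    f'.meanCurv (fun p => g (N (φ p))) p = f.meanCurv N (φ p) := by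
  let e : TangentSpace (𝓡 n) p ≃ₗ[ℝ] TangentSpace (𝓡 n) (φ p) :=
    LinearEquiv.ofBijective (mfderiv (𝓡 n) (𝓡 n) φ p).toLinearMap (bijective_mfderiv_diffeomorph p)
  have h1 : e.conj (f'.shape (fun p => g (N (φ p))) p) = f.shape N (φ p) := by
    ext v
    obtain ⟨w, rfl⟩ := e.surjective v
    rw [LinearEquiv.conj_apply_apply, LinearEquiv.symm_apply_apply]
    exact hN.shape_transport hg h p w
  rw [meanCurv, meanCurv, ← h1, LinearMap.trace_conj']

/-- Strict pinching, expressed in terms of quadratic forms. -/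
def IsStrictlyPinchedWith (f : HypImmersion n) (N : Sph n → Mink n) : Prop :=
  f.IsLSCWith N ∧ ∀ p v, v ≠ 0 →
    (1 / 2) * f.meanCurv N p * f.firstForm p v v < f.firstForm p (f.shape N p v) v

theorem IsStrictlyPinchedWith.isStrictlyHalfPinched (h : f.IsStrictlyPinchedWith N) :
    f.IsStrictlyHalfPinched := by
  refine ⟨N, h.1, fun p μ hμ => ?_⟩
  obtain ⟨v, hv⟩ := hμ.exists_hasEigenvector
  have h1 := h.2 p v hv.2
  have h2 : f.firstForm p (f.shape N p v) v = μ * f.firstForm p v v := by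
    rw [hv.apply_eq_smul, firstForm, map_smul, mink_smul_left, firstForm]
  rw [h2] at h1
  exact lt_of_mul_lt_mul_right h1 (f.firstForm_self_pos p hv.2).le

theorem IsStrictlyPinchedWith.transport (hf : f.IsStrictlyPinchedWith N)
    (hg : ∀ x y, mink (g x) (g y) = mink x y) (h : ∀ p, f'.amb p = g (f.amb (φ p))) :
    f'.IsStrictlyPinchedWith (fun p => g (N (φ p))) := by
  have hN := hf.1.1
  refine ⟨⟨hN.transport hg h, fun p v hv => ?_⟩, fun p v hv => ?_⟩
  all_goals
    have hv' : mfderiv (𝓡 n) (𝓡 n) φ p v ≠ 0 := fun h0 =>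
      hv ((bijective_mfderiv_diffeomorph p).1 (by rw [h0, map_zero]))
    rw [firstForm_transport hg h p (f'.shape _ p v), hN.shape_transport hg h]
  · exact hf.1.2 _ _ hv'
  · rw [firstForm_transport hg h p v v, hN.meanCurv_transport hg h]
    exact hf.2 _ _ hv'

end HypImmersion

end Transport

/-! ### The second fundamental form in parametrisations -/

section Parametrisation

variable {n : ℕ} {V : Type*} [NormedAddCommGroup V] [NormedSpace ℝ V]

/-- The chain rule for a map from the sphere composed with a parametrisation. -/
theorem hasFDerivAt_comp_parametrisation {F : Sph n → Mink n} {ψ : V → Sph n} {x : V}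
    (hF : MDifferentiableAt (𝓡 n) 𝓘(ℝ, Mink n) F (ψ x))
    (hψ : MDifferentiableAt 𝓘(ℝ, V) (𝓡 n) ψ x) :
    ∃ D : V →L[ℝ] Mink n, HasFDerivAt (fun y => F (ψ y)) D x ∧
      ∀ X : V, D X = HypImmersion.diff F (ψ x) (mfderiv 𝓘(ℝ, V) (𝓡 n) ψ x X) := by
  have h1 := (hF.hasMFDerivAt.comp x hψ.hasMFDerivAt).hasFDerivAt
  exact ⟨_, h1, fun X => rfl⟩

theorem fderiv_comp_parametrisation {F : Sph n → Mink n} {ψ : V → Sph n} {x : V}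
    (hF : MDifferentiableAt (𝓡 n) 𝓘(ℝ, Mink n) F (ψ x))
    (hψ : MDifferentiableAt 𝓘(ℝ, V) (𝓡 n) ψ x) (X : V) :
    fderiv ℝ (fun y => F (ψ y)) x X =
      HypImmersion.diff F (ψ x) (mfderiv 𝓘(ℝ, V) (𝓡 n) ψ x X) := by
  obtain ⟨D, hD, hD'⟩ := hasFDerivAt_comp_parametrisation hF hψ
  rw [hD.fderiv, hD']

namespace HypImmersion

variable {f : HypImmersion n} {N : Sph n → Mink n}

theorem contDiffAt_radialExt (f : HypImmersion n) {x : EuclideanSpace ℝ (Fin (n + 1))}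
    (hx : x ≠ 0) : ContDiffAt ℝ ∞ (radialExt f.amb) x := by
  have h1 : ContMDiffAt 𝓘(ℝ, EuclideanSpace ℝ (Fin (n + 1))) 𝓘(ℝ, Mink n) ∞
      (fun y => f.amb (toSph y)) x := (f.smooth _).comp x (contMDiffAt_toSph hx)
  refine h1.contDiffAt.congr_of_eventuallyEq ?_
  filter_upwards [isOpen_ne.mem_nhds hx] with y hy using radialExt_eq _ hy

theorem mdifferentiableAt_toSph {x : EuclideanSpace ℝ (Fin (n + 1))} (hx : x ≠ 0) :
    MDifferentiableAt 𝓘(ℝ, EuclideanSpace ℝ (Fin (n + 1))) (𝓡 n) toSph x :=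
  (contMDiffAt_toSph hx).mdifferentiableAt (by simp)

theorem fderiv_radialExt (f : HypImmersion n) {x : EuclideanSpace ℝ (Fin (n + 1))}
    (hx : x ≠ 0) (X : EuclideanSpace ℝ (Fin (n + 1))) :
    fderiv ℝ (radialExt f.amb) x X =
      diff f.amb (toSph x) (mfderiv 𝓘(ℝ, EuclideanSpace ℝ (Fin (n + 1))) (𝓡 n) toSph x X) := by
  rw [← fderiv_comp_parametrisation (f.mdifferentiableAt_amb _) (mdifferentiableAt_toSph hx)]
  congr 1
  apply Filter.EventuallyEq.fderiv_eq
  filter_upwards [isOpen_ne.mem_nhds hx] with y hy using radialExt_eq _ hy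

/-- The second fundamental form is minus the normal component of the second derivative. -/
theorem IsUnitNormal.firstForm_shape_toSph (hN : f.IsUnitNormal N)
    {x : EuclideanSpace ℝ (Fin (n + 1))} (hx : x ≠ 0) (X Y : EuclideanSpace ℝ (Fin (n + 1))) :
    f.firstForm (toSph x)
        (f.shape N (toSph x) (mfderiv 𝓘(ℝ, EuclideanSpace ℝ (Fin (n + 1))) (𝓡 n) toSph x X))
        (mfderiv 𝓘(ℝ, EuclideanSpace ℝ (Fin (n + 1))) (𝓡 n) toSph x Y) =
      -mink (N (toSph x)) (fderiv ℝ (fderiv ℝ (radialExt f.amb)) x X Y) := by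
  rw [hN.firstForm_shape, ← fderiv_radialExt f hx]
  obtain ⟨D, hD, hD'⟩ := hasFDerivAt_comp_parametrisation (hN.mdifferentiableAt _)
    (mdifferentiableAt_toSph hx)
  have h2 : DifferentiableAt ℝ (fderiv ℝ (radialExt f.amb)) x :=
    ((f.contDiffAt_radialExt hx).fderiv_right (m := 1) (by norm_cast)).differentiableAt
      (by simp)
  have h3 := h2.hasFDerivAt.clm_apply (hasFDerivAt_const Y x)
  obtain ⟨E, hE, hE'⟩ := hD.mink h3
  have h4 : (fun y => mink (N (toSph y)) (fderiv ℝ (radialExt f.amb) y Y)) =ᶠ[𝓝 x]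
      fun _ => 0 := by
    filter_upwards [isOpen_ne.mem_nhds hx] with y hy
    rw [fderiv_radialExt f hy, hN.normal]
  have h5 := hE' X
  rw [hE.unique ((hasFDerivAt_const (0 : ℝ) x).congr_of_eventuallyEq h4), hD'] at h5
  simp only [zero_apply, add_apply,
    ContinuousLinearMap.comp_apply, ContinuousLinearMap.flip_apply, map_zero, zero_add] at h5
  linarith

/-- Every tangent vector of the sphere is the image of a vector under the radial projection. -/
theorem exists_mfderiv_toSph_eq (p : Sph n)
    (v : TangentSpace (𝓡 n) (toSph (p : EuclideanSpace ℝ (Fin (n + 1))))) :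
    ∃ X : EuclideanSpace ℝ (Fin (n + 1)),
      mfderiv 𝓘(ℝ, EuclideanSpace ℝ (Fin (n + 1))) (𝓡 n) toSph
        (p : EuclideanSpace ℝ (Fin (n + 1))) X = v := by
  have := Fact.mk (finrank_euclideanSpace_fin (𝕜 := ℝ) (n := n + 1))
  have h1 : MDifferentiableAt (𝓡 n) 𝓘(ℝ, EuclideanSpace ℝ (Fin (n + 1)))
      ((↑) : Sph n → EuclideanSpace ℝ (Fin (n + 1))) p :=
    (contMDiff_coe_sphere (m := 1) p).mdifferentiableAt (by simp)
  have h2 := (mdifferentiableAt_toSph (coe_sph_ne_zero p)).hasMFDerivAt.comp p h1.hasMFDerivAt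
  have h3 : (toSph ∘ ((↑) : Sph n → EuclideanSpace ℝ (Fin (n + 1)))) = id :=
    funext fun q => toSph_coe q
  rw [h3] at h2
  have h4 := hasMFDerivAt_unique h2 (hasMFDerivAt_id p)
  exact ⟨_, congrArg (fun L => L v) h4⟩

theorem IsUnitNormal.firstForm_shape_comm (hN : f.IsUnitNormal N) (p : Sph n)
    (v w : TangentSpace (𝓡 n) p) :
    f.firstForm p (f.shape N p v) w = f.firstForm p v (f.shape N p w) := by
  have key : ∀ v w : TangentSpace (𝓡 n) (toSph (p : EuclideanSpace ℝ (Fin (n + 1)))),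
      f.firstForm _ (f.shape N _ v) w = f.firstForm _ v (f.shape N _ w) := by
    intro v w
    obtain ⟨X, rfl⟩ := exists_mfderiv_toSph_eq p v
    obtain ⟨Y, rfl⟩ := exists_mfderiv_toSph_eq p w
    have hx := coe_sph_ne_zero p
    rw [firstForm_comm f _ _ (f.shape N _ _)]
    refine (hN.firstForm_shape_toSph hx X Y).trans
      (Eq.trans ?_ (hN.firstForm_shape_toSph hx Y X).symm)
    have hs : IsSymmSndFDerivAt ℝ (radialExt f.amb) (p : EuclideanSpace ℝ (Fin (n + 1))) :=
      (f.contDiffAt_radialExt hx).isSymmSndFDerivAt (by simp; norm_cast)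
    exact congrArg (fun Z => -mink (N (toSph p)) Z) (hs.eq X Y)
  rw [toSph_coe] at key
  exact key v w

/-- An orthonormal frame of principal directions, with the principal curvatures `l`. -/
theorem IsUnitNormal.exists_principal_frame (hN : f.IsUnitNormal N) (p : Sph n) :
    ∃ (e : Module.Basis (Fin n) ℝ (TangentSpace (𝓡 n) p)) (l : Fin n → ℝ),
      (∀ i j, f.firstForm p (e i) (e j) = if i = j then 1 else 0) ∧
      (∀ i, f.shape N p (e i) = l i • e i) ∧ f.meanCurv N p = (1 / n) * ∑ i, l i := by
  obtain ⟨e, l, he, hl⟩ := exists_orthonormal_eigenbasis (finrank_tangentSpace_sph p)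
    (f.firstBilin p) (f.firstForm_comm p) (fun v hv => f.firstForm_self_pos p hv) (f.shape N p)
    (hN.firstForm_shape_comm p)
  refine ⟨e, l, he, hl, ?_⟩
  rw [meanCurv, LinearMap.trace_eq_matrix_trace ℝ e]
  congr 1
  refine Finset.sum_congr rfl fun i _ => ?_
  rw [Matrix.diag_apply, LinearMap.toMatrix_apply, hl]
  simp

theorem firstForm_eq_sum {p : Sph n} {e : Module.Basis (Fin n) ℝ (TangentSpace (𝓡 n) p)}
    (he : ∀ i j, f.firstForm p (e i) (e j) = if i = j then 1 else 0)
    (v : TangentSpace (𝓡 n) p) : f.firstForm p v v = ∑ i, e.repr v i ^ 2 := by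
  have h1 : f.firstBilin p v v = ∑ i, e.repr v i ^ 2 := by
    conv_lhs => rw [← e.sum_repr v]
    simp only [map_sum, LinearMap.sum_apply, map_smul, LinearMap.smul_apply, firstBilin_apply, he,
      smul_eq_mul]
    simp [sq]
  exact h1

theorem firstForm_shape_eq_sum {p : Sph n} {e : Module.Basis (Fin n) ℝ (TangentSpace (𝓡 n) p)}
    {l : Fin n → ℝ} (he : ∀ i j, f.firstForm p (e i) (e j) = if i = j then 1 else 0)
    (hl : ∀ i, f.shape N p (e i) = l i • e i) (v : TangentSpace (𝓡 n) p) :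
    f.firstForm p (f.shape N p v) v = ∑ i, l i * e.repr v i ^ 2 := by
  have h1 : f.firstBilin p (f.shape N p v) v = ∑ i, l i * e.repr v i ^ 2 := by
    conv_lhs => rw [← e.sum_repr v]
    simp only [map_sum, LinearMap.sum_apply, map_smul, LinearMap.smul_apply, firstBilin_apply, he,
      smul_eq_mul, hl]
    simp only [mul_ite, mul_one, mul_zero, Finset.sum_ite_eq', Finset.mem_univ,
      if_true]
    exact Finset.sum_congr rfl fun i _ => by ring
  exact h1

/-- Weak pinching at a point, expressed in terms of quadratic forms. -/
def PinchedAt (f : HypImmersion n) (N : Sph n → Mink n) (p : Sph n) : Prop :=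
  ∀ v, (1 / 2) * f.meanCurv N p * f.firstForm p v v ≤ f.firstForm p (f.shape N p v) v

theorem IsStrictlyHalfPinched.exists_pinchedAt (h : f.IsStrictlyHalfPinched) :
    ∃ N, f.IsUnitNormal N ∧ ∀ p, f.PinchedAt N p := by
  obtain ⟨N, hN, hpinch⟩ := h
  refine ⟨N, hN.1, fun p v => ?_⟩
  obtain ⟨e, l, he, hl, -⟩ := hN.1.exists_principal_frame p
  rw [firstForm_eq_sum he, firstForm_shape_eq_sum he hl, Finset.mul_sum]
  refine Finset.sum_le_sum fun i _ => ?_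
  have : Module.End.HasEigenvalue (f.shape N p) (l i) :=
    Module.End.hasEigenvalue_of_hasEigenvector
      (Module.End.hasEigenvector_iff.2 ⟨Module.End.mem_eigenspace_iff.2 (hl i), e.ne_zero i⟩)
  exact mul_le_mul_of_nonneg_right (hpinch p _ this).le (sq_nonneg _)

end HypImmersion

end Parametrisation

/-! ### Weak pinching is a closed condition -/

section Closure

variable {n : ℕ}

namespace HypImmersion

variable {f f' : HypImmersion n} {N : Sph n → Mink n}

/-- The first derivative of the radial extension. -/
def jetOne (f : HypImmersion n) (p : Sph n) (X : EuclideanSpace ℝ (Fin (n + 1))) : Mink n :=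
  iteratedFDeriv ℝ 1 (radialExt f.amb) (p : EuclideanSpace ℝ (Fin (n + 1))) fun _ => X

/-- The second derivative of the radial extension. -/
def jetTwo (f : HypImmersion n) (p : Sph n) (X Y : EuclideanSpace ℝ (Fin (n + 1))) : Mink n :=
  iteratedFDeriv ℝ 2 (radialExt f.amb) (p : EuclideanSpace ℝ (Fin (n + 1))) ![X, Y]

theorem jetOne_eq (f : HypImmersion n) (p : Sph n) (X : EuclideanSpace ℝ (Fin (n + 1))) :
    f.jetOne p X = fderiv ℝ (radialExt f.amb) (p : EuclideanSpace ℝ (Fin (n + 1))) X := by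
  rw [jetOne, iteratedFDeriv_one_apply]

theorem jetTwo_eq (f : HypImmersion n) (p : Sph n) (X Y : EuclideanSpace ℝ (Fin (n + 1))) :
    f.jetTwo p X Y =
      fderiv ℝ (fderiv ℝ (radialExt f.amb)) (p : EuclideanSpace ℝ (Fin (n + 1))) X Y := by
  rw [jetTwo, iteratedFDeriv_two_apply]
  simp

/-- The Gram matrix of the images of `n` vectors. -/
def jetGram (f : HypImmersion n) (p : Sph n) (b : Fin n → EuclideanSpace ℝ (Fin (n + 1))) :
    Matrix (Fin n) (Fin n) ℝ :=
  Matrix.of fun i j => mink (f.jetOne p (b i)) (f.jetOne p (b j))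

/-- The matrix of the second fundamental form in the direction `ν`. -/
def jetSecond (f : HypImmersion n) (p : Sph n) (ν : Mink n)
    (b : Fin n → EuclideanSpace ℝ (Fin (n + 1))) : Matrix (Fin n) (Fin n) ℝ :=
  Matrix.of fun i j => -mink ν (f.jetTwo p (b i) (b j))

/-- Weak pinching at `p` with respect to the unit normal `ν`, in terms of the `2`-jet at `p`. The
mean curvature is computed in every family `b` of vectors that yields a frame. In this form the
condition passes to limits and is invariant under reparametrisation. -/
structure JetPinched (f : HypImmersion n) (p : Sph n) (ν : Mink n) : Prop where
  tangent : mink (f.amb p) ν = 0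
  unit : mink ν ν = 1
  normal : ∀ X, mink ν (f.jetOne p X) = 0
  pinched : ∀ b, (f.jetGram p b).det ≠ 0 → ∀ X,
    (1 / 2) * ((1 / n) * ((f.jetGram p b)⁻¹ * f.jetSecond p ν b).trace) *
      mink (f.jetOne p X) (f.jetOne p X) ≤ -mink ν (f.jetTwo p X X)

section Continuity

variable {α : Type*} {l : Filter α} {u : α → HypImmersion n}

theorem tendsto_iteratedFDeriv (h : Filter.Tendsto u l (𝓝 f)) (m : ℕ) (p : Sph n) :
    Filter.Tendsto
      (fun a => iteratedFDeriv ℝ m (radialExt (u a).amb) (p : EuclideanSpace ℝ (Fin (n + 1)))) l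
      (𝓝 (iteratedFDeriv ℝ m (radialExt f.amb) (p : EuclideanSpace ℝ (Fin (n + 1))))) := by
  have h1 : Continuous (fun f : HypImmersion n => UniformFun.ofFun
      (fun p : Sph n => iteratedFDeriv ℝ m (radialExt f.amb)
        (p : EuclideanSpace ℝ (Fin (n + 1))))) :=
    continuous_iInf_dom (i := m) continuous_induced_dom
  have h2 := (UniformFun.uniformContinuous_eval
    (β := EuclideanSpace ℝ (Fin (n + 1)) [×m]→L[ℝ] Mink n) p).continuous.comp h1
  exact (h2.tendsto f).comp h

theorem tendsto_iteratedFDeriv_apply (h : Filter.Tendsto u l (𝓝 f)) {m : ℕ} (p : Sph n)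
    (v : Fin m → EuclideanSpace ℝ (Fin (n + 1))) :
    Filter.Tendsto
      (fun a => iteratedFDeriv ℝ m (radialExt (u a).amb) (p : EuclideanSpace ℝ (Fin (n + 1))) v) l
      (𝓝 (iteratedFDeriv ℝ m (radialExt f.amb) (p : EuclideanSpace ℝ (Fin (n + 1))) v)) :=
  Filter.Tendsto.comp
    (g := fun L : EuclideanSpace ℝ (Fin (n + 1)) [×m]→L[ℝ] Mink n => L v)
    ((ContinuousMultilinearMap.apply ℝ _ _ v).continuous.tendsto _) (tendsto_iteratedFDeriv h m p)

theorem tendsto_jetOne (h : Filter.Tendsto u l (𝓝 f)) (p : Sph n)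
    (X : EuclideanSpace ℝ (Fin (n + 1))) :
    Filter.Tendsto (fun a => (u a).jetOne p X) l (𝓝 (f.jetOne p X)) :=
  tendsto_iteratedFDeriv_apply h p fun _ => X

theorem tendsto_jetTwo (h : Filter.Tendsto u l (𝓝 f)) (p : Sph n)
    (X Y : EuclideanSpace ℝ (Fin (n + 1))) :
    Filter.Tendsto (fun a => (u a).jetTwo p X Y) l (𝓝 (f.jetTwo p X Y)) :=
  tendsto_iteratedFDeriv_apply h p ![X, Y]

theorem tendsto_amb (h : Filter.Tendsto u l (𝓝 f)) (p : Sph n) :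
    Filter.Tendsto (fun a => (u a).amb p) l (𝓝 (f.amb p)) := by
  have h1 := tendsto_iteratedFDeriv_apply h p (m := 0) 0
  have h2 : ∀ f : HypImmersion n, iteratedFDeriv ℝ 0 (radialExt f.amb)
      (p : EuclideanSpace ℝ (Fin (n + 1))) 0 = f.amb p := fun f => by
    rw [iteratedFDeriv_zero_apply, radialExt_eq _ (coe_sph_ne_zero p), toSph_coe]
  simp only [h2] at h1
  exact h1

theorem tendsto_mink {v w : α → Mink n} {v₀ w₀ : Mink n} (hv : Filter.Tendsto v l (𝓝 v₀))
    (hw : Filter.Tendsto w l (𝓝 w₀)) :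
    Filter.Tendsto (fun a => mink (v a) (w a)) l (𝓝 (mink v₀ w₀)) :=
  (Filter.Tendsto.inner hv.fst_nhds hw.fst_nhds).sub (hv.snd_nhds.mul hw.snd_nhds)

end Continuity

/-- Unit normals at points of hyperbolic space are bounded in terms of the point. -/
theorem norm_le_of_unit (x : Hyp n) {v : Mink n} (hv : mink (x : Mink n) v = 0)
    (h1 : mink v v = 1) : ‖v‖ ≤ (x : Mink n).2 := by
  have h2 := snd_sq_le_of_mink_eq_zero x hv
  have hpos := x.2.2
  rw [h1, one_mul] at h2
  rw [mink, real_inner_self_eq_norm_sq] at h1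
  rw [Prod.norm_def]
  apply max_le
  · apply le_of_sq_le_sq _ hpos.le
    nlinarith
  · rw [Real.norm_eq_abs]
    apply abs_le_of_sq_le_sq _ hpos.le
    linarith

theorem isClosed_setOf_jetPinched (p : Sph n) :
    IsClosed {f : HypImmersion n | ∃ ν, f.JetPinched p ν} := by
  rw [isClosed_iff_ultrafilter]
  intro f U hU hmem
  have hid : Filter.Tendsto id (U : Filter (HypImmersion n)) (𝓝 f) := hU
  let ν : HypImmersion n → Mink n := fun f' => open Classical in
    if h : ∃ ν, f'.JetPinched p ν then h.choose else 0
  have hν : ∀ᶠ f' in (U : Filter (HypImmersion n)), f'.JetPinched p (ν f') := by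
    filter_upwards [hmem] with f' hf'
    have hf'' : ∃ ν, f'.JetPinched p ν := hf'
    simp only [ν, dif_pos hf'']
    exact hf''.choose_spec
  have hbd : ∀ᶠ f' in (U : Filter (HypImmersion n)),
      ν f' ∈ Metric.closedBall (0 : Mink n) ((f.amb p).2 + 1) := by
    have h1 : ∀ᶠ f' in (U : Filter (HypImmersion n)), (f'.amb p).2 < (f.amb p).2 + 1 :=
      ((continuous_snd.tendsto _).comp (tendsto_amb hid p)).eventually_lt_const (by simp)
    filter_upwards [hν, h1] with f' hf' hlt
    rw [mem_closedBall_zero_iff]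
    exact (norm_le_of_unit (f'.toFun p) hf'.tangent hf'.unit).trans hlt.le
  obtain ⟨ν₀, -, hν₀⟩ := (isCompact_closedBall (0 : Mink n) ((f.amb p).2 + 1)).ultrafilter_le_nhds
    (U.map ν) (Filter.le_principal_iff.2 hbd)
  have hlim : Filter.Tendsto ν (U : Filter (HypImmersion n)) (𝓝 ν₀) := hν₀
  refine ⟨ν₀, ⟨?_, ?_, fun X => ?_, fun b hb X => ?_⟩⟩
  · exact tendsto_nhds_unique_of_eventuallyEq (tendsto_mink (tendsto_amb hid p) hlim)
      tendsto_const_nhds (hν.mono fun f' h => h.tangent)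
  · exact tendsto_nhds_unique_of_eventuallyEq (tendsto_mink hlim hlim)
      tendsto_const_nhds (hν.mono fun f' h => h.unit)
  · exact tendsto_nhds_unique_of_eventuallyEq (tendsto_mink hlim (tendsto_jetOne hid p X))
      tendsto_const_nhds (hν.mono fun f' h => h.normal X)
  · have hg : Filter.Tendsto (fun f' : HypImmersion n => f'.jetGram p b) (U : Filter _)
        (𝓝 (f.jetGram p b)) :=
      tendsto_pi_nhds.2 fun i => tendsto_pi_nhds.2 fun j =>
        tendsto_mink (tendsto_jetOne hid p _) (tendsto_jetOne hid p _)
    have hs : Filter.Tendsto (fun f' : HypImmersion n => f'.jetSecond p (ν f') b) (U : Filter _)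
        (𝓝 (f.jetSecond p ν₀ b)) :=
      tendsto_pi_nhds.2 fun i => tendsto_pi_nhds.2 fun j =>
        (tendsto_mink hlim (tendsto_jetTwo hid p _ _)).neg
    have hdet : Filter.Tendsto (fun f' : HypImmersion n => (f'.jetGram p b).det) (U : Filter _)
        (𝓝 (f.jetGram p b).det) := (continuous_id.matrix_det.tendsto _).comp hg
    have hinv : Filter.Tendsto (fun f' : HypImmersion n => (f'.jetGram p b)⁻¹) (U : Filter _)
        (𝓝 (f.jetGram p b)⁻¹) := by
      simp only [Matrix.inv_def, Ring.inverse_eq_inv']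
      exact (hdet.inv₀ hb).smul ((continuous_id.matrix_adjugate.tendsto _).comp hg)
    have htr : Filter.Tendsto (fun f' : HypImmersion n =>
        ((f'.jetGram p b)⁻¹ * f'.jetSecond p (ν f') b).trace) (U : Filter _)
        (𝓝 ((f.jetGram p b)⁻¹ * f.jetSecond p ν₀ b).trace) := by
      simp only [Matrix.trace, Matrix.diag_apply, Matrix.mul_apply]
      exact tendsto_finsetSum _ fun i _ => tendsto_finsetSum _ fun j _ =>
        ((tendsto_pi_nhds.1 (tendsto_pi_nhds.1 hinv i) j)).mul
          (tendsto_pi_nhds.1 (tendsto_pi_nhds.1 hs j) i)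
    refine le_of_tendsto_of_tendsto
      (((htr.const_mul (1 / (n : ℝ))).const_mul (1 / 2)).mul
        (tendsto_mink (tendsto_jetOne hid p X) (tendsto_jetOne hid p X)))
      (tendsto_mink hlim (tendsto_jetTwo hid p X X)).neg ?_
    filter_upwards [hν, hdet.eventually_ne hb] with f' h1 h2 using h1.pinched b h2 X

/-- The chain rule to second order, for a composition with a linear map on the left. -/
theorem fderiv_fderiv_linear_comp {E F F' : Type*} [NormedAddCommGroup E] [NormedSpace ℝ E]
    [NormedAddCommGroup F] [NormedSpace ℝ F] [NormedAddCommGroup F'] [NormedSpace ℝ F']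
    (G : F →L[ℝ] F') {R : E → F} {R' : E → F'} {Θ : E → E} {x : E} (hR : ContDiffAt ℝ 2 R (Θ x))
    (hΘ : ContDiffAt ℝ 2 Θ x) (h : ∀ᶠ y in 𝓝 x, R' y = G (R (Θ y))) :
    (∀ X, fderiv ℝ R' x X = G (fderiv ℝ R (Θ x) (fderiv ℝ Θ x X))) ∧
      ∀ X Y, fderiv ℝ (fderiv ℝ R') x X Y =
        G (fderiv ℝ (fderiv ℝ R) (Θ x) (fderiv ℝ Θ x X) (fderiv ℝ Θ x Y)) +
          G (fderiv ℝ R (Θ x) (fderiv ℝ (fderiv ℝ Θ) x X Y)) := by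
  have h1 : ∀ᶠ y in 𝓝 x, fderiv ℝ R' y = G.comp ((fderiv ℝ R (Θ y)).comp (fderiv ℝ Θ y)) := by
    filter_upwards [h.eventually_nhds, hΘ.eventually (by simp),
      hΘ.continuousAt.eventually (hR.eventually (by simp))] with y h1 h2 h3
    rw [Filter.EventuallyEq.fderiv_eq h1]
    exact (G.hasFDerivAt.comp y ((h3.differentiableAt (by simp)).hasFDerivAt.comp y
      (h2.differentiableAt (by simp)).hasFDerivAt)).fderiv
  refine ⟨fun X => by rw [h1.self_of_nhds]; rfl, fun X Y => ?_⟩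
  have h2 := ((hR.fderiv_right (m := 1) (by norm_cast)).differentiableAt (by simp)).hasFDerivAt
  have h3 := (hΘ.differentiableAt (by simp)).hasFDerivAt
  have h4 := ((hΘ.fderiv_right (m := 1) (by norm_cast)).differentiableAt (by simp)).hasFDerivAt
  have h5 := (hasFDerivAt_const G x).clm_comp ((h2.comp x h3).clm_comp h4)
  rw [Filter.EventuallyEq.fderiv_eq h1]
  refine (congrArg (fun L => L X Y) h5.fderiv).trans ?_
  simp [add_comm]

/-- The weak pinching condition is invariant under Lorentz transformations and reparametrisation:
the second derivative of the reparametrisation only contributes tangential terms. -/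
theorem JetPinched.transport {φ : Diffeomorph (𝓡 n) (𝓡 n) (Sph n) (Sph n) ∞}
    {g : Mink n ≃ₗ[ℝ] Mink n} {p : Sph n} {ν : Mink n} (hν : f.JetPinched (φ p) ν)
    (hg : ∀ x y, mink (g x) (g y) = mink x y) (h : ∀ p, f'.amb p = g (f.amb (φ p))) :
    f'.JetPinched p (g ν) := by
  obtain ⟨x, hxp⟩ : ∃ x : EuclideanSpace ℝ (Fin (n + 1)), x = p := ⟨_, rfl⟩
  have hx : x ≠ 0 := hxp ▸ coe_sph_ne_zero p
  obtain ⟨G, hG⟩ : ∃ G : Mink n →L[ℝ] Mink n, ∀ v, G v = g v :=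
    ⟨LinearMap.toContinuousLinearMap g.toLinearMap, fun v => rfl⟩
  obtain ⟨Θ, hΘdef⟩ : ∃ Θ : EuclideanSpace ℝ (Fin (n + 1)) → EuclideanSpace ℝ (Fin (n + 1)),
    ∀ y, Θ y = (φ (toSph y) : EuclideanSpace ℝ (Fin (n + 1))) := ⟨_, fun y => rfl⟩
  have hΘx : Θ x = (φ p : EuclideanSpace ℝ (Fin (n + 1))) := by rw [hΘdef, hxp, toSph_coe]
  have hΘ : ContDiffAt ℝ 2 Θ x := by
    have := Fact.mk (finrank_euclideanSpace_fin (𝕜 := ℝ) (n := n + 1))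
    have h1 : ContMDiffAt 𝓘(ℝ, EuclideanSpace ℝ (Fin (n + 1)))
        𝓘(ℝ, EuclideanSpace ℝ (Fin (n + 1))) ∞
        (fun y => (φ (toSph y) : EuclideanSpace ℝ (Fin (n + 1)))) x :=
      (contMDiff_coe_sphere (m := ∞) _).comp x
        ((φ.contMDiff _).comp x (contMDiffAt_toSph hx))
    rw [funext hΘdef]
    exact h1.contDiffAt.of_le (by norm_cast)
  have hΘ0 : ∀ y, Θ y ≠ 0 := fun y => by rw [hΘdef]; exact coe_sph_ne_zero _
  have hR : ∀ᶠ y in 𝓝 x, radialExt f'.amb y = G (radialExt f.amb (Θ y)) := by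
    filter_upwards [isOpen_ne.mem_nhds hx] with y hy
    rw [radialExt_eq _ hy, h, radialExt_eq _ (hΘ0 y), hΘdef, toSph_coe, hG]
  obtain ⟨hd1, hd2⟩ := fderiv_fderiv_linear_comp G
    ((f.contDiffAt_radialExt (hΘ0 x)).of_le (by norm_cast)) hΘ hR
  simp only [hΘx, hG] at hd1 hd2
  rw [hxp] at hd1 hd2
  have hone : ∀ X, f'.jetOne p X = g (f.jetOne (φ p) (fderiv ℝ Θ p X)) := fun X => by
    rw [jetOne_eq, jetOne_eq, hd1]
  have htwo : ∀ X Y, f'.jetTwo p X Y = g (f.jetTwo (φ p) (fderiv ℝ Θ p X) (fderiv ℝ Θ p Y)) +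
      g (f.jetOne (φ p) (fderiv ℝ (fderiv ℝ Θ) p X Y)) := fun X Y => by
    rw [jetTwo_eq, jetTwo_eq, jetOne_eq, hd2]
  have htwo' : ∀ X Y, mink (g ν) (f'.jetTwo p X Y) =
      mink ν (f.jetTwo (φ p) (fderiv ℝ Θ p X) (fderiv ℝ Θ p Y)) := fun X Y => by
    rw [htwo, mink_add_right, hg, hg, hν.normal, add_zero]
  refine ⟨by rw [h, hg, hν.tangent], by rw [hg, hν.unit], fun X => by rw [hone, hg, hν.normal],
    fun b hb X => ?_⟩
  have hgram : f'.jetGram p b = f.jetGram (φ p) (fun i => fderiv ℝ Θ p (b i)) := by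
    ext i j
    simp only [jetGram, Matrix.of_apply, hone, hg]
  have hsecond : f'.jetSecond p (g ν) b = f.jetSecond (φ p) ν (fun i => fderiv ℝ Θ p (b i)) := by
    ext i j
    simp only [jetSecond, Matrix.of_apply, htwo']
  rw [hgram] at hb
  rw [hgram, hsecond, hone, hg, htwo']
  exact hν.pinched _ hb _

end HypImmersion

end Closure

/-! ### Weak pinching in the closure of the pinched classes -/

section ClosureConsequence

variable {n : ℕ}

namespace HypImmersion

variable {f f' : HypImmersion n} {N : Sph n → Mink n}

theorem mink_jetOne (f : HypImmersion n) (p : Sph n) (X Y : EuclideanSpace ℝ (Fin (n + 1))) :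
    mink (f.jetOne p X) (f.jetOne p Y) =
      f.firstForm (toSph (p : EuclideanSpace ℝ (Fin (n + 1))))
        (mfderiv 𝓘(ℝ, EuclideanSpace ℝ (Fin (n + 1))) (𝓡 n) toSph
          (p : EuclideanSpace ℝ (Fin (n + 1))) X)
        (mfderiv 𝓘(ℝ, EuclideanSpace ℝ (Fin (n + 1))) (𝓡 n) toSph
          (p : EuclideanSpace ℝ (Fin (n + 1))) Y) := by
  rw [jetOne_eq, jetOne_eq, fderiv_radialExt f (coe_sph_ne_zero p),
    fderiv_radialExt f (coe_sph_ne_zero p)]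
  rfl

theorem IsUnitNormal.mink_jetTwo (hN : f.IsUnitNormal N) (p : Sph n)
    (X Y : EuclideanSpace ℝ (Fin (n + 1))) :
    -mink (N p) (f.jetTwo p X Y) =
      f.firstForm (toSph (p : EuclideanSpace ℝ (Fin (n + 1))))
        (f.shape N _ (mfderiv 𝓘(ℝ, EuclideanSpace ℝ (Fin (n + 1))) (𝓡 n) toSph
          (p : EuclideanSpace ℝ (Fin (n + 1))) X))
        (mfderiv 𝓘(ℝ, EuclideanSpace ℝ (Fin (n + 1))) (𝓡 n) toSph
          (p : EuclideanSpace ℝ (Fin (n + 1))) Y) := by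
  rw [jetTwo_eq]
  refine Eq.trans ?_ (hN.firstForm_shape_toSph (coe_sph_ne_zero p) X Y).symm
  rw [toSph_coe]

theorem IsUnitNormal.meanCurv_eq_jet (hN : f.IsUnitNormal N) (p : Sph n)
    (b : Fin n → EuclideanSpace ℝ (Fin (n + 1))) (hb : (f.jetGram p b).det ≠ 0) :
    f.meanCurv N p = (1 / n) * ((f.jetGram p b)⁻¹ * f.jetSecond p (N p) b).trace := by
  let v : Fin n → TangentSpace (𝓡 n) (toSph (p : EuclideanSpace ℝ (Fin (n + 1)))) := fun i =>
    mfderiv 𝓘(ℝ, EuclideanSpace ℝ (Fin (n + 1))) (𝓡 n) toSph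
      (p : EuclideanSpace ℝ (Fin (n + 1))) (b i)
  have hgram : f.jetGram p b = Matrix.of fun i j => f.firstBilin _ (v i) (v j) := by
    ext i j
    exact f.mink_jetOne p _ _
  have hsecond : f.jetSecond p (N p) b =
      Matrix.of fun i j => f.firstBilin _ (v i) (f.shape N _ (v j)) := by
    ext i j
    rw [jetSecond, Matrix.of_apply]
    exact (hN.mink_jetTwo p _ _).trans (hN.firstForm_shape_comm _ _ _)
  rw [hgram] at hb
  have h1 := trace_eq_trace_gram (finrank_tangentSpace_sph _) (f.firstBilin _)
    (f.shape N (toSph (p : EuclideanSpace ℝ (Fin (n + 1))))) v hb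
  rw [hgram, hsecond, ← h1]
  change _ = f.meanCurv N (toSph (p : EuclideanSpace ℝ (Fin (n + 1))))
  rw [toSph_coe]

theorem PinchedAt.jetPinched (hN : f.IsUnitNormal N) {p : Sph n} (h : f.PinchedAt N p) :
    f.JetPinched p (N p) where
  tangent := hN.tangent p
  unit := hN.unit p
  normal X := by
    rw [jetOne_eq, fderiv_radialExt f (coe_sph_ne_zero p)]
    have := hN.normal (toSph (p : EuclideanSpace ℝ (Fin (n + 1))))
      (mfderiv 𝓘(ℝ, EuclideanSpace ℝ (Fin (n + 1))) (𝓡 n) toSph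
        (p : EuclideanSpace ℝ (Fin (n + 1))) X)
    rwa [toSph_coe] at this ⊢
  pinched b hb X := by
    rw [← hN.meanCurv_eq_jet p b hb, mink_jetOne, hN.mink_jetTwo]
    have h1 : f.PinchedAt N (toSph (p : EuclideanSpace ℝ (Fin (n + 1)))) := by rwa [toSph_coe]
    have h2 : f.meanCurv N p = f.meanCurv N (toSph (p : EuclideanSpace ℝ (Fin (n + 1)))) := by
      rw [toSph_coe]
    rw [h2]
    exact h1 _

/-- Weak pinching passes from the jet condition to the outward normal. If the jet condition holds
for the inward normal instead, then the mean curvature vanishes and there is nothing to prove. -/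
theorem IsOutwardNormal.pinchedAt_of_jetPinched (hn : 1 ≤ n) (hN : f.IsOutwardNormal N) {p : Sph n}
    {ν : Mink n} (h : f.JetPinched p ν) : f.PinchedAt N p := by
  have hn0 : (0 : ℝ) < n := by exact_mod_cast hn
  have hU := hN.1
  have hframe : ∃ b : Fin n → EuclideanSpace ℝ (Fin (n + 1)), f.jetGram p b = 1 := by
    obtain ⟨e, l, he, -, -⟩ :=
      hU.exists_principal_frame (toSph (p : EuclideanSpace ℝ (Fin (n + 1))))
    choose b hb using fun i => exists_mfderiv_toSph_eq p (e i)
    refine ⟨b, ?_⟩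
    ext i j
    rw [jetGram, Matrix.of_apply, mink_jetOne, hb, hb, he, Matrix.one_apply]
  obtain ⟨b, hb⟩ := hframe
  have hdet : (f.jetGram p b).det ≠ 0 := by simp [hb]
  have hnormal : ∀ v, mink ν (diff f.amb p v) = 0 := by
    have key : ∀ v, mink ν (diff f.amb (toSph (p : EuclideanSpace ℝ (Fin (n + 1)))) v) = 0 := by
      intro v
      obtain ⟨X, rfl⟩ := exists_mfderiv_toSph_eq p v
      rw [← fderiv_radialExt f (coe_sph_ne_zero p), ← jetOne_eq, h.normal]
    rwa [toSph_coe] at key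
  have hH := hU.meanCurv_eq_jet p b hdet
  have hp := h.pinched b hdet
  suffices hs : ∀ X, (1 / 2) * f.meanCurv N p * mink (f.jetOne p X) (f.jetOne p X) ≤
      -mink (N p) (f.jetTwo p X X) by
    have key : f.PinchedAt N (toSph (p : EuclideanSpace ℝ (Fin (n + 1)))) := by
      intro v
      obtain ⟨X, rfl⟩ := exists_mfderiv_toSph_eq p v
      have h2 : f.meanCurv N (toSph (p : EuclideanSpace ℝ (Fin (n + 1)))) = f.meanCurv N p := by
        rw [toSph_coe]
      rw [h2, ← mink_jetOne]
      exact (hs X).trans_eq (hU.mink_jetTwo p X X)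
    rwa [toSph_coe] at key
  rcases hU.eq_or_eq_neg p h.tangent h.unit hnormal with hν | hν
  · intro X
    rw [hH]
    simpa [hν] using hp X
  · have hsecond : f.jetSecond p ν b = -f.jetSecond p (N p) b := by
      ext i j
      simp [jetSecond, hν]
    have hp' : ∀ X, -mink (N p) (f.jetTwo p X X) ≤
        (1 / 2) * f.meanCurv N p * mink (f.jetOne p X) (f.jetOne p X) := by
      intro X
      have h1 := hp X
      rw [hsecond, mul_neg, Matrix.trace_neg, hν, mink_neg_left] at h1
      rw [hH]
      linarith
    have hA : ∀ X, 0 ≤ -mink (N p) (f.jetTwo p X X) := fun X => by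
      rw [hU.mink_jetTwo]
      exact hN.2 _ _
    have hgr : ∀ i, mink (f.jetOne p (b i)) (f.jetOne p (b i)) = 1 := fun i => by
      have := congrFun (congrFun hb i) i
      simpa [jetGram] using this
    have htr : f.meanCurv N p = (1 / n) * ∑ i, -mink (N p) (f.jetTwo p (b i) (b i)) := by
      rw [hH, hb, inv_one, Matrix.one_mul]
      rfl
    have hle : f.meanCurv N p ≤ 0 := by
      have h1 : ∑ i, -mink (N p) (f.jetTwo p (b i) (b i)) ≤
          ∑ _i : Fin n, (1 / 2) * f.meanCurv N p :=
        Finset.sum_le_sum fun i _ => by simpa [hgr] using hp' (b i)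
      rw [Finset.sum_const, Finset.card_univ, Fintype.card_fin, nsmul_eq_mul] at h1
      have h2 : ∑ i, -mink (N p) (f.jetTwo p (b i) (b i)) = n * f.meanCurv N p := by
        rw [htr]
        field_simp
      rw [h2] at h1
      nlinarith
    intro X
    refine le_trans ?_ (hA X)
    have h0 : 0 ≤ mink (f.jetOne p X) (f.jetOne p X) := by
      rw [mink_jetOne]
      by_cases hv : mfderiv 𝓘(ℝ, EuclideanSpace ℝ (Fin (n + 1))) (𝓡 n) toSph
          (p : EuclideanSpace ℝ (Fin (n + 1))) X = 0
      · rw [hv]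
        simp [firstForm]
      · exact (f.firstForm_self_pos _ hv).le
    nlinarith

end HypImmersion

/-- Immersions in the closure of the pinched classes are weakly pinched with respect to their
outward normal. -/
theorem pinchedAt_of_mem_closure (hn : 1 ≤ n) {M : HyperbolicManifold n} {f : HypImmersion n}
    {N : Sph n → Mink n} (hN : f.IsOutwardNormal N) (hf : M.cls f ∈ closure M.pinchedSpace)
    (p : Sph n) : f.PinchedAt N p := by
  let W : Set (HypImmersion n) := {f | ∀ p, ∃ ν, f.JetPinched p ν}
  have hW : IsClosed W := by
    have : W = ⋂ p, {f | ∃ ν, f.JetPinched p ν} := by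
      ext f
      simp [W]
    rw [this]
    exact isClosed_iInter HypImmersion.isClosed_setOf_jetPinched
  have hsat : ∀ f f' : HypImmersion n, M.cls f = M.cls f' → f ∈ W → f' ∈ W := by
    intro f f' h hfW p
    obtain ⟨g, hg, φ, hφ⟩ := exists_deck_of_cls_eq hn h
    obtain ⟨ν, hν⟩ := hfW (φ p)
    exact ⟨g ν, hν.transport (M.map_form g hg) hφ⟩
  let C : Set M.ImmersionClass := {c | ∃ f, M.cls f = c ∧ f ∈ W}
  have hpre : M.cls ⁻¹' C = W := by
    ext f
    exact ⟨fun ⟨f', h1, h2⟩ => hsat f' f h1 h2, fun h => ⟨f, rfl, h⟩⟩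
  have hC : IsClosed C := by
    have hq : Topology.IsQuotientMap M.cls := isQuotientMap_quot_mk
    rw [← hq.isClosed_preimage, hpre]
    exact hW
  have hsub : M.pinchedSpace ⊆ C := by
    rintro c ⟨f, rfl, hf, -⟩
    obtain ⟨N, hN, hp⟩ := hf.exists_pinchedAt
    exact ⟨f, rfl, fun p => ⟨N p, (hp p).jetPinched hN⟩⟩
  have hfW : f ∈ W := by
    rw [← hpre]
    exact closure_minimal hsub hC hf
  obtain ⟨ν, hν⟩ := hfW p
  exact hN.pinchedAt_of_jetPinched hn hν

end ClosureConsequence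

/-! ### Second order jets of functions of one variable -/

/-- The function `f` is differentiable near `0` and twice differentiable at `0`, with value, first and
second derivative `a`, `b` and `c`. -/
def HasJet (f : ℝ → ℝ) (a b c : ℝ) : Prop :=
  ∃ f' : ℝ → ℝ, (∀ᶠ s in 𝓝 0, HasDerivAt f (f' s) s) ∧ f 0 = a ∧ f' 0 = b ∧ HasDerivAt f' c 0

namespace HasJet

variable {f g : ℝ → ℝ} {a b c a' b' c' : ℝ}

theorem cast (h : HasJet f a b c) (ha : a = a') (hb : b = b') (hc : c = c') :
    HasJet f a' b' c' := ha ▸ hb ▸ hc ▸ h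

theorem unique (h : HasJet f a b c) (h' : HasJet f a' b' c') : a = a' ∧ b = b' ∧ c = c' := by
  obtain ⟨f', h1, h2, h3, h4⟩ := h
  obtain ⟨g', k1, k2, k3, k4⟩ := h'
  have he : f' =ᶠ[𝓝 0] g' := by
    filter_upwards [h1, k1] with s hs ks using hs.unique ks
  exact ⟨h2.symm.trans k2, by rw [← h3, ← k3, he.self_of_nhds],
    h4.unique (k4.congr_of_eventuallyEq he)⟩

theorem congr (h : HasJet f a b c) (hfg : g =ᶠ[𝓝 0] f) : HasJet g a b c := by
  obtain ⟨f', h1, h2, h3, h4⟩ := h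
  refine ⟨f', ?_, hfg.self_of_nhds.trans h2, h3, h4⟩
  filter_upwards [h1, hfg.eventually_nhds] with s hs hs' using hs.congr_of_eventuallyEq hs'

theorem const (a : ℝ) : HasJet (fun _ => a) a 0 0 :=
  ⟨fun _ => 0, .of_forall fun _ => hasDerivAt_const _ _, rfl, rfl, hasDerivAt_const _ _⟩

theorem add (hf : HasJet f a b c) (hg : HasJet g a' b' c') :
    HasJet (fun s => f s + g s) (a + a') (b + b') (c + c') := by
  obtain ⟨f', h1, h2, h3, h4⟩ := hf
  obtain ⟨g', k1, k2, k3, k4⟩ := hg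
  refine ⟨fun s => f' s + g' s, ?_, by simp [h2, k2], by simp [h3, k3], h4.add k4⟩
  filter_upwards [h1, k1] with s hs ks using hs.add ks

theorem mul (hf : HasJet f a b c) (hg : HasJet g a' b' c') :
    HasJet (fun s => f s * g s) (a * a') (b * a' + a * b') (c * a' + 2 * b * b' + a * c') := by
  obtain ⟨f', h1, h2, h3, h4⟩ := hf
  obtain ⟨g', k1, k2, k3, k4⟩ := hg
  refine ⟨fun s => f' s * g s + f s * g' s, ?_, by simp [h2, k2], by simp [h3, k3, h2, k2], ?_⟩
  · filter_upwards [h1, k1] with s hs ks using hs.mul ks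
  · have := (h4.mul k1.self_of_nhds).add (h1.self_of_nhds.mul k4)
    rw [h2, h3, k2, k3] at this
    convert! this using 1
    ring

theorem const_mul (r : ℝ) (hf : HasJet f a b c) :
    HasJet (fun s => r * f s) (r * a) (r * b) (r * c) :=
  ((const r).mul hf).cast rfl (by ring) (by ring)

theorem neg (hf : HasJet f a b c) : HasJet (fun s => -f s) (-a) (-b) (-c) := by
  simpa using hf.const_mul (-1)

theorem sub (hf : HasJet f a b c) (hg : HasJet g a' b' c') :
    HasJet (fun s => f s - g s) (a - a') (b - b') (c - c') := by
  simpa [sub_eq_add_neg] using hf.add hg.neg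

theorem sq (hf : HasJet f a b c) :
    HasJet (fun s => f s ^ 2) (a ^ 2) (2 * a * b) (2 * a * c + 2 * b ^ 2) := by
  simp only [pow_two]
  exact (hf.mul hf).cast rfl (by ring) (by ring)

theorem sum {ι : Type*} {s : Finset ι} {f : ι → ℝ → ℝ} {a b c : ι → ℝ}
    (h : ∀ i, HasJet (f i) (a i) (b i) (c i)) :
    HasJet (fun x => ∑ i ∈ s, f i x) (∑ i ∈ s, a i) (∑ i ∈ s, b i) (∑ i ∈ s, c i) := by
  classical
  induction s using Finset.induction_on with
  | empty => simpa using const 0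
  | insert i s hi ih => simpa [Finset.sum_insert hi] using (h i).add ih

theorem inv (hf : HasJet f 1 0 c) : HasJet (fun s => (f s)⁻¹) 1 0 (-c) := by
  obtain ⟨f', h1, h2, h3, h4⟩ := hf
  have hne : ∀ᶠ s in 𝓝 0, f s ≠ 0 :=
    h1.self_of_nhds.continuousAt.eventually_ne (by rw [h2]; norm_num)
  refine ⟨fun s => -f' s / f s ^ 2, ?_, by simp [h2], by simp [h3], ?_⟩
  · filter_upwards [h1, hne] with s hs hs' using hs.inv hs'
  · have := h4.neg.div (h1.self_of_nhds.pow 2) (by simp [h2])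
    convert! this using 1
    simp [h2, h3]

theorem sqrt (hf : HasJet f 1 0 c) : HasJet (fun s => √(f s)) 1 0 (c / 2) := by
  obtain ⟨f', h1, h2, h3, h4⟩ := hf
  have hne : ∀ᶠ s in 𝓝 0, f s ≠ 0 :=
    h1.self_of_nhds.continuousAt.eventually_ne (by rw [h2]; norm_num)
  refine ⟨fun s => f' s / (2 * √(f s)), ?_, by simp [h2], by simp [h3], ?_⟩
  · filter_upwards [h1, hne] with s hs hs' using hs.sqrt hs'
  · have := h4.div ((h1.self_of_nhds.sqrt (by rw [h2]; norm_num)).const_mul 2)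
      (by rw [h2]; norm_num)
    convert! this using 1
    simp only [h2, h3, Real.sqrt_one]
    ring

/-- The first and second derivative tests at a zero of a nonnegative function. -/
theorem of_nonneg (hf : HasJet f 0 b c) (h0 : ∀ᶠ s in 𝓝 0, 0 ≤ f s) : b = 0 ∧ 0 ≤ c := by
  obtain ⟨f', h1, h2, h3, h4⟩ := hf
  have hb : b = 0 := by
    have hmin : IsLocalMin f 0 := by
      filter_upwards [h0] with s hs
      rwa [h2]
    rw [← h3]
    exact hmin.hasDerivAt_eq_zero h1.self_of_nhds
  refine ⟨hb, ?_⟩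
  by_contra! hc
  have hd : deriv f =ᶠ[𝓝 0] f' := h1.mono fun s hs => hs.deriv
  have hmax : IsLocalMax f 0 := by
    refine isLocalMax_of_deriv_deriv_neg ?_ ?_ h1.self_of_nhds.continuousAt
    · rw [hd.deriv_eq, h4.deriv]
      exact hc
    · rw [hd.self_of_nhds, h3, hb]
  -- A local maximum which is also a minimum is a point of local constancy.
  have hzero : f =ᶠ[𝓝 0] fun _ => 0 := by
    filter_upwards [h0, hmax] with s hs hs'
    rw [h2] at hs'
    exact le_antisymm hs' hs
  have := (unique ⟨f', h1, h2, h3, h4⟩ ((const 0).congr hzero)).2.2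
  linarith

end HasJet

/-! ### Directional derivatives -/

section Directional

variable {Z : Type*} [NormedAddCommGroup Z] [NormedSpace ℝ Z]

/-- The derivative in the direction of a constant vector field. -/
def dirDeriv (w : Z) (f : Z → ℝ) (z : Z) : ℝ := fderiv ℝ f z w

theorem ContDiffAt.dirDeriv {f : Z → ℝ} {z : Z} {k m : ℕ∞} (hf : ContDiffAt ℝ k f z) (w : Z)
    (hm : m + 1 ≤ k) : ContDiffAt ℝ m (dirDeriv w f) z := by
  have h1 : ContDiffAt ℝ m (fderiv ℝ f) z := hf.fderiv_right (by exact_mod_cast hm)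
  exact h1.clm_apply contDiffAt_const

theorem dirDeriv_comm {f : Z → ℝ} {z : Z} (hf : ContDiffAt ℝ 2 f z) (v w : Z) :
    dirDeriv v (dirDeriv w f) z = dirDeriv w (dirDeriv v f) z := by
  have h1 : DifferentiableAt ℝ (fderiv ℝ f) z :=
    (hf.fderiv_right (m := 1) (by norm_cast)).differentiableAt (by simp)
  have h2 : ∀ v w : Z, dirDeriv v (dirDeriv w f) z = fderiv ℝ (fderiv ℝ f) z v w := fun v w => by
    have h3 : HasFDerivAt (dirDeriv w f) _ z := h1.hasFDerivAt.clm_apply (hasFDerivAt_const w z)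
    rw [dirDeriv.eq_def v, h3.fderiv]
    simp
  rw [h2, h2]
  exact (hf.isSymmSndFDerivAt (by simp)).eq v w

theorem dirDeriv_congr {f g : Z → ℝ} {z : Z} (h : f =ᶠ[𝓝 z] g) (w : Z) :
    dirDeriv w f =ᶠ[𝓝 z] dirDeriv w g :=
  h.fderiv.mono fun y hy => by rw [dirDeriv, dirDeriv, hy]

/-- Two pairs of directional derivatives commute. -/
theorem dirDeriv_comm_pairs {f : Z → ℝ} {z : Z} (hf : ContDiffAt ℝ 4 f z) (v w : Z) :
    dirDeriv v (dirDeriv v (dirDeriv w (dirDeriv w f))) z =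
      dirDeriv w (dirDeriv w (dirDeriv v (dirDeriv v f))) z := by
  have e1 : ∀ f : Z → ℝ, ContDiffAt ℝ 2 f z →
      dirDeriv v (dirDeriv w f) =ᶠ[𝓝 z] dirDeriv w (dirDeriv v f) := by
    intro f hf
    filter_upwards [hf.eventually (by simp)] with y hy using dirDeriv_comm hy v w
  have hf4 : ContDiffAt ℝ ((4 : ℕ∞) : WithTop ℕ∞) f z := hf
  have hw : ContDiffAt ℝ ((3 : ℕ∞) : WithTop ℕ∞) (dirDeriv w f) z :=
    hf4.dirDeriv w (by norm_num)
  have hv : ContDiffAt ℝ ((3 : ℕ∞) : WithTop ℕ∞) (dirDeriv v f) z :=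
    hf4.dirDeriv v (by norm_num)
  have hwv : ContDiffAt ℝ 2 (dirDeriv w (dirDeriv v f)) z :=
    hv.dirDeriv (m := 2) w (by norm_num)
  have hvw : ContDiffAt ℝ 2 (dirDeriv v (dirDeriv w f)) z :=
    hw.dirDeriv (m := 2) v (by norm_num)
  calc dirDeriv v (dirDeriv v (dirDeriv w (dirDeriv w f))) z
      = dirDeriv v (dirDeriv w (dirDeriv v (dirDeriv w f))) z :=
        (dirDeriv_congr (e1 _ (hw.of_le (by norm_num))) v).self_of_nhds
    _ = dirDeriv w (dirDeriv v (dirDeriv v (dirDeriv w f))) z := dirDeriv_comm hvw v w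
    _ = dirDeriv w (dirDeriv v (dirDeriv w (dirDeriv v f))) z :=
        (dirDeriv_congr (dirDeriv_congr (e1 _ (hf.of_le (by norm_num))) v) w).self_of_nhds
    _ = dirDeriv w (dirDeriv w (dirDeriv v (dirDeriv v f))) z :=
        (dirDeriv_congr (e1 _ (hv.of_le (by norm_num))) w).self_of_nhds

/-- The derivatives `∂ₜ∂ᵢ∂ᵢ` and `∂ᵢ∂ᵢ∂ₜ` agree. -/
theorem dirDeriv_comm_triple {f : Z → ℝ} {z : Z} (hf : ContDiffAt ℝ 4 f z) (v w : Z) :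
    dirDeriv v (dirDeriv w (dirDeriv w f)) z = dirDeriv w (dirDeriv w (dirDeriv v f)) z := by
  have hf4 : ContDiffAt ℝ ((4 : ℕ∞) : WithTop ℕ∞) f z := hf
  have hw : ContDiffAt ℝ 2 (dirDeriv w f) z := hf4.dirDeriv (m := 2) w (by norm_num)
  have e1 : dirDeriv v (dirDeriv w f) =ᶠ[𝓝 z] dirDeriv w (dirDeriv v f) := by
    filter_upwards [hf.eventually (by simp)] with y hy
    exact dirDeriv_comm (hy.of_le (by norm_num)) v w
  rw [dirDeriv_comm hw v w]
  exact (dirDeriv_congr e1 w).self_of_nhds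

/-- The jet of a function along a line. -/
theorem hasJet_line {f : Z → ℝ} {z : Z} (hf : ContDiffAt ℝ 2 f z) (w : Z) :
    HasJet (fun s : ℝ => f (z + s • w)) (f z) (dirDeriv w f z)
      (dirDeriv w (dirDeriv w f) z) := by
  have hline : ∀ s : ℝ, HasDerivAt (fun s : ℝ => z + s • w) w s := fun s => by
    simpa using ((hasDerivAt_id s).smul_const w).const_add z
  have hcont : Filter.Tendsto (fun s : ℝ => z + s • w) (𝓝 0) (𝓝 z) := by
    simpa using (hline 0).continuousAt.tendsto
  refine ⟨fun s => dirDeriv w f (z + s • w), ?_, by simp, by simp, ?_⟩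
  · filter_upwards [hcont.eventually (hf.eventually (by simp))] with s hs
    exact (hs.differentiableAt (by simp)).hasFDerivAt.comp_hasDerivAt s (hline s)
  · have h1 : ContDiffAt ℝ 1 (dirDeriv w f) (z + (0 : ℝ) • w) := by
      rw [zero_smul, add_zero]
      exact ContDiffAt.dirDeriv (k := 2) (m := 1) hf w (by norm_num)
    have h2 := (h1.differentiableAt (by simp)).hasFDerivAt.comp_hasDerivAt (0 : ℝ) (hline 0)
    have h3 : dirDeriv w (dirDeriv w f) z = fderiv ℝ (dirDeriv w f) (z + (0 : ℝ) • w) w := by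
      rw [zero_smul, add_zero, dirDeriv]
    rw [h3]
    exact h2

end Directional

/-! ### Graphs in the Klein model -/

/-- The unit vector of space-time in the direction of the `i`-th space coordinate. -/
def spaceDir {n : ℕ} (i : Fin n) : ℝ × EuclideanSpace ℝ (Fin n) :=
  (0, EuclideanSpace.single i 1)

/-- The unit vector of space-time in the direction of time. -/
def timeDir (n : ℕ) : ℝ × EuclideanSpace ℝ (Fin n) := (1, 0)

namespace KleinGraph

variable {n : ℕ} (u : ℝ × EuclideanSpace ℝ (Fin n) → ℝ)

/-- The first space derivatives. -/
def d1 (i : Fin n) : ℝ × EuclideanSpace ℝ (Fin n) → ℝ := dirDeriv (spaceDir i) u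

/-- The second space derivatives. -/
def d2 (i j : Fin n) : ℝ × EuclideanSpace ℝ (Fin n) → ℝ := dirDeriv (spaceDir i) (d1 u j)

/-- The timelike component `α` of the normal `(α, -∂u, 1)` of the graph `(1, y, u)`; components
refer to an orthonormal frame of Minkowski space. Orthogonality to the position fixes its value. -/
def normalTime (z : ℝ × EuclideanSpace ℝ (Fin n)) : ℝ := u z - ∑ i, z.2 i * d1 u i z

/-- The auxiliary covector `∂u + α y`, which describes the tangential part of the normal. -/
def normalSpace (i : Fin n) (z : ℝ × EuclideanSpace ℝ (Fin n)) : ℝ :=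
  d1 u i z + normalTime u z * z.2 i

/-- The Minkowski square of the normal `(α, -∂u, 1)`. -/
def normalSq (z : ℝ × EuclideanSpace ℝ (Fin n)) : ℝ :=
  1 + ∑ i, d1 u i z ^ 2 - normalTime u z ^ 2

/-- Minus the Minkowski square of the point `(1, y, u)`. -/
def pointSq (z : ℝ × EuclideanSpace ℝ (Fin n)) : ℝ := 1 - ∑ i, z.2 i ^ 2 - u z ^ 2

/-- The trace of the Hessian of `u` with respect to the metric of the graph, divided by `n`. Up to a
factor whose sign depends on the orientation it is the mean curvature, see `geometry_of_graph`. -/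
def traceHess (z : ℝ × EuclideanSpace ℝ (Fin n)) : ℝ :=
  (1 / n) * (pointSq u z * (∑ i, d2 u i i z - ∑ i, ∑ j, z.2 i * z.2 j * d2 u i j z -
    (∑ i, ∑ j, normalSpace u i z * normalSpace u j z * d2 u i j z) * (normalSq u z)⁻¹))

/-- The diagonal entries of the metric of the graph, after the point `(1, y, u)` has been scaled to
the hyperboloid. -/
def metricDiag (k : Fin n) (z : ℝ × EuclideanSpace ℝ (Fin n)) : ℝ :=
  (pointSq u z)⁻¹ * (1 + d1 u k z ^ 2) + (pointSq u z)⁻¹ ^ 2 * (z.2 k + u z * d1 u k z) ^ 2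

variable {u}

theorem sum_sum_ite (d l : Fin n → ℝ) :
    ∑ i, ∑ j, 2 * d i * d j * (if i = j then l i else 0) = 2 * ∑ i, d i ^ 2 * l i := by
  simp only [mul_ite, mul_zero, Finset.sum_ite_eq, Finset.mem_univ, if_true, Finset.mul_sum]
  exact Finset.sum_congr rfl fun i _ => by ring

/-- Jets of the geometric quantities along a line through a point at which the graph is tangent to
the horizontal hyperplane. The coordinates of the line are `d i * s`. -/
theorem hasJet_geometry {γ : ℝ → ℝ × EuclideanSpace ℝ (Fin n)} {u1 u2 : ℝ} {d p p2 l : Fin n → ℝ}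
    {q r : Fin n → Fin n → ℝ} (hγ : ∀ i, HasJet (fun s => (γ s).2 i) 0 (d i) 0)
    (h0 : HasJet (fun s => u (γ s)) 0 u1 u2) (h1 : ∀ i, HasJet (fun s => d1 u i (γ s)) 0 (p i) (p2 i))
    (h2 : ∀ i j, HasJet (fun s => d2 u i j (γ s)) (if i = j then l i else 0) (q i j) (r i j)) :
    HasJet (fun s => normalSq u (γ s)) 1 0 (2 * ∑ i, p i ^ 2 - 2 * u1 ^ 2) ∧
    HasJet (fun s => pointSq u (γ s)) 1 0 (-(2 * ∑ i, d i ^ 2 + 2 * u1 ^ 2)) ∧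
    HasJet (fun s => traceHess u (γ s)) ((1 / n) * ∑ i, l i) ((1 / n) * ∑ i, q i i)
      ((1 / n) * (∑ i, r i i - (2 * ∑ i, d i ^ 2 + 2 * u1 ^ 2) * ∑ i, l i -
        2 * ∑ i, d i ^ 2 * l i - 2 * ∑ i, p i ^ 2 * l i)) ∧
    ∀ k, HasJet (fun s => metricDiag u k (γ s)) 1 0
      (2 * ∑ i, d i ^ 2 + 2 * u1 ^ 2 + 2 * p k ^ 2 + 2 * d k ^ 2) := by
  have hα : HasJet (fun s => normalTime u (γ s)) 0 u1 (u2 - 2 * ∑ i, d i * p i) := by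
    refine (h0.sub (HasJet.sum fun i => (hγ i).mul (h1 i))).cast (by simp) (by simp) ?_
    simp only [zero_mul, zero_add, add_zero, Finset.mul_sum]
    congr 1
    exact Finset.sum_congr rfl fun i _ => by ring
  have hb : ∀ i, ∃ c, HasJet (fun s => normalSpace u i (γ s)) 0 (p i) c := fun i =>
    ⟨_, ((h1 i).add (hα.mul (hγ i))).cast (by simp) (by simp) rfl⟩
  choose bc hb using hb
  have hW : HasJet (fun s => normalSq u (γ s)) 1 0 (2 * ∑ i, p i ^ 2 - 2 * u1 ^ 2) := by
    refine (((HasJet.const 1).add (HasJet.sum fun i => (h1 i).sq)).sub hα.sq).cast (by simp)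
      (by simp) ?_
    simp only [mul_zero, zero_mul, zero_add, Finset.mul_sum]
  have hC : HasJet (fun s => pointSq u (γ s)) 1 0 (-(2 * ∑ i, d i ^ 2 + 2 * u1 ^ 2)) := by
    refine (((HasJet.const 1).sub (HasJet.sum fun i => (hγ i).sq)).sub h0.sq).cast (by simp)
      (by simp) ?_
    simp only [mul_zero, zero_mul, zero_add, Finset.mul_sum]
    ring
  have hX : HasJet (fun s => ∑ i, d2 u i i (γ s)) (∑ i, l i) (∑ i, q i i) (∑ i, r i i) :=
    HasJet.sum fun i => (h2 i i).cast (by simp) rfl rfl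
  have quad : ∀ {b : Fin n → ℝ → ℝ} {e c : Fin n → ℝ}, (∀ i, HasJet (b i) 0 (e i) (c i)) →
      HasJet (fun s => ∑ i, ∑ j, b i s * b j s * d2 u i j (γ s)) 0 0 (2 * ∑ i, e i ^ 2 * l i) := by
    intro b e c hbe
    rw [← sum_sum_ite]
    refine (HasJet.sum fun i => HasJet.sum fun j => ((hbe i).mul (hbe j)).mul (h2 i j)).cast
      (by simp) (by simp) ?_
    simp
  have hY := quad hγ
  have hZ := quad hb
  have hL : HasJet (fun s => traceHess u (γ s)) ((1 / n) * ∑ i, l i) ((1 / n) * ∑ i, q i i)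
      ((1 / n) * (∑ i, r i i - (2 * ∑ i, d i ^ 2 + 2 * u1 ^ 2) * ∑ i, l i -
        2 * ∑ i, d i ^ 2 * l i - 2 * ∑ i, p i ^ 2 * l i)) := by
    refine ((hC.mul ((hX.sub hY).sub (hZ.mul hW.inv))).const_mul _).cast ?_ ?_ ?_ <;> ring
  have hg : ∀ k, HasJet (fun s => metricDiag u k (γ s)) 1 0
      (2 * ∑ i, d i ^ 2 + 2 * u1 ^ 2 + 2 * p k ^ 2 + 2 * d k ^ 2) := fun k => by
    refine ((hC.inv.mul ((HasJet.const 1).add (h1 k).sq)).add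
      (hC.inv.sq.mul ((hγ k).add (h0.mul (h1 k))).sq)).cast ?_ ?_ ?_ <;> ring
  exact ⟨hW, hC, hL, hg⟩

theorem contDiffAt_d1 {z : ℝ × EuclideanSpace ℝ (Fin n)} {k m : ℕ∞} (hu : ContDiffAt ℝ k u z)
    (hm : m + 1 ≤ k) (i : Fin n) : ContDiffAt ℝ m (d1 u i) z := hu.dirDeriv _ hm

theorem hasJet_coord (z : ℝ × EuclideanSpace ℝ (Fin n)) (w : ℝ × EuclideanSpace ℝ (Fin n))
    (i : Fin n) : HasJet (fun s : ℝ => (z + s • w).2 i) (z.2 i) (w.2 i) 0 := by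
  refine ⟨fun _ => w.2 i, .of_forall fun s => ?_, by simp, rfl, hasDerivAt_const _ _⟩
  have : (fun s : ℝ => (z + s • w).2 i) = fun s => z.2 i + s * w.2 i := by
    ext s
    simp
  rw [this]
  simpa using ((hasDerivAt_id s).mul_const (w.2 i)).const_add (z.2 i)

/-- The maximum principle at a point where the second fundamental form of the evolving graph has a
principal curvature equal to half of the mean curvature. The pinching defect in the direction `i₀` has
a minimum there, so its time derivative vanishes and its second derivatives in all space directions
are nonnegative. Both are expressed by the evolution equation; on adding them up, all terms that
involve fourth derivatives of `u` cancel, and an inequality for the reaction terms remains. Here `κ`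
is the forcing term along the graph, `Q k` its Hessian in the direction `k`, and `ℓ` its derivative
in the direction of the normal. -/
theorem reaction_le (hn : 1 ≤ n) {z : ℝ × EuclideanSpace ℝ (Fin n)} (hz : z.2 = 0)
    (hu : ContDiffAt ℝ 4 u z) (hu0 : u z = 0) (hu1 : ∀ i, d1 u i z = 0) {l : Fin n → ℝ}
    (hu2 : ∀ i j, d2 u i j z = if i = j then l i else 0)
    {H : ℝ} (hH : H = (1 / n) * ∑ i, l i) {i₀ : Fin n} (hi₀ : l i₀ = H / 2)
    {κ : ℝ × EuclideanSpace ℝ (Fin n) → ℝ} {κ0 ℓ : ℝ} {κ1 Q : Fin n → ℝ}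
    (hκ : ∀ k, HasJet (fun s => κ (z + s • spaceDir k)) κ0 (κ1 k) (Q k + l k * ℓ))
    (hflow : ∀ᶠ y in 𝓝 z, dirDeriv (timeDir n) u y =
      traceHess u y - √(normalSq u y * pointSq u y) * κ y)
    (hpinch : ∀ᶠ y in 𝓝 z, 0 ≤ d2 u i₀ i₀ y - (1 / 2) * (traceHess u y * metricDiag u i₀ y)) :
    κ0 * ((1 / (2 * n)) * ∑ i, l i ^ 2 - H ^ 2 / 4 + 1 / 2) - H - Q i₀ +
      (1 / (2 * n)) * ∑ i, Q i ≤ 0 := by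
  have hn0 : (n : ℝ) ≠ 0 := by exact_mod_cast (by omega : n ≠ 0)
  have hu' : ContDiffAt ℝ ((4 : ℕ∞) : WithTop ℕ∞) u z := hu
  have hd1 : ∀ i, ContDiffAt ℝ ((3 : ℕ∞) : WithTop ℕ∞) (d1 u i) z := fun i =>
    contDiffAt_d1 hu' (by norm_num) i
  have hd2 : ∀ i j, ContDiffAt ℝ 2 (d2 u i j) z := fun i j =>
    (hd1 j).dirDeriv (m := 2) _ (by norm_num)
  have hline : ∀ w : ℝ × EuclideanSpace ℝ (Fin n),
      Filter.Tendsto (fun s : ℝ => z + s • w) (𝓝 0) (𝓝 z) := fun w => by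
    have : Continuous fun s : ℝ => z + s • w := by fun_prop
    simpa using this.tendsto 0
  have hgeom : ∀ w : ℝ × EuclideanSpace ℝ (Fin n), _ := fun w =>
    hasJet_geometry (u := u) (γ := fun s => z + s • w) (u1 := dirDeriv w u z)
      (u2 := dirDeriv w (dirDeriv w u) z) (d := fun i => w.2 i)
      (p := fun i => dirDeriv w (d1 u i) z) (p2 := fun i => dirDeriv w (dirDeriv w (d1 u i)) z)
      (l := l) (q := fun i j => dirDeriv w (d2 u i j) z)
      (r := fun i j => dirDeriv w (dirDeriv w (d2 u i j)) z)
      (fun i => (hasJet_coord z w i).cast (by simp [hz]) rfl rfl)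
      ((hasJet_line (hu.of_le (by norm_num)) w).cast hu0 rfl rfl)
      (fun i => (hasJet_line ((hd1 i).of_le (by norm_num)) w).cast (hu1 i) rfl rfl)
      (fun i j => (hasJet_line (hd2 i j) w).cast (hu2 i j) rfl rfl)
  have hΦ : ∀ w : ℝ × EuclideanSpace ℝ (Fin n), _ := fun w =>
    ((((hasJet_line (hd2 i₀ i₀) w).cast ((hu2 i₀ i₀).trans (if_pos rfl)) rfl rfl).sub
      (((hgeom w).2.2.1.mul ((hgeom w).2.2.2 i₀)).const_mul (1 / 2))).cast
        (by rw [hi₀, hH]; ring) rfl rfl).of_nonneg ((hline w).eventually hpinch)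
  -- Since the flow extends to both sides in time, the time derivative of the defect vanishes.
  have htime := (hΦ (timeDir n)).1
  have hτ : ∀ i, dirDeriv (timeDir n) (d2 u i i) z =
      dirDeriv (spaceDir i) (dirDeriv (spaceDir i) (dirDeriv (timeDir n) u)) z := fun i =>
    dirDeriv_comm_triple hu _ _
  simp only [hτ] at htime
  -- Second space derivatives of the evolution equation.
  have hdir : ∀ k : Fin n, ∑ i, (spaceDir k).2 i ^ 2 = (1 : ℝ) := fun k => by
    simp [spaceDir, PiLp.single_apply]
  have hdir2 : ∀ (k : Fin n) (f : Fin n → ℝ), ∑ i, (spaceDir k).2 i ^ 2 * f i = f k := fun k f => by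
    simp [spaceDir, PiLp.single_apply]
  have hp : ∀ k i, dirDeriv (spaceDir k) (d1 u i) z = if k = i then l k else 0 := fun k i => hu2 k i
  have hp2 : ∀ (k : Fin n), ∑ i, dirDeriv (spaceDir k) (d1 u i) z ^ 2 = l k ^ 2 := fun k => by
    simp [hp]
  have hp3 : ∀ (k : Fin n), ∑ i, dirDeriv (spaceDir k) (d1 u i) z ^ 2 * l i = l k ^ 3 := fun k => by
    simp only [hp, ite_pow]
    simp
    ring
  have hp1 : ∀ k, dirDeriv (spaceDir k) u z = 0 := hu1
  have hL : ∀ k, HasJet (fun s => traceHess u (z + s • spaceDir k)) H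
      ((1 / n) * ∑ i, dirDeriv (spaceDir k) (d2 u i i) z)
      ((1 / n) * ∑ i, dirDeriv (spaceDir k) (dirDeriv (spaceDir k) (d2 u i i)) z - 2 * H -
        (2 / n) * l k - (2 / n) * l k ^ 3) := fun k => by
    refine (hgeom (spaceDir k)).2.2.1.cast hH.symm rfl ?_
    simp only [hdir, hdir2, hp3, hp1]
    rw [hH]
    ring
  have hut : ContDiffAt ℝ 2 (dirDeriv (timeDir n) u) z :=
    (hu'.dirDeriv (m := 3) _ (by norm_num)).of_le (by norm_num)
  have hspace : ∀ k,
      dirDeriv (spaceDir k) (dirDeriv (spaceDir k) (dirDeriv (timeDir n) u)) z =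
        ((1 / n) * ∑ i, dirDeriv (spaceDir k) (dirDeriv (spaceDir k) (d2 u i i)) z - 2 * H -
          (2 / n) * l k - (2 / n) * l k ^ 3) -
        (Q k + l k * ℓ + κ0 * (l k ^ 2 - 1)) := fun k => by
    have h1 := ((hL k).sub ((((hgeom (spaceDir k)).1.mul
      (hgeom (spaceDir k)).2.1).cast (by ring) (by ring) rfl).sqrt.mul (hκ k))).congr
        ((hline (spaceDir k)).eventually hflow)
    have h2 := ((hasJet_line hut (spaceDir k)).unique h1).2.2
    rw [h2]
    simp only [hdir, hp2, hp1]
    ring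
  have hpos : ∀ k, 0 ≤ dirDeriv (spaceDir k) (dirDeriv (spaceDir k) (d2 u i₀ i₀)) z -
      (1 / 2) * (((1 / n) * ∑ i, dirDeriv (spaceDir k) (dirDeriv (spaceDir k) (d2 u i i)) z -
        2 * H - (2 / n) * l k - (2 / n) * l k ^ 3) +
        H * (2 + if k = i₀ then 2 * l k ^ 2 + 2 else 0)) := fun k => by
    refine (hΦ (spaceDir k)).2.trans_eq ?_
    simp only [hdir, hdir2, hp, hp1]
    rw [← hH]
    by_cases hk : k = i₀
    · subst hk
      simp [spaceDir]
      rw [hH]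
      ring
    · simp [hk, spaceDir, Ne.symm hk]
      rw [hH]
      ring
  have hsum := Finset.sum_nonneg fun k (_ : k ∈ Finset.univ) => hpos k
  have hcomm : ∀ k, dirDeriv (spaceDir k) (dirDeriv (spaceDir k) (d2 u i₀ i₀)) z =
      dirDeriv (spaceDir i₀) (dirDeriv (spaceDir i₀) (d2 u k k)) z := fun k =>
    dirDeriv_comm_pairs hu _ _
  simp only [hcomm] at hsum
  set P : Fin n → ℝ := fun k =>
    (1 / n) * ∑ i, dirDeriv (spaceDir k) (dirDeriv (spaceDir k) (d2 u i i)) z - 2 * H -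
      (2 / n) * l k - (2 / n) * l k ^ 3 with hP
  have hP0 : ∑ k, dirDeriv (spaceDir i₀) (dirDeriv (spaceDir i₀) (d2 u k k)) z =
      n * P i₀ + 2 * n * H + 2 * l i₀ + 2 * l i₀ ^ 3 := by
    simp only [hP]
    field_simp
    ring
  have h1 : 0 ≤ n * P i₀ + n * H - (1 / 2) * ∑ k, P k := by
    have h2 : ∑ k, (dirDeriv (spaceDir i₀) (dirDeriv (spaceDir i₀) (d2 u k k)) z -
        1 / 2 * (P k + H * (2 + if k = i₀ then 2 * l k ^ 2 + 2 else 0))) =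
        n * P i₀ + 2 * n * H + 2 * l i₀ + 2 * l i₀ ^ 3 -
          1 / 2 * (∑ k, P k + H * (2 * n + (2 * l i₀ ^ 2 + 2))) := by
      rw [Finset.sum_sub_distrib, hP0, ← Finset.mul_sum, Finset.sum_add_distrib, ← Finset.mul_sum,
        Finset.sum_add_distrib]
      simp [mul_comm]
    rw [h2, hi₀] at hsum
    linarith
  have hl : ∑ k, l k = n * H := by
    rw [hH]
    field_simp
  have hR : ∑ k, (Q k + l k * ℓ + κ0 * (l k ^ 2 - 1)) =
      ∑ k, Q k + n * H * ℓ + κ0 * (∑ k, l k ^ 2 - n) := by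
    rw [Finset.sum_add_distrib, Finset.sum_add_distrib, ← Finset.sum_mul, ← Finset.mul_sum,
      Finset.sum_sub_distrib, hl]
    simp
  have h3 : P i₀ - (Q i₀ + l i₀ * ℓ + κ0 * (l i₀ ^ 2 - 1)) - (1 / (2 * n)) *
      (∑ k, P k - (∑ k, Q k + n * H * ℓ + κ0 * (∑ k, l k ^ 2 - n))) = 0 := by
    rw [← hR, ← Finset.sum_sub_distrib]
    simp only [hspace] at htime
    rw [← htime]
    ring
  have h4 : 0 ≤ P i₀ + H - (1 / (2 * n)) * ∑ k, P k := by
    have : P i₀ + H - (1 / (2 * n)) * ∑ k, P k =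
        (1 / n) * (n * P i₀ + n * H - (1 / 2) * ∑ k, P k) := by
      field_simp
    rw [this]
    positivity
  rw [hi₀] at h3
  have h5 : (1 / (2 * (n : ℝ))) * (∑ k, P k - (∑ k, Q k + n * H * ℓ + κ0 * (∑ k, l k ^ 2 - n))) =
      (1 / (2 * n)) * ∑ k, P k - (1 / (2 * n)) * ∑ k, Q k - H * ℓ / 2 -
        κ0 * ((1 / (2 * n)) * ∑ k, l k ^ 2) + κ0 / 2 := by
    field_simp
    ring
  rw [h5] at h3
  linarith

end KleinGraph

/-! ### Geometry of Klein graphs -/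

section GraphGeometry

variable {n : ℕ}

/-- An orthonormal frame of Minkowski space, `o` being timelike. -/
structure IsMinkFrame (o : Mink n) (e : Fin n → Mink n) (ν : Mink n) : Prop where
  oo : mink o o = -1
  νν : mink ν ν = 1
  oν : mink o ν = 0
  ee : ∀ i j, mink (e i) (e j) = if i = j then 1 else 0
  oe : ∀ i, mink o (e i) = 0
  νe : ∀ i, mink ν (e i) = 0
  expand : ∀ w, w = -mink o w • o + ∑ i, mink (e i) w • e i + mink ν w • ν

@[simp] theorem mink_sum_right {ι : Type*} (s : Finset ι) (x : Mink n) (f : ι → Mink n) :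
    mink x (∑ i ∈ s, f i) = ∑ i ∈ s, mink x (f i) := map_sum (minkForm n x) f s

@[simp] theorem mink_sum_left {ι : Type*} (s : Finset ι) (x : Mink n) (f : ι → Mink n) :
    mink (∑ i ∈ s, f i) x = ∑ i ∈ s, mink (f i) x := by
  simp only [mink_comm _ x, mink_sum_right]

namespace KleinGraph

/-- The point of the affine chart of the Klein model over the coordinates `z.2` at height `u z`. -/
def point (o : Mink n) (e : Fin n → Mink n) (ν : Mink n) (u : ℝ × EuclideanSpace ℝ (Fin n) → ℝ)
    (z : ℝ × EuclideanSpace ℝ (Fin n)) : Mink n := o + ∑ i, z.2 i • e i + u z • ν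

variable {o : Mink n} {e : Fin n → Mink n} {ν : Mink n} {u : ℝ × EuclideanSpace ℝ (Fin n) → ℝ}
  {z : ℝ × EuclideanSpace ℝ (Fin n)}

theorem mink_point_left (w : Mink n) : mink (point o e ν u z) w =
    mink o w + ∑ i, z.2 i * mink (e i) w + u z * mink ν w := by
  simp [point]

theorem mink_point_self (hf : IsMinkFrame o e ν) :
    mink (point o e ν u z) (point o e ν u z) = -pointSq u z := by
  have h1 : mink o (point o e ν u z) = -1 := by
    simp [point, hf.oo, hf.oν, hf.oe]
  have h2 : ∀ i, mink (e i) (point o e ν u z) = z.2 i := fun i => by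
    simp [point, hf.ee, mink_comm (e i) o, hf.oe, mink_comm (e i) ν, hf.νe]
  have h3 : mink ν (point o e ν u z) = u z := by
    simp [point, hf.νν, mink_comm ν o, hf.oν, hf.νe]
  rw [mink_point_left, h1, h3, pointSq]
  simp only [h2]
  have : ∑ i, z.2 i * z.2 i = ∑ i, z.2 i ^ 2 := Finset.sum_congr rfl fun i _ => by ring
  rw [this]
  ring

theorem mink_point_tangent (hf : IsMinkFrame o e ν) (c : ℝ) (j : Fin n) :
    mink (point o e ν u z) (e j + c • ν) = z.2 j + u z * c := by
  rw [mink_point_left]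
  simp [hf.oe, hf.oν, hf.ee, hf.νe, hf.νν, mink_comm _ ν]

theorem mink_tangent_tangent (hf : IsMinkFrame o e ν) (c d : ℝ) (i j : Fin n) :
    mink (e i + c • ν) (e j + d • ν) = (if i = j then 1 else 0) + c * d := by
  simp [hf.ee, hf.νe, hf.νν, mink_comm _ ν, mul_comm]

theorem hasDerivAt_point (hu : DifferentiableAt ℝ u z) (w : ℝ × EuclideanSpace ℝ (Fin n)) :
    HasDerivAt (fun s : ℝ => point o e ν u (z + s • w))
      (∑ i, w.2 i • e i + dirDeriv w u z • ν) 0 := by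
  have h1 : HasDerivAt (fun s : ℝ => z + s • w) w 0 := by
    simpa using ((hasDerivAt_id (0 : ℝ)).smul_const w).const_add z
  have h2 : HasDerivAt (fun s : ℝ => u (z + s • w)) (dirDeriv w u z) 0 := by
    have h3 : HasFDerivAt u (fderiv ℝ u z) (z + (0 : ℝ) • w) := by
      simpa using hu.hasFDerivAt
    exact h3.comp_hasDerivAt (0 : ℝ) h1
  have h4 : ∀ i, HasDerivAt (fun s : ℝ => (z + s • w).2 i • e i) (w.2 i • e i) 0 := fun i => by
    have : (fun s : ℝ => (z + s • w).2 i • e i) = fun s => (z.2 i + s * w.2 i) • e i := by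
      ext1 s
      simp
    rw [this]
    simpa using (((hasDerivAt_id (0 : ℝ)).mul_const (w.2 i)).const_add (z.2 i)).smul_const (e i)
  have h5 := ((hasDerivAt_const (0 : ℝ) o).add
    (HasDerivAt.fun_sum fun i (_ : i ∈ Finset.univ) => h4 i)).add (h2.smul_const ν)
  rw [zero_add] at h5
  exact h5

theorem sum_spaceDir_smul (k : Fin n) : ∑ i, (spaceDir k).2 i • e i = e k := by
  simp [spaceDir, PiLp.single_apply]

/-- The explicit inverse of the metric of a Klein graph. -/
theorem inverse_metric {y d b m : Fin n → ℝ} {v α Q W : ℝ} (hα : α = v - ∑ i, y i * d i)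
    (hb : ∀ i, b i = d i + α * y i) (hm : ∀ i, m i = y i + v * d i)
    (hQ : Q = 1 - ∑ i, y i ^ 2 - v ^ 2) (hW : W = 1 + ∑ i, d i ^ 2 - α ^ 2) (hQ0 : Q ≠ 0)
    (hW0 : W ≠ 0) :
    (Matrix.of fun i j => Q * ((if i = j then 1 else 0) - y i * y j - b i * b j * W⁻¹)) *
      (Matrix.of fun i j => Q⁻¹ * ((if i = j then 1 else 0) + d i * d j) +
        Q⁻¹ ^ 2 * (m i * m j)) = (1 : Matrix (Fin n) (Fin n) ℝ) := by
  ext i j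
  rw [Matrix.mul_apply, Matrix.one_apply]
  simp only [Matrix.of_apply]
  set Y := ∑ i, y i ^ 2 with hY
  set D := ∑ i, d i ^ 2 with hD
  set p := ∑ i, y i * d i with hp
  have e1 : ∀ k, Q * ((if i = k then 1 else 0) - y i * y k - b i * b k * W⁻¹) *
      (Q⁻¹ * ((if k = j then 1 else 0) + d k * d j) + Q⁻¹ ^ 2 * (m k * m j)) =
      (if i = k then (1 : ℝ) else 0) * (if k = j then 1 else 0) +
      (if i = k then (1 : ℝ) else 0) * (d k * d j + Q⁻¹ * (m k * m j)) -
      (if k = j then (1 : ℝ) else 0) * (y i * y k + W⁻¹ * (b i * (d k + α * y k))) -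
      ((y i + W⁻¹ * b i * α) * (d j + Q⁻¹ * m j * v) * (y k * d k) +
        (y i + W⁻¹ * b i * α) * (Q⁻¹ * m j) * y k ^ 2 +
        W⁻¹ * b i * (d j + Q⁻¹ * m j * v) * d k ^ 2 +
        W⁻¹ * b i * (Q⁻¹ * m j) * (y k * d k)) := fun k => by
    have hQQ : Q * Q⁻¹ = 1 := mul_inv_cancel₀ hQ0
    have hk := hb k
    have hmk := hm k
    set δ₁ : ℝ := if i = k then 1 else 0
    set δ₂ : ℝ := if k = j then 1 else 0
    rw [hk]
    have : Q * (δ₁ - y i * y k - b i * (d k + α * y k) * W⁻¹) *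
        (Q⁻¹ * (δ₂ + d k * d j) + Q⁻¹ ^ 2 * (m k * m j)) =
        (Q * Q⁻¹) * (δ₁ - y i * y k - b i * (d k + α * y k) * W⁻¹) *
        ((δ₂ + d k * d j) + Q⁻¹ * (m k * m j)) := by ring
    rw [this, hQQ, hmk]
    ring
  rw [Finset.sum_congr rfl fun k _ => e1 k, Finset.sum_sub_distrib, Finset.sum_sub_distrib,
    Finset.sum_add_distrib, Finset.sum_add_distrib, Finset.sum_add_distrib, Finset.sum_add_distrib,
    ← Finset.mul_sum, ← Finset.mul_sum, ← Finset.mul_sum, ← Finset.mul_sum, ← hY, ← hD, ← hp]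
  simp only [ite_mul, one_mul, zero_mul, Finset.sum_ite_eq, Finset.sum_ite_eq', Finset.mem_univ,
    if_true]
  rw [hm i, hm j, hb i]
  have hp' : p = v - α := by linarith
  have hY' : Y = 1 - v ^ 2 - Q := by linarith
  have hD' : D = W - 1 + α ^ 2 := by linarith
  rw [hp', hY', hD']
  field_simp
  ring

theorem diff_spaceDir {f : HypImmersion n} {θ : ℝ × EuclideanSpace ℝ (Fin n) → Sph n}
    {a : ℝ × EuclideanSpace ℝ (Fin n) → ℝ}
    (hθ : MDifferentiableAt 𝓘(ℝ, ℝ × EuclideanSpace ℝ (Fin n)) (𝓡 n) θ z)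
    (ha : DifferentiableAt ℝ a z) (hu : DifferentiableAt ℝ u z)
    (hrep : ∀ᶠ y in 𝓝 z, y.1 = z.1 → f.amb (θ y) = a y • point o e ν u y) (j : Fin n) :
    HypImmersion.diff f.amb (θ z)
        (mfderiv 𝓘(ℝ, ℝ × EuclideanSpace ℝ (Fin n)) (𝓡 n) θ z (spaceDir j)) =
      dirDeriv (spaceDir j) a z • point o e ν u z + a z • (e j + d1 u j z • ν) := by
  have hline : HasDerivAt (fun s : ℝ => z + s • spaceDir j) (spaceDir j) 0 := by
    simpa using ((hasDerivAt_id (0 : ℝ)).smul_const (spaceDir j)).const_add z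
  obtain ⟨D, hD, hD'⟩ := hasFDerivAt_comp_parametrisation (f.mdifferentiableAt_amb _) hθ
  have hz0 : z = z + (0 : ℝ) • spaceDir j := by simp
  rw [← hD' (spaceDir j)]
  have h1 : HasDerivAt (fun s : ℝ => f.amb (θ (z + s • spaceDir j))) (D (spaceDir j)) 0 := by
    rw [hz0] at hD
    exact hD.comp_hasDerivAt (0 : ℝ) hline
  have h2 : HasDerivAt (fun s : ℝ => a (z + s • spaceDir j)) (dirDeriv (spaceDir j) a z) 0 := by
    have h3 : HasFDerivAt a (fderiv ℝ a z) (z + (0 : ℝ) • spaceDir j) := by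
      simpa using ha.hasFDerivAt
    exact h3.comp_hasDerivAt (0 : ℝ) hline
  have h4 := h2.smul (hasDerivAt_point (o := o) (e := e) (ν := ν) hu (spaceDir j))
  rw [sum_spaceDir_smul] at h4
  have h5 : (fun s : ℝ => f.amb (θ (z + s • spaceDir j))) =ᶠ[𝓝 0]
      fun s => a (z + s • spaceDir j) • point o e ν u (z + s • spaceDir j) := by
    have hcont : Filter.Tendsto (fun s : ℝ => z + s • spaceDir j) (𝓝 0) (𝓝 z) := by
      simpa using hline.continuousAt.tendsto
    filter_upwards [hcont.eventually hrep] with s hs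
    exact hs (by simp [spaceDir])
  rw [h1.unique (h4.congr_of_eventuallyEq h5)]
  simp only [zero_smul, add_zero]
  rw [add_comm]
  rfl

/-- The unit normal, the mean curvature and the fundamental forms of an immersion which is locally
a Klein graph at time `z.1`, in the given parametrisation. The sign of `σ` distinguishes the two unit
normals. -/
theorem geometry_of_graph (hfr : IsMinkFrame o e ν) {f : HypImmersion n} {N : Sph n → Mink n}
    (hN : f.IsUnitNormal N) {θ : ℝ × EuclideanSpace ℝ (Fin n) → Sph n}
    {a : ℝ × EuclideanSpace ℝ (Fin n) → ℝ}
    (hθ : ∀ᶠ y in 𝓝 z, MDifferentiableAt 𝓘(ℝ, ℝ × EuclideanSpace ℝ (Fin n)) (𝓡 n) θ y)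
    (ha : ∀ᶠ y in 𝓝 z, DifferentiableAt ℝ a y) (ha0 : ∀ᶠ y in 𝓝 z, 0 < a y)
    (hu : ContDiffAt ℝ 2 u z)
    (hrep : ∀ᶠ y in 𝓝 z, y.1 = z.1 → f.amb (θ y) = a y • point o e ν u y) :
    a z ^ 2 * pointSq u z = 1 ∧ ∃ σ : ℝ, σ ^ 2 * normalSq u z = 1 ∧
      mink ν (N (θ z)) = -σ ∧ (∀ j, mink (e j) (N (θ z)) = σ * d1 u j z) ∧
      mink (N (θ z)) (point o e ν u z) = 0 ∧
      f.meanCurv N (θ z) = a z * σ * traceHess u z ∧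
      ∃ v : Fin n → TangentSpace (𝓡 n) (θ z),
        (∀ j, HypImmersion.diff f.amb (θ z) (v j) =
          (a z ^ 3 * (z.2 j + u z * d1 u j z)) • point o e ν u z + a z • (e j + d1 u j z • ν)) ∧
        (∀ k, f.firstForm (θ z) (v k) (v k) = metricDiag u k z) ∧
        ∀ i j, f.firstForm (θ z) (f.shape N (θ z) (v i)) (v j) = a z * σ * d2 u i j z := by
  let v : Fin n → TangentSpace (𝓡 n) (θ z) := fun j =>
    mfderiv 𝓘(ℝ, ℝ × EuclideanSpace ℝ (Fin n)) (𝓡 n) θ z (spaceDir j)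
  have hud : ∀ᶠ y in 𝓝 z, DifferentiableAt ℝ u y := by
    filter_upwards [hu.eventually (by simp)] with y hy using hy.differentiableAt (by simp)
  have hvel : ∀ᶠ y in 𝓝 z, y.1 = z.1 → ∀ j, HypImmersion.diff f.amb (θ y)
      (mfderiv 𝓘(ℝ, ℝ × EuclideanSpace ℝ (Fin n)) (𝓡 n) θ y (spaceDir j)) =
        dirDeriv (spaceDir j) a y • point o e ν u y + a y • (e j + d1 u j y • ν) := by
    filter_upwards [hθ, ha, hud, hrep.eventually_nhds] with y h1 h2 h3 h4 hyz j
    refine diff_spaceDir h1 h2 h3 ?_ j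
    rwa [hyz]
  -- The normal is orthogonal to the position and to the coordinate directions of the graph.
  have hNP : ∀ᶠ y in 𝓝 z, y.1 = z.1 → mink (N (θ y)) (point o e ν u y) = 0 := by
    filter_upwards [hrep, ha0] with y h1 h2 hyz
    have h3 := hN.tangent (θ y)
    rw [h1 hyz, mink_smul_left, mink_comm] at h3
    exact (mul_eq_zero.1 h3).resolve_left h2.ne'
  have hNT : ∀ᶠ y in 𝓝 z, y.1 = z.1 → ∀ j, mink (N (θ y)) (e j + d1 u j y • ν) = 0 := by
    filter_upwards [hNP, hvel, ha0] with y h1 h2 h3 hyz j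
    have h4 := hN.normal (θ y) (mfderiv 𝓘(ℝ, ℝ × EuclideanSpace ℝ (Fin n)) (𝓡 n) θ y (spaceDir j))
    rw [h2 hyz, mink_add_right, mink_smul_right, mink_smul_right, h1 hyz, mul_zero, zero_add] at h4
    exact (mul_eq_zero.1 h4).resolve_left h3.ne'
  have hP := hrep.self_of_nhds rfl
  have hv : ∀ j, HypImmersion.diff f.amb (θ z) (v j) =
      dirDeriv (spaceDir j) a z • point o e ν u z + a z • (e j + d1 u j z • ν) :=
    hvel.self_of_nhds rfl
  have hapos := ha0.self_of_nhds
  have haQ : a z ^ 2 * pointSq u z = 1 := by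
    have h1 := f.mink_amb_self (θ z)
    rw [hP, mink_smul_left, mink_smul_right, mink_point_self hfr] at h1
    linarith
  have hQ0 : pointSq u z ≠ 0 := fun h => by simp [h] at haQ
  -- The components of the normal.
  set ζ := mink ν (N (θ z)) with hζ
  have hβ : ∀ j, mink (e j) (N (θ z)) = -(ζ * d1 u j z) := fun j => by
    have h1 := hNT.self_of_nhds rfl j
    rw [mink_comm, mink_add_left, mink_smul_left] at h1
    linarith
  have hc : mink o (N (θ z)) = -(ζ * normalTime u z) := by
    have h1 := hNP.self_of_nhds rfl
    rw [mink_comm, mink_point_left, ← hζ] at h1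
    simp only [hβ] at h1
    have h2 : ∑ i, z.2 i * -(ζ * d1 u i z) = -(ζ * ∑ i, z.2 i * d1 u i z) := by
      rw [Finset.mul_sum, ← Finset.sum_neg_distrib]
      exact Finset.sum_congr rfl fun i _ => by ring
    rw [h2] at h1
    rw [normalTime]
    linarith
  have hunit : ζ ^ 2 * normalSq u z = 1 := by
    have h1 := hN.unit (θ z)
    have h2 := congrArg (fun w => mink w (N (θ z))) (hfr.expand (N (θ z)))
    simp only [h1, mink_add_left, mink_smul_left, mink_sum_left, hβ, hc, ← hζ] at h2
    have h3 : ∑ i, -(ζ * d1 u i z) * -(ζ * d1 u i z) = ζ ^ 2 * ∑ i, d1 u i z ^ 2 := by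
      rw [Finset.mul_sum]
      exact Finset.sum_congr rfl fun i _ => by ring
    rw [h3] at h2
    rw [normalSq]
    linarith
  have hW0 : normalSq u z ≠ 0 := fun h => by simp [h] at hunit
  -- The second fundamental form, from the derivative of the orthogonality relations.
  have hII : ∀ i j, f.firstForm (θ z) (f.shape N (θ z) (v i)) (v j) =
      -(a z * ζ * d2 u i j z) := by
    intro i j
    have hline : HasDerivAt (fun s : ℝ => z + s • spaceDir i) (spaceDir i) 0 := by
      simpa using ((hasDerivAt_id (0 : ℝ)).smul_const (spaceDir i)).const_add z
    have hcont : Filter.Tendsto (fun s : ℝ => z + s • spaceDir i) (𝓝 0) (𝓝 z) := by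
      simpa using hline.continuousAt.tendsto
    have hz0 : z = z + (0 : ℝ) • spaceDir i := by simp
    obtain ⟨D, hD, hD'⟩ := hasFDerivAt_comp_parametrisation (hN.mdifferentiableAt (θ z))
      hθ.self_of_nhds
    have hn' : HasDerivAt (fun s : ℝ => N (θ (z + s • spaceDir i)))
        (HypImmersion.diff N (θ z) (v i)) 0 := by
      have : HypImmersion.diff N (θ z) (v i) = D (spaceDir i) := (hD' _).symm
      rw [this]
      rw [hz0] at hD
      exact hD.comp_hasDerivAt (0 : ℝ) hline
    have h1 := hn'.mink (hasDerivAt_point (o := o) (e := e) (ν := ν) hud.self_of_nhds (spaceDir i))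
    have h2 : (fun s : ℝ => mink (N (θ (z + s • spaceDir i)))
        (point o e ν u (z + s • spaceDir i))) =ᶠ[𝓝 0] fun _ => 0 := by
      filter_upwards [hcont.eventually hNP] with s hs
      exact hs (by simp [spaceDir])
    have h3 := h1.unique ((hasDerivAt_const (0 : ℝ) (0 : ℝ)).congr_of_eventuallyEq h2)
    have h4 : HasDerivAt (fun s : ℝ => e j + d1 u j (z + s • spaceDir i) • ν)
        (d2 u i j z • ν) 0 := by
      have h5 : DifferentiableAt ℝ (d1 u j) z :=
        (ContDiffAt.dirDeriv (k := 2) (m := 1) hu (spaceDir j) (by norm_num)).differentiableAt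
          (by simp)
      have h6 : HasDerivAt (fun s : ℝ => d1 u j (z + s • spaceDir i)) (d2 u i j z) 0 := by
        have h7 : HasFDerivAt (d1 u j) (fderiv ℝ (d1 u j) z) (z + (0 : ℝ) • spaceDir i) := by
          simpa using h5.hasFDerivAt
        exact h7.comp_hasDerivAt (0 : ℝ) hline
      exact (h6.smul_const ν).const_add (e j)
    have h8 := hn'.mink h4
    have h9 : (fun s : ℝ => mink (N (θ (z + s • spaceDir i)))
        (e j + d1 u j (z + s • spaceDir i) • ν)) =ᶠ[𝓝 0] fun _ => 0 := by
      filter_upwards [hcont.eventually hNT] with s hs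
      exact hs (by simp [spaceDir]) j
    have h10 := h8.unique ((hasDerivAt_const (0 : ℝ) (0 : ℝ)).congr_of_eventuallyEq h9)
    rw [sum_spaceDir_smul] at h3
    simp only [zero_smul, add_zero] at h3 h10
    have h11 : mink (N (θ z)) (e i + dirDeriv (spaceDir i) u z • ν) = 0 :=
      hNT.self_of_nhds rfl i
    rw [h11, zero_add] at h3
    rw [mink_smul_right, mink_comm, ← hζ] at h10
    rw [hN.firstForm_shape, hv, mink_add_right, mink_smul_right, mink_smul_right, h3]
    linear_combination a z * h10
  -- The first fundamental form.
  set m : Fin n → ℝ := fun i => z.2 i + u z * d1 u i z with hm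
  have hai : ∀ i, dirDeriv (spaceDir i) a z = a z ^ 3 * m i := by
    intro i
    have h1 := f.mink_amb_diff (θ z) (v i)
    rw [hv, hP, mink_smul_left, mink_add_right, mink_smul_right, mink_smul_right,
      mink_point_self hfr, mink_point_tangent hfr] at h1
    have h2 := (mul_eq_zero.1 h1).resolve_left hapos.ne'
    simp only [hm]
    linear_combination (-(dirDeriv (spaceDir i) a z)) * haQ - a z ^ 2 * h2
  have hI : ∀ i j, f.firstForm (θ z) (v i) (v j) =
      (pointSq u z)⁻¹ * ((if i = j then 1 else 0) + d1 u i z * d1 u j z) +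
        (pointSq u z)⁻¹ ^ 2 * (m i * m j) := by
    intro i j
    have hinv : (pointSq u z)⁻¹ = a z ^ 2 := by
      field_simp
      linarith
    rw [HypImmersion.firstForm, hv, hv]
    simp only [mink_add_left (_ • _) (_ • _) (_ • _ + _ • _), mink_add_right (_ • _) (_ • _) (_ • _),
      mink_smul_left _ _ (_ • _), mink_smul_right]
    have hmi : ∀ i, mink (point o e ν u z) (e i + d1 u i z • ν) = m i := fun i =>
      mink_point_tangent hfr _ _
    rw [mink_point_self hfr, hmi, mink_tangent_tangent hfr, mink_comm (e i + d1 u i z • ν), hmi,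
      hai, hai, hinv]
    linear_combination (-(a z ^ 4 * m i * m j)) * haQ
  refine ⟨haQ, -ζ, by linarith, by ring, fun j => by rw [hβ]; ring, hNP.self_of_nhds rfl, ?_, v,
    fun j => by rw [hv, hai], fun k => ?_, fun i j => ?_⟩
  · set g : Matrix (Fin n) (Fin n) ℝ :=
      Matrix.of fun i j => f.firstBilin (θ z) (v i) (v j) with hg
    have hg' : g = Matrix.of fun i j =>
        (pointSq u z)⁻¹ * ((if i = j then 1 else 0) + d1 u i z * d1 u j z) +
          (pointSq u z)⁻¹ ^ 2 * (m i * m j) := by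
      ext i j
      exact hI i j
    have hK := inverse_metric (y := fun i => z.2 i) (d := fun i => d1 u i z)
      (b := fun i => normalSpace u i z) (m := m) (v := u z) (α := normalTime u z) rfl
      (fun i => rfl) (fun i => rfl) (Q := pointSq u z) rfl (W := normalSq u z) rfl hQ0 hW0
    rw [← hg'] at hK
    have hdet : g.det ≠ 0 := (Matrix.isUnit_det_of_left_inverse hK).ne_zero
    have htr := trace_eq_trace_gram (finrank_tangentSpace_sph (θ z)) (f.firstBilin (θ z))
      (f.shape N (θ z)) v hdet
    rw [Matrix.inv_eq_left_inv hK] at htr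
    rw [HypImmersion.meanCurv, htr, traceHess, Matrix.trace]
    simp only [Matrix.diag_apply, Matrix.mul_apply, Matrix.of_apply]
    have hII' : ∀ i j, f.firstBilin (θ z) (v j) (f.shape N (θ z) (v i)) =
        -(a z * ζ * d2 u i j z) := fun i j => (f.firstForm_comm _ _ _).trans (hII i j)
    simp only [hII']
    have hterm : ∀ i j, pointSq u z * ((if i = j then 1 else 0) - z.2 i * z.2 j -
        normalSpace u i z * normalSpace u j z * (normalSq u z)⁻¹) * -(a z * ζ * d2 u i j z) =
        (-(a z * ζ * pointSq u z)) * ((if i = j then 1 else 0) * d2 u i j z) +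
          (a z * ζ * pointSq u z) * (z.2 i * z.2 j * d2 u i j z) +
          (a z * ζ * pointSq u z * (normalSq u z)⁻¹) *
            (normalSpace u i z * normalSpace u j z * d2 u i j z) := fun i j => by ring
    simp only [hterm, Finset.sum_add_distrib, ← Finset.mul_sum]
    simp only [ite_mul, one_mul, zero_mul, Finset.sum_ite_eq, Finset.mem_univ, if_true]
    ring
  · rw [hI, metricDiag, if_pos rfl]
    simp only [hm]
    ring
  · rw [hII]
    ring

end KleinGraph

end GraphGeometry

/-! ### Existence of graph parametrisations -/

section GraphExistence

variable {n : ℕ}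

namespace HypImmersion

/-- Principal directions, the position and the inward normal form a frame of Minkowski space. -/
theorem IsUnitNormal.isMinkFrame {f : HypImmersion n} {N : Sph n → Mink n} (hN : f.IsUnitNormal N)
    {p : Sph n} {E : Module.Basis (Fin n) ℝ (TangentSpace (𝓡 n) p)}
    (hE : ∀ i j, f.firstForm p (E i) (E j) = if i = j then 1 else 0) :
    IsMinkFrame (f.amb p) (fun i => diff f.amb p (E i)) (-N p) where
  oo := f.mink_amb_self p
  νν := by simp [hN.unit]
  oν := by simp [hN.tangent]
  ee := hE
  oe i := f.mink_amb_diff p _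
  νe i := by simp [hN.normal]
  expand w := by
    obtain ⟨c, v, x, rfl⟩ := hN.exists_decomposition p w
    have h1 : diff f.amb p v = ∑ i, E.repr v i • diff f.amb p (E i) := by
      simp_rw [← map_smul, ← map_sum, E.sum_repr]
    have h2 : ∀ i, mink (diff f.amb p (E i)) (diff f.amb p v) = E.repr v i := fun i => by
      rw [h1]
      have : ∀ j, mink (diff f.amb p (E i)) (diff f.amb p (E j)) = if i = j then 1 else 0 := hE i
      simp [this]
    have h3 : ∀ i, mink (diff f.amb p (E i)) (f.amb p) = 0 := fun i => by
      rw [mink_comm, f.mink_amb_diff]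
    have h4 : ∀ i, mink (diff f.amb p (E i)) (N p) = 0 := fun i => by
      rw [mink_comm, hN.normal]
    have h5 : mink (N p) (f.amb p) = 0 := by rw [mink_comm, hN.tangent]
    simp only [mink_add_right, mink_smul_right, f.mink_amb_self, f.mink_amb_diff, hN.tangent,
      hN.normal, hN.unit, h2, h3, h4, h5, mink_neg_left]
    rw [h1]
    simp

end HypImmersion

open KleinGraph in
/-- Near a point, a smooth family of immersions is a family of graphs in the Klein model. The
parametrisation `θ` comes from the inverse of `(t, x) ↦ (t, y)`, where `y` are the affine coordinates
of the family; they are fixed by the frame at the single time `t₀`. -/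
theorem exists_graph {F : ℝ → HypImmersion n} {a b t₀ : ℝ} (ht₀ : t₀ ∈ Set.Ioo a b)
    (hF : ContMDiffOn (𝓘(ℝ, ℝ).prod (𝓡 n)) 𝓘(ℝ, Mink n) ∞
      (fun q : ℝ × Sph n => (F q.1).amb q.2) (Set.Ioo a b ×ˢ Set.univ)) (p : Sph n)
    {E : Fin n → TangentSpace (𝓡 n) (toSph (p : EuclideanSpace ℝ (Fin (n + 1))))} {ν : Mink n}
    (hfr : IsMinkFrame ((F t₀).amb (toSph (p : EuclideanSpace ℝ (Fin (n + 1)))))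
      (fun i => HypImmersion.diff (F t₀).amb _ (E i)) ν) :
    ∃ (u A : ℝ × EuclideanSpace ℝ (Fin n) → ℝ) (θ : ℝ × EuclideanSpace ℝ (Fin n) → Sph n),
      ContDiffAt ℝ 4 u (t₀, 0) ∧ u (t₀, 0) = 0 ∧
      θ (t₀, 0) = toSph (p : EuclideanSpace ℝ (Fin (n + 1))) ∧
      (∀ᶠ z in 𝓝 (t₀, 0), MDifferentiableAt 𝓘(ℝ, ℝ × EuclideanSpace ℝ (Fin n)) (𝓡 n) θ z) ∧
      (∀ᶠ z in 𝓝 (t₀, 0), DifferentiableAt ℝ A z) ∧ (∀ᶠ z in 𝓝 (t₀, 0), 0 < A z) ∧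
      ∀ᶠ z in 𝓝 (t₀, 0), (F z.1).amb (θ z) = A z • point
        ((F t₀).amb (toSph (p : EuclideanSpace ℝ (Fin (n + 1)))))
        (fun i => HypImmersion.diff (F t₀).amb _ (E i)) ν u z := by
  choose X hX using fun i => HypImmersion.exists_mfderiv_toSph_eq p (E i)
  set o : Mink n := (F t₀).amb (toSph (p : EuclideanSpace ℝ (Fin (n + 1)))) with ho
  set e : Fin n → Mink n := fun i => HypImmersion.diff (F t₀).amb _ (E i) with he
  -- An affine parametrisation of the sphere, adapted to the given tangent vectors.
  let ι : ℝ × EuclideanSpace ℝ (Fin n) → EuclideanSpace ℝ (Fin (n + 1)) :=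
    fun z => p + ∑ i, z.2 i • X i
  have hι : ContDiff ℝ ∞ ι := by
    refine contDiff_const.add (ContDiff.sum fun i _ => ?_)
    exact ((EuclideanSpace.proj (𝕜 := ℝ) i).contDiff.comp contDiff_snd).smul contDiff_const
  have hι0 : ι (t₀, 0) = p := by simp [ι]
  have hιne : ι (t₀, 0) ≠ 0 := by
    rw [hι0]
    exact coe_sph_ne_zero p
  let Fh : ℝ × EuclideanSpace ℝ (Fin n) → Mink n := fun z => (F z.1).amb (toSph (ι z))
  have hψ : ∀ z, ι z ≠ 0 →
      ContMDiffAt 𝓘(ℝ, ℝ × EuclideanSpace ℝ (Fin n)) (𝓡 n) ∞ (fun z => toSph (ι z)) z :=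
    fun z hz => (contMDiffAt_toSph hz).comp z hι.contMDiff.contMDiffAt
  have hFh : ContDiffAt ℝ ∞ Fh (t₀, 0) := by
    have h1 : ContMDiffAt (𝓘(ℝ, ℝ).prod (𝓡 n)) 𝓘(ℝ, Mink n) ∞
        (fun q : ℝ × Sph n => (F q.1).amb q.2) (t₀, toSph (ι (t₀, 0))) :=
      hF.contMDiffAt (prod_mem_nhds (Ioo_mem_nhds ht₀.1 ht₀.2) Filter.univ_mem)
    have h2 : ContMDiffAt 𝓘(ℝ, ℝ × EuclideanSpace ℝ (Fin n)) (𝓘(ℝ, ℝ).prod (𝓡 n)) ∞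
        (fun z : ℝ × EuclideanSpace ℝ (Fin n) => (z.1, toSph (ι z))) (t₀, 0) :=
      (contDiff_fst.contMDiff.contMDiffAt).prodMk (hψ _ hιne)
    exact (h1.comp (t₀, 0) h2).contDiffAt
  have hFh0 : Fh (t₀, 0) = o := by simp [Fh, hι0, ho]
  have hFd := (hFh.differentiableAt (by simp)).hasFDerivAt
  have hFe : ∀ x, fderiv ℝ Fh (t₀, 0) (0, x) = ∑ i, x i • e i := by
    intro x
    have h1 : HasDerivAt (fun s : ℝ => ι (t₀, s • x)) (∑ i, x i • X i) 0 := by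
      have h2 : (fun s : ℝ => ι (t₀, s • x)) = fun s => (p : EuclideanSpace ℝ (Fin (n + 1))) +
          s • ∑ i, x i • X i := by
        ext1 s
        simp [ι, Finset.smul_sum, smul_smul]
      rw [h2]
      simpa using ((hasDerivAt_id (0 : ℝ)).smul_const (∑ i, x i • X i)).const_add
        (p : EuclideanSpace ℝ (Fin (n + 1)))
    obtain ⟨D, hD, hD'⟩ := hasFDerivAt_comp_parametrisation ((F t₀).mdifferentiableAt_amb _)
      (HypImmersion.mdifferentiableAt_toSph (coe_sph_ne_zero p))
    have h3 : HasDerivAt (fun s : ℝ => (F t₀).amb (toSph (ι (t₀, s • x))))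
        (D (∑ i, x i • X i)) 0 := by
      have hD2 : HasFDerivAt (fun y => (F t₀).amb (toSph y)) D (ι (t₀, (0 : ℝ) • x)) := by
        rw [zero_smul, hι0]
        exact hD
      exact hD2.comp_hasDerivAt (0 : ℝ) h1
    have h4 : HasDerivAt (fun s : ℝ => (t₀, s • x)) ((0 : ℝ), x) 0 := by
      simpa using (hasDerivAt_const (0 : ℝ) t₀).prodMk ((hasDerivAt_id (0 : ℝ)).smul_const x)
    have h5 : HasDerivAt (fun s : ℝ => Fh (t₀, s • x)) (fderiv ℝ Fh (t₀, 0) (0, x)) 0 := by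
      have hFd2 : HasFDerivAt Fh (fderiv ℝ Fh (t₀, 0)) (t₀, (0 : ℝ) • x) := by
        rw [zero_smul]
        exact hFd
      exact hFd2.comp_hasDerivAt (0 : ℝ) h4
    rw [h5.unique h3, map_sum]
    refine Finset.sum_congr rfl fun i _ => ?_
    rw [map_smul, hD', hX]
  have hmink : ∀ w : Mink n, ∃ L : Mink n →L[ℝ] ℝ, ∀ v, L v = mink w v := fun w =>
    ⟨LinearMap.toContinuousLinearMap (minkForm n w), fun v => rfl⟩
  have hmF : ∀ w : Mink n, ContDiffAt ℝ ∞ (fun z => mink w (Fh z)) (t₀, 0) := fun w => by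
    obtain ⟨L, hL⟩ := hmink w
    simp only [← hL]
    exact L.contDiff.contDiffAt.comp _ hFh
  have hmFd : ∀ w : Mink n, ∃ D : ℝ × EuclideanSpace ℝ (Fin n) →L[ℝ] ℝ,
      HasFDerivAt (fun z => mink w (Fh z)) D (t₀, 0) ∧
        ∀ x, D (0, x) = mink w (∑ i, x i • e i) := fun w => by
    obtain ⟨L, hL⟩ := hmink w
    refine ⟨L.comp (fderiv ℝ Fh (t₀, 0)), ?_, fun x => ?_⟩
    · simp only [← hL]
      exact L.hasFDerivAt.comp _ hFd
    · rw [ContinuousLinearMap.comp_apply, hFe, hL]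
  let c : ℝ × EuclideanSpace ℝ (Fin n) → ℝ := fun z => -mink o (Fh z)
  have hc : ContDiffAt ℝ ∞ c (t₀, 0) := (hmF o).neg
  have hc0 : c (t₀, 0) = 1 := by simp [c, hFh0, hfr.oo]
  -- The affine coordinates of the family, and the inverse function theorem.
  let Y : Fin n → ℝ × EuclideanSpace ℝ (Fin n) → ℝ := fun i z => mink (e i) (Fh z) * (c z)⁻¹
  have hY : ∀ i, ContDiffAt ℝ ∞ (Y i) (t₀, 0) := fun i =>
    (hmF (e i)).mul (hc.inv (by rw [hc0]; norm_num))
  have hY0 : ∀ i, Y i (t₀, 0) = 0 := fun i => by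
    simp only [Y, hFh0]
    rw [mink_comm, hfr.oe, zero_mul]
  have hYd : ∀ i, ∃ D : ℝ × EuclideanSpace ℝ (Fin n) →L[ℝ] ℝ, HasFDerivAt (Y i) D (t₀, 0) ∧
      ∀ x, D (0, x) = x i := fun i => by
    obtain ⟨D, hD, hD'⟩ := hmFd (e i)
    have hci : DifferentiableAt ℝ (fun z => (c z)⁻¹) (t₀, 0) :=
      (hc.inv (by rw [hc0]; norm_num)).differentiableAt (by simp)
    refine ⟨_, hD.mul hci.hasFDerivAt, fun x => ?_⟩
    have h1 : mink (e i) (Fh (t₀, 0)) = 0 := by rw [hFh0, mink_comm, hfr.oe]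
    simp [h1, hc0, hD', hfr.ee]
  choose DY hDY hDY' using hYd
  let Ψ : ℝ × EuclideanSpace ℝ (Fin n) → ℝ × EuclideanSpace ℝ (Fin n) :=
    fun z => (z.1, WithLp.toLp 2 fun i => Y i z)
  have hΨ : ContDiffAt ℝ ∞ Ψ (t₀, 0) :=
    contDiffAt_fst.prodMk (contDiffAt_euclidean.2 hY)
  have hΨ0 : Ψ (t₀, 0) = (t₀, 0) := by
    ext i
    · rfl
    · simp [Ψ, hY0]
  let DΨ : ℝ × EuclideanSpace ℝ (Fin n) →L[ℝ] ℝ × EuclideanSpace ℝ (Fin n) := fderiv ℝ Ψ (t₀, 0)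
  have hDΨ : HasFDerivAt Ψ DΨ (t₀, 0) := (hΨ.differentiableAt (by simp)).hasFDerivAt
  have hDΨ1 : ∀ w, (DΨ w).1 = w.1 := fun w => by
    have h1 := hDΨ.fst.unique (hasFDerivAt_fst (𝕜 := ℝ)
      (p := ((t₀, 0) : ℝ × EuclideanSpace ℝ (Fin n))))
    exact congrArg (fun L => L w) h1
  have hDΨ2 : ∀ w i, (DΨ w).2 i = DY i w := fun w i => by
    have h1 := ((EuclideanSpace.proj (𝕜 := ℝ) i).hasFDerivAt.comp (t₀, (0 : EuclideanSpace ℝ (Fin n)))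
      hDΨ.snd).unique (hDY i)
    exact congrArg (fun L => L w) h1
  have hinj : Function.Injective DΨ := by
    rw [injective_iff_map_eq_zero]
    rintro ⟨s, x⟩ h
    have hs : s = 0 := by
      have := hDΨ1 (s, x)
      rw [h] at this
      exact this.symm
    subst hs
    have hx : x = 0 := by
      ext i
      have := hDΨ2 (0, x) i
      rw [h, hDY'] at this
      exact this.symm
    rw [hx]
    rfl
  let DΨe : (ℝ × EuclideanSpace ℝ (Fin n)) ≃L[ℝ] ℝ × EuclideanSpace ℝ (Fin n) :=
    (LinearEquiv.ofInjectiveEndo DΨ.toLinearMap hinj).toContinuousLinearEquiv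
  have hDΨe : HasFDerivAt Ψ (DΨe : ℝ × EuclideanSpace ℝ (Fin n) →L[ℝ] _) (t₀, 0) := by
    convert! hDΨ using 1
  let Λ := hΨ.localInverse hDΨe (by simp)
  have hΛ : ContDiffAt ℝ ∞ Λ (t₀, 0) := by
    have := hΨ.to_localInverse hDΨe (by simp)
    rwa [hΨ0] at this
  have hΛ0 : Λ (t₀, 0) = (t₀, 0) := by
    have := hΨ.localInverse_apply_image hDΨe (by simp)
    rwa [hΨ0] at this
  have hΨΛ : ∀ᶠ z in 𝓝 (t₀, 0), Ψ (Λ z) = z := by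
    have := (hΨ.hasStrictFDerivAt' hDΨe (by simp)).eventually_right_inverse
    rwa [hΨ0] at this
  have hcΛ : ContDiffAt ℝ ∞ (fun z => c (Λ z)) (t₀, 0) := by
    refine ContDiffAt.comp (g := c) _ ?_ hΛ
    rw [hΛ0]
    exact hc
  have hcΛ0 : c (Λ (t₀, 0)) = 1 := by rw [hΛ0, hc0]
  have hcpos : ∀ᶠ z in 𝓝 (t₀, 0), 0 < c (Λ z) :=
    hcΛ.continuousAt.eventually_const_lt (by simp only [hcΛ0]; norm_num)
  refine ⟨fun z => mink ν (Fh (Λ z)) * (c (Λ z))⁻¹, fun z => c (Λ z), fun z => toSph (ι (Λ z)),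
    ?_, ?_, ?_, ?_, ?_, hcpos, ?_⟩
  · have h1 : ContDiffAt ℝ ∞ (fun z => mink ν (Fh (Λ z))) (t₀, 0) := by
      refine ContDiffAt.comp (g := fun z => mink ν (Fh z)) _ ?_ hΛ
      rw [hΛ0]
      exact hmF ν
    exact (h1.mul (hcΛ.inv (by rw [hcΛ0]; norm_num))).of_le (by norm_cast)
  · simp only [hΛ0, hFh0]
    rw [mink_comm, hfr.oν, zero_mul]
  · simp only [hΛ0, hι0]
  · have h1 : ∀ᶠ z in 𝓝 (t₀, (0 : EuclideanSpace ℝ (Fin n))), ι (Λ z) ≠ 0 := by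
      refine (hι.continuous.continuousAt.comp hΛ.continuousAt).eventually_ne ?_
      rwa [Function.comp_apply, hΛ0]
    filter_upwards [h1, (hΛ.of_le (m := 1) (by norm_cast)).eventually (by simp)] with z h2 h3
    exact ((hψ _ h2).mdifferentiableAt (by simp)).comp z
      (h3.contMDiffAt.mdifferentiableAt (by simp))
  · filter_upwards [(hcΛ.of_le (m := 1) (by norm_cast)).eventually (by simp)] with z hz
    exact hz.differentiableAt (by simp)
  · filter_upwards [hΨΛ, hcpos] with z h1 h2
    have h3 : (Λ z).1 = z.1 := by
      conv_rhs => rw [← h1]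
    have h4 : ∀ i, Y i (Λ z) = z.2 i := fun i => by
      conv_rhs => rw [← h1]
    have h5 : (F z.1).amb (toSph (ι (Λ z))) = Fh (Λ z) := by rw [← h3]
    rw [h5]
    conv_lhs => rw [hfr.expand (Fh (Λ z))]
    simp only [point, smul_add, Finset.smul_sum, smul_smul, ← h4, Y]
    congr 1
    · congr 1
      refine Finset.sum_congr rfl fun i _ => ?_
      congr 1
      field_simp
    · congr 1
      field_simp

end GraphExistence

/-! ### The forcing term -/

theorem HasJet.iteratedDeriv_two {f : ℝ → ℝ} {a b c : ℝ} (h : HasJet f a b c) :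
    iteratedDeriv 2 f 0 = c := by
  obtain ⟨f', h1, -, -, h4⟩ := h
  rw [iteratedDeriv_succ, iteratedDeriv_one]
  have h2 : deriv f =ᶠ[𝓝 0] f' := h1.mono fun s hs => hs.deriv
  rw [h2.deriv_eq, h4.deriv]

theorem hasJet_id : HasJet (fun s => s) 0 1 0 :=
  ⟨fun _ => 1, .of_forall fun s => hasDerivAt_id s, rfl, rfl, hasDerivAt_const _ _⟩

theorem hasJet_cosh : HasJet Real.cosh 1 0 1 :=
  ⟨Real.sinh, .of_forall Real.hasDerivAt_cosh, Real.cosh_zero, Real.sinh_zero, by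
    simpa using Real.hasDerivAt_sinh 0⟩

theorem hasJet_sinh : HasJet Real.sinh 0 1 0 :=
  ⟨Real.cosh, .of_forall Real.hasDerivAt_sinh, Real.sinh_zero, Real.cosh_zero, by
    simpa using Real.hasDerivAt_cosh 0⟩

/-- The jet of a function along a curve with position `x`, velocity `v` and acceleration
`a • x + l • w`. Hyperbolic geodesics and the coordinate lines of a graph have this form. -/
theorem hasJet_comp_curve {V : Type*} [NormedAddCommGroup V] [NormedSpace ℝ V] {g : V → ℝ}
    (hg : ContDiff ℝ 2 g) {x v w : V} {α β γ : ℝ → ℝ} {a l : ℝ} (hα : HasJet α 1 0 a)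
    (hβ : HasJet β 0 1 0) (hγ : HasJet γ 0 0 l) :
    HasJet (fun s => g (α s • x + β s • v + γ s • w)) (g x) (fderiv ℝ g x v)
      (fderiv ℝ (fderiv ℝ g) x v v + fderiv ℝ g x (a • x + l • w)) := by
  obtain ⟨α', a1, a2, a3, a4⟩ := hα
  obtain ⟨β', b1, b2, b3, b4⟩ := hβ
  obtain ⟨γ', c1, c2, c3, c4⟩ := hγ
  have hc : ∀ᶠ s in 𝓝 0, HasDerivAt (fun s => α s • x + β s • v + γ s • w)
      (α' s • x + β' s • v + γ' s • w) s := by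
    filter_upwards [a1, b1, c1] with s h1 h2 h3
    exact ((h1.smul_const x).add (h2.smul_const v)).add (h3.smul_const w)
  have hx : α 0 • x + β 0 • v + γ 0 • w = x := by simp [a2, b2, c2]
  have hv : α' 0 • x + β' 0 • v + γ' 0 • w = v := by simp [a3, b3, c3]
  refine ⟨fun s => fderiv ℝ g (α s • x + β s • v + γ s • w) (α' s • x + β' s • v + γ' s • w), ?_,
    by simp only [hx], by simp only [hx, hv], ?_⟩
  · filter_upwards [hc] with s hs
    exact (hg.differentiable (by simp) _).hasFDerivAt.comp_hasDerivAt s hs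
  · have h1 : HasDerivAt (fun s => α' s • x + β' s • v + γ' s • w) (a • x + l • w) 0 := by
      have := ((a4.smul_const x).add (b4.smul_const v)).add (c4.smul_const w)
      rw [zero_smul, add_zero] at this
      exact this
    have h2 : HasFDerivAt (fderiv ℝ g) (fderiv ℝ (fderiv ℝ g) x) (α 0 • x + β 0 • v + γ 0 • w) := by
      rw [hx]
      exact ((hg.fderiv_right (m := 1) (by norm_num)).differentiable (by simp) x).hasFDerivAt
    have h3 := h2.comp_hasDerivAt (0 : ℝ) hc.self_of_nhds
    have h4 := h3.clm_apply h1
    rw [hv] at h4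
    convert! h4 using 1
    rw [Function.comp_apply, hx]

variable {n : ℕ}

theorem hypChart_fst (x : Hyp n) : hypChart (x : Mink n).1 = x := by
  obtain ⟨⟨y, s⟩, h1, h2⟩ := x
  apply Subtype.ext
  simp only [hypChart]
  congr 1
  rw [mink, real_inner_self_eq_norm_sq] at h1
  rw [Real.sqrt_eq_iff_mul_self_eq_of_pos h2]
  linarith

namespace HyperbolicManifold

variable {M : HyperbolicManifold n} {h : M.Point → ℝ}

/-- The expression of a function on the manifold in the global chart of its universal cover. -/
def chartRep (M : HyperbolicManifold n) (h : M.Point → ℝ) (y : EuclideanSpace ℝ (Fin (n + 1))) :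
    ℝ := h (M.proj (hypChart y))

theorem chartRep_fst (x : Hyp n) : M.chartRep h (x : Mink n).1 = h (M.proj x) := by
  rw [chartRep, hypChart_fst]

/-- The Hessian of `h`, evaluated on the unit tangent vector `v` at `x`, in the global chart. The
second term is due to the acceleration `x` of the geodesic with velocity `v`. -/
def chartHess (M : HyperbolicManifold n) (h : M.Point → ℝ) (x v : Mink n) : ℝ :=
  fderiv ℝ (fderiv ℝ (M.chartRep h)) x.1 v.1 v.1 + fderiv ℝ (M.chartRep h) x.1 x.1

theorem iteratedDeriv_geod (hs : M.IsSmooth h) (x : Hyp n) (v : UnitTangent x) :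
    iteratedDeriv 2 (fun s => h (M.proj (geod x v s))) 0 = M.chartHess h x v.1 := by
  have h1 := (hasJet_comp_curve (g := M.chartRep h) (hs.of_le (by norm_cast)) (x := (x : Mink n).1)
    (v := v.1.1) (w := 0) hasJet_cosh hasJet_sinh (.const 0)).iteratedDeriv_two
  have h2 : (fun s => h (M.proj (geod x v s))) = fun s => M.chartRep h
      (Real.cosh s • (x : Mink n).1 + Real.sinh s • v.1.1 + (0 : ℝ) • 0) := by
    ext1 s
    rw [← chartRep_fst (M := M) (h := h) (geod x v s)]
    simp only [geod, smul_zero, add_zero]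
    rfl
  rw [h2, h1, one_smul, smul_zero, add_zero, chartHess]

theorem abs_chartHess_le (hs : M.IsSmooth h) (x : Hyp n) {v : Mink n}
    (hxv : mink (x : Mink n) v = 0) (hv : mink v v = 1) :
    |M.chartHess h x v| ≤ M.hessNorm h x := by
  have hbdd : BddAbove (Set.range fun v : UnitTangent x =>
      |iteratedDeriv 2 (fun s => h (M.proj (geod x v s))) 0|) := by
    refine ⟨‖fderiv ℝ (fderiv ℝ (M.chartRep h)) (x : Mink n).1‖ * (x : Mink n).2 * (x : Mink n).2 +
      |fderiv ℝ (M.chartRep h) (x : Mink n).1 (x : Mink n).1|, ?_⟩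
    rintro _ ⟨v, rfl⟩
    have h1 : ‖v.1.1‖ ≤ (x : Mink n).2 :=
      (norm_fst_le _).trans (HypImmersion.norm_le_of_unit x v.2.1 v.2.2)
    have hx := x.2.2
    simp only [iteratedDeriv_geod hs]
    refine (abs_add_le _ _).trans (add_le_add ?_ le_rfl)
    refine ((fderiv ℝ (fderiv ℝ (M.chartRep h)) (x : Mink n).1).le_opNorm₂ _ _).trans ?_
    gcongr
  rw [← iteratedDeriv_geod hs x ⟨v, hxv, hv⟩]
  exact le_ciSup hbdd _

theorem gradNorm_nonneg (x : Hyp n) : 0 ≤ M.gradNorm h x :=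
  Real.iSup_nonneg fun _ => abs_nonneg _

theorem pos_of_mem_forcingTerms (hh : h ∈ M.forcingTerms) (x : Hyp n) : 0 < h (M.proj x) := by
  refine lt_trans ?_ (hh.2 x).1
  have h1 : (0 : ℝ) < Real.sqrt (8 / 27) * (1 / ((n + 1) * (n + 2))) := by positivity
  exact div_pos (Real.cosh_pos _) (Real.sinh_pos_iff.2 h1)

theorem two_lt_of_mem_forcingTerms (hh : h ∈ M.forcingTerms) (x : Hyp n) : 2 < h (M.proj x) := by
  have h1 := pos_of_mem_forcingTerms hh x
  have h2 := (hh.2 x).2.1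
  have h3 := M.gradNorm_nonneg (h := h) x
  nlinarith

theorem abs_chartHess_lt (hh : h ∈ M.forcingTerms) (x : Hyp n) {v : Mink n}
    (hxv : mink (x : Mink n) v = 0) (hv : mink v v = 1) :
    |M.chartHess h x v| < h (M.proj x) / 6 := by
  refine (abs_chartHess_le hh.1 x hxv hv).trans_lt ?_
  have h1 := (div_lt_iff₀ (pos_of_mem_forcingTerms hh x)).1 (hh.2 x).2.2
  linarith

end HyperbolicManifold

/-- The sign of the reaction term of `KleinGraph.reaction_le`, for a forcing term larger than `2`
whose Hessian is smaller than a sixth of its value. As `H ^ 2` is at most the mean of the squares `l i ^ 2`,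
the expression is greater than `κ0 * (H ^ 2 + 1) / 4 - H`. -/
theorem reaction_pos (hn : 1 ≤ n) {κ0 H : ℝ} {l Q : Fin n → ℝ} (hκ : 2 < κ0)
    (hQ : ∀ i, |Q i| < κ0 / 6) (hH : H = (1 / n) * ∑ i, l i) (i₀ : Fin n) :
    0 < κ0 * ((1 / (2 * n)) * ∑ i, l i ^ 2 - H ^ 2 / 4 + 1 / 2) - H - Q i₀ +
      (1 / (2 * n)) * ∑ i, Q i := by
  have hn0 : (0 : ℝ) < n := by exact_mod_cast hn
  have h1 : (∑ i, l i) ^ 2 ≤ n * ∑ i, l i ^ 2 := by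
    simpa using sq_sum_le_card_mul_sum_sq (s := Finset.univ) (f := l)
  have h2 : H ^ 2 / 2 ≤ (1 / (2 * n)) * ∑ i, l i ^ 2 := by
    rw [hH, mul_pow, div_pow, one_pow, div_mul_eq_mul_div, div_mul_eq_mul_div, div_div,
      div_le_div_iff₀ (by positivity) (by positivity)]
    nlinarith
  have h3 : -(κ0 / 12) ≤ (1 / (2 * n)) * ∑ i, Q i := by
    have h4 : ∑ _i : Fin n, -(κ0 / 6) ≤ ∑ i, Q i :=
      Finset.sum_le_sum fun i _ => (abs_lt.1 (hQ i)).1.le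
    have h5 : (1 / (2 * n)) * ∑ _i : Fin n, -(κ0 / 6) = -(κ0 / 12) := by
      simp only [Finset.sum_const, Finset.card_univ, Fintype.card_fin, nsmul_eq_mul]
      field_simp
      norm_num
    rw [← h5]
    gcongr
  have h4 := (abs_lt.1 (hQ i₀)).2
  have h5 : κ0 * (H ^ 2 / 2) ≤ κ0 * ((1 / (2 * n)) * ∑ i, l i ^ 2) := by gcongr
  nlinarith [sq_nonneg (H - 1), mul_nonneg (sub_nonneg.2 hκ.le) (sq_nonneg H)]

/-! ### The flow in a graph parametrisation -/

section Flow

variable {n : ℕ}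

/-- The normal velocity of a family of immersions may be computed along any moving parametrisation
of the sphere, since these differ by tangential vectors. -/
theorem mink_deriv_eq_of_parametrisation {F : ℝ → HypImmersion n} {a b : ℝ}
    (hF : ContMDiffOn (𝓘(ℝ, ℝ).prod (𝓡 n)) 𝓘(ℝ, Mink n) ∞
      (fun q : ℝ × Sph n => (F q.1).amb q.2) (Set.Ioo a b ×ˢ Set.univ))
    {z : ℝ × EuclideanSpace ℝ (Fin n)} (hz : z.1 ∈ Set.Ioo a b)
    {θ : ℝ × EuclideanSpace ℝ (Fin n) → Sph n}
    (hθ : MDifferentiableAt 𝓘(ℝ, ℝ × EuclideanSpace ℝ (Fin n)) (𝓡 n) θ z)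
    {N : Sph n → Mink n} (hN : (F z.1).IsUnitNormal N)
    {D : ℝ × EuclideanSpace ℝ (Fin n) →L[ℝ] Mink n}
    (hD : HasFDerivAt (fun y => (F y.1).amb (θ y)) D z) :
    mink (deriv (fun s => (F s).amb (θ z)) z.1) (N (θ z)) = mink (D (timeDir n)) (N (θ z)) := by
  let Φ : ℝ × Sph n → Mink n := fun q => (F q.1).amb q.2
  have hΦ := ((hF.contMDiffAt (x := (z.1, θ z))
    (prod_mem_nhds (Ioo_mem_nhds hz.1 hz.2) Filter.univ_mem)).mdifferentiableAt
    (by simp)).hasMFDerivAt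
  set L := mfderiv (𝓘(ℝ, ℝ).prod (𝓡 n)) 𝓘(ℝ, Mink n) Φ (z.1, θ z)
  have hfst : HasMFDerivAt 𝓘(ℝ, ℝ × EuclideanSpace ℝ (Fin n)) 𝓘(ℝ, ℝ)
      (fun y : ℝ × EuclideanSpace ℝ (Fin n) => y.1) z
      (ContinuousLinearMap.fst ℝ ℝ (EuclideanSpace ℝ (Fin n))) :=
    (hasFDerivAt_fst (𝕜 := ℝ) (p := z)).hasMFDerivAt
  have h1 : HasMFDerivAt 𝓘(ℝ, ℝ × EuclideanSpace ℝ (Fin n)) 𝓘(ℝ, Mink n)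
      (fun y => (F y.1).amb (θ y)) z _ :=
    HasMFDerivAt.comp (g := Φ) (f := fun y => (y.1, θ y)) z hΦ (hfst.prodMk hθ.hasMFDerivAt)
  have h2 : HasMFDerivAt 𝓘(ℝ, ℝ) 𝓘(ℝ, Mink n) (fun s => (F s).amb (θ z)) z.1 _ :=
    HasMFDerivAt.comp (g := Φ) (f := fun s => (s, θ z)) z.1 hΦ
      ((hasMFDerivAt_id z.1).prodMk (hasMFDerivAt_const (θ z) z.1))
  have h3 : HasMFDerivAt (𝓡 n) 𝓘(ℝ, Mink n) (F z.1).amb (θ z) _ :=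
    HasMFDerivAt.comp (g := Φ) (f := fun q => (z.1, q)) (θ z) hΦ
      ((hasMFDerivAt_const z.1 (θ z)).prodMk (hasMFDerivAt_id (θ z)))
  have h4 : D (timeDir n) = deriv (fun s => (F s).amb (θ z)) z.1 +
      HypImmersion.diff (F z.1).amb (θ z)
        (mfderiv 𝓘(ℝ, ℝ × EuclideanSpace ℝ (Fin n)) (𝓡 n) θ z (timeDir n)) := by
    obtain ⟨D', hD', hD'1⟩ : ∃ D' : ℝ →L[ℝ] Mink n,
        HasFDerivAt (fun s => (F s).amb (θ z)) D' z.1 ∧ D' 1 = L (1, 0) := ⟨_, h2.hasFDerivAt, rfl⟩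
    rw [hD.unique h1.hasFDerivAt, hD'.hasDerivAt.deriv, hD'1, HypImmersion.diff, h3.mfderiv]
    set w := mfderiv 𝓘(ℝ, ℝ × EuclideanSpace ℝ (Fin n)) (𝓡 n) θ z (timeDir n)
    have h5 : (((1 : ℝ), w) : ℝ × TangentSpace (𝓡 n) (θ z)) = (1, 0) + (0, w) := by simp
    exact (congrArg L h5).trans (map_add L _ _)
  rw [h4, mink_add_left, mink_comm _ (N (θ z)), mink_comm _ (N (θ z)), hN.normal, add_zero]

open KleinGraph HyperbolicManifold in
/-- The jet of the forcing term along a coordinate line of a Klein graph which is horizontal at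
`z`: the second derivative is the Hessian in the direction `e k`, corrected by the curvature of the line. -/
theorem hasJet_forcing {M : HyperbolicManifold n} {h : M.Point → ℝ} (hs : M.IsSmooth h)
    {o : Mink n} {e : Fin n → Mink n} {ν : Mink n} {u A κ : ℝ × EuclideanSpace ℝ (Fin n) → ℝ}
    {z : ℝ × EuclideanSpace ℝ (Fin n)} (hz : z.2 = 0) (hu : ContDiffAt ℝ 2 u z) (hu0 : u z = 0)
    {k : Fin n} (hu1 : d1 u k z = 0)
    (hA : ∀ᶠ y in 𝓝 z, 0 < A y ∧ A y ^ 2 * pointSq u y = 1)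
    (hκ : ∀ᶠ y in 𝓝 z, κ y = M.chartRep h (A y • point o e ν u y).1) :
    HasJet (fun s => κ (z + s • spaceDir k)) (M.chartRep h o.1)
      (fderiv ℝ (M.chartRep h) o.1 (e k).1)
      (M.chartHess h o (e k) + d2 u k k z * fderiv ℝ (M.chartRep h) o.1 ν.1) := by
  have hline : Filter.Tendsto (fun s : ℝ => z + s • spaceDir k) (𝓝 0) (𝓝 z) := by
    have : Continuous fun s : ℝ => z + s • spaceDir k := by fun_prop
    simpa using this.tendsto 0
  have hju : HasJet (fun s => u (z + s • spaceDir k)) 0 0 (d2 u k k z) :=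
    (hasJet_line hu (spaceDir k)).cast hu0 hu1 rfl
  have hcoord : ∀ s : ℝ, ∀ i, (z + s • spaceDir k).2 i = if i = k then s else 0 := fun s i => by
    simp [hz, spaceDir, PiLp.single_apply]
  have hα : HasJet (fun s => A (z + s • spaceDir k)) 1 0 1 := by
    have h1 : HasJet (fun s => (√(1 - s ^ 2 - u (z + s • spaceDir k) ^ 2))⁻¹) 1 0 1 :=
      (((((HasJet.const 1).sub hasJet_id.sq).sub hju.sq).cast (c' := -2) (by norm_num)
        (by norm_num) (by norm_num)).sqrt.inv).cast rfl rfl (by norm_num)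
    refine h1.congr ?_
    filter_upwards [hline.eventually hA] with s hs
    have h2 : pointSq u (z + s • spaceDir k) = 1 - s ^ 2 - u (z + s • spaceDir k) ^ 2 := by
      simp only [pointSq, hcoord]
      simp
    rw [← h2, eq_comm, inv_eq_iff_eq_inv, Real.sqrt_eq_iff_mul_self_eq_of_pos (inv_pos.2 hs.1)]
    have := hs.1.ne'
    field_simp
    linarith [hs.2]
  have h1 := hasJet_comp_curve (g := M.chartRep h) (hs.of_le (by norm_cast)) (x := o.1)
    (v := (e k).1) (w := ν.1) hα ((hα.mul hasJet_id).cast (b' := 1) (c' := 0) (by norm_num)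
      (by norm_num) (by norm_num)) ((hα.mul hju).cast (a' := 0) (b' := 0) (c' := d2 u k k z)
      (by norm_num) (by norm_num) (by ring))
  refine (h1.congr ?_).cast rfl rfl ?_
  · filter_upwards [hline.eventually hκ] with s hs
    rw [hs]
    simp only [point, hcoord]
    simp [ite_smul, smul_smul]
  · rw [map_add, one_smul, map_smul, smul_eq_mul, chartHess]
    ring

open KleinGraph in
theorem continuousAt_traceHess {u : ℝ × EuclideanSpace ℝ (Fin n) → ℝ}
    {z : ℝ × EuclideanSpace ℝ (Fin n)} (hu : ContDiffAt ℝ 4 u z) (hW : normalSq u z ≠ 0) :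
    ContinuousAt (traceHess u) z := by
  have hu' : ContDiffAt ℝ ((4 : ℕ∞) : WithTop ℕ∞) u z := hu
  have h0 : ContinuousAt u z := hu.continuousAt
  have hd1 : ∀ i, ContDiffAt ℝ ((3 : ℕ∞) : WithTop ℕ∞) (d1 u i) z := fun i =>
    hu'.dirDeriv _ (by norm_num)
  have h1 : ∀ i, ContinuousAt (d1 u i) z := fun i => (hd1 i).continuousAt
  have h2 : ∀ i j, ContinuousAt (d2 u i j) z := fun i j =>
    ((hd1 j).dirDeriv (m := 2) _ (by norm_num)).continuousAt
  have hy : ∀ i, ContinuousAt (fun z : ℝ × EuclideanSpace ℝ (Fin n) => z.2 i) z := fun i => by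
    fun_prop
  have hα : ContinuousAt (normalTime u) z :=
    h0.sub (tendsto_finsetSum _ fun i _ => (hy i).mul (h1 i))
  have hb : ∀ i, ContinuousAt (normalSpace u i) z := fun i => (h1 i).add (hα.mul (hy i))
  have hW' : ContinuousAt (normalSq u) z :=
    ((tendsto_finsetSum _ fun i _ => (h1 i).pow 2).const_add 1).sub (hα.pow 2)
  have hQ : ContinuousAt (pointSq u) z :=
    ((tendsto_finsetSum _ fun i _ => (hy i).pow 2).const_sub 1).sub (h0.pow 2)
  have hs : ∀ f : Fin n → Fin n → ℝ × EuclideanSpace ℝ (Fin n) → ℝ,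
      (∀ i j, ContinuousAt (f i j) z) → ContinuousAt (fun z => ∑ i, ∑ j, f i j z) z := fun f hf =>
    tendsto_finsetSum _ fun i _ => tendsto_finsetSum _ fun j _ => hf i j
  refine (hQ.mul (((tendsto_finsetSum _ fun i _ => h2 i i).sub
    (hs (fun i j z => z.2 i * z.2 j * d2 u i j z) fun i j => ((hy i).mul (hy j)).mul (h2 i j))).sub
    ((hs (fun i j z => normalSpace u i z * normalSpace u j z * d2 u i j z) fun i j =>
      ((hb i).mul (hb j)).mul (h2 i j)).mul (hW'.inv₀ hW)))).const_mul _

end Flow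

/-! ### Strict pinching along the flow -/

section Strict

variable {n : ℕ}

open KleinGraph HyperbolicManifold in
/-- Along a weakly pinched flow, no principal curvature equals half of the mean curvature: the
conclusions of `KleinGraph.reaction_le` and `reaction_pos` exclude each other. -/
theorem principal_curvature_ne (hn : 1 ≤ n) {M : HyperbolicManifold n} {h : M.Point → ℝ}
    (hh : h ∈ M.forcingTerms) {F : ℝ → HypImmersion n} {a b : ℝ}
    (hF : ContMDiffOn (𝓘(ℝ, ℝ).prod (𝓡 n)) 𝓘(ℝ, Mink n) ∞
      (fun q : ℝ × Sph n => (F q.1).amb q.2) (Set.Ioo a b ×ˢ Set.univ))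
    {N : ℝ → Sph n → Mink n} (hN : ∀ t ∈ Set.Ioo a b, (F t).IsUnitNormal (N t))
    (hflow : ∀ t ∈ Set.Ioo a b, ∀ p, mink (deriv (fun s => (F s).amb p) t) (N t p) =
      h (M.proj ((F t).toFun p)) - (F t).meanCurv (N t) p)
    (hpinch : ∀ t ∈ Set.Ioo a b, ∀ p, (F t).PinchedAt (N t) p) {t₀ : ℝ} (ht₀ : t₀ ∈ Set.Ioo a b)
    (p : Sph n)
    {E : Module.Basis (Fin n) ℝ (TangentSpace (𝓡 n) (toSph (p : EuclideanSpace ℝ (Fin (n + 1)))))}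
    {l : Fin n → ℝ}
    (hE : ∀ i j, (F t₀).firstForm _ (E i) (E j) = if i = j then 1 else 0)
    (hl : ∀ i, (F t₀).shape (N t₀) _ (E i) = l i • E i)
    (hH : (F t₀).meanCurv (N t₀) (toSph (p : EuclideanSpace ℝ (Fin (n + 1)))) = (1 / n) * ∑ i, l i)
    (i₀ : Fin n) :
    l i₀ ≠ (F t₀).meanCurv (N t₀) (toSph (p : EuclideanSpace ℝ (Fin (n + 1)))) / 2 := by
  intro hi₀
  have hfr := (hN t₀ ht₀).isMinkFrame hE
  obtain ⟨u, A, θ, hu, hu0, hθ0, hθ, hAd, hA0, hrep⟩ := exists_graph ht₀ hF p hfr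
  set o := (F t₀).amb (toSph (p : EuclideanSpace ℝ (Fin (n + 1)))) with ho
  set e : Fin n → Mink n := fun i => HypImmersion.diff (F t₀).amb _ (E i) with he
  set ν := -N t₀ (toSph (p : EuclideanSpace ℝ (Fin (n + 1)))) with hν
  have hu' : ContDiffAt ℝ ((4 : ℕ∞) : WithTop ℕ∞) u (t₀, 0) := hu
  have hu2 : ContDiffAt ℝ 2 u (t₀, 0) := hu.of_le (by norm_num)
  have ht : ∀ᶠ z : ℝ × EuclideanSpace ℝ (Fin n) in 𝓝 (t₀, 0), z.1 ∈ Set.Ioo a b :=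
    continuousAt_fst.eventually (Ioo_mem_nhds ht₀.1 ht₀.2)
  have hgeo : ∀ᶠ z in 𝓝 (t₀, 0), A z ^ 2 * pointSq u z = 1 ∧ ∃ σ : ℝ, σ ^ 2 * normalSq u z = 1 ∧
      mink ν (N z.1 (θ z)) = -σ ∧ (∀ j, mink (e j) (N z.1 (θ z)) = σ * d1 u j z) ∧
      mink (N z.1 (θ z)) (point o e ν u z) = 0 ∧
      (F z.1).meanCurv (N z.1) (θ z) = A z * σ * traceHess u z ∧
      ∃ v : Fin n → TangentSpace (𝓡 n) (θ z),
        (∀ j, HypImmersion.diff (F z.1).amb (θ z) (v j) =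
          (A z ^ 3 * (z.2 j + u z * d1 u j z)) • point o e ν u z + A z • (e j + d1 u j z • ν)) ∧
        (∀ k, (F z.1).firstForm (θ z) (v k) (v k) = metricDiag u k z) ∧
        ∀ i j, (F z.1).firstForm (θ z) ((F z.1).shape (N z.1) (θ z) (v i)) (v j) =
          A z * σ * d2 u i j z := by
    filter_upwards [hθ.eventually_nhds, hAd.eventually_nhds, hA0.eventually_nhds,
      hrep.eventually_nhds, ht, hu2.eventually (by simp)] with z h1 h2 h3 h4 h5 h6
    refine geometry_of_graph hfr (hN z.1 h5) h1 h2 h3 h6 ?_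
    filter_upwards [h4] with y hy hyz
    rw [← hy, hyz]
  let κ : ℝ × EuclideanSpace ℝ (Fin n) → ℝ := fun z => M.chartRep h ((F z.1).amb (θ z)).1
  have hκ : ∀ z, κ z = h (M.proj ((F z.1).toFun (θ z))) := fun z => chartRep_fst _
  -- The flow equation for the height function, up to the orientation of the normal.
  have hspeed : ∀ᶠ z in 𝓝 (t₀, 0), ∀ σ : ℝ, mink ν (N z.1 (θ z)) = -σ →
      mink (N z.1 (θ z)) (point o e ν u z) = 0 →
      (F z.1).meanCurv (N z.1) (θ z) = A z * σ * traceHess u z →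
      A z * σ * (traceHess u z - dirDeriv (timeDir n) u z) = κ z := by
    filter_upwards [hθ, hAd, hrep.eventually_nhds, ht, hu2.eventually (by simp)]
      with z h1 h2 h4 h5 h6 σ k1 k2 k3
    have hud : DifferentiableAt ℝ u z := h6.differentiableAt (by simp)
    have hP : DifferentiableAt ℝ (point o e ν u) z := by
      simp only [point.eq_unfold]
      fun_prop
    have hD := (h2.hasFDerivAt.smul hP.hasFDerivAt).congr_of_eventuallyEq h4
    have h7 := mink_deriv_eq_of_parametrisation hF h5 h1 (hN z.1 h5) hD
    have h8 : fderiv ℝ (point o e ν u) z (timeDir n) = dirDeriv (timeDir n) u z • ν := by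
      have k4 := hasDerivAt_point (o := o) (e := e) (ν := ν) hud (timeDir n)
      have k5 : HasFDerivAt (point o e ν u) (fderiv ℝ (point o e ν u) z)
          (z + (0 : ℝ) • timeDir n) := by
        simpa using hP.hasFDerivAt
      have k6 : HasDerivAt (fun s : ℝ => z + s • timeDir n) (timeDir n) 0 := by
        simpa using ((hasDerivAt_id (0 : ℝ)).smul_const (timeDir n)).const_add z
      have k7 : HasDerivAt (fun s : ℝ => point o e ν u (z + s • timeDir n)) _ 0 :=
        HasFDerivAt.comp_hasDerivAt (l := point o e ν u) (f := fun s : ℝ => z + s • timeDir n)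
          (0 : ℝ) k5 k6
      rw [k7.unique k4]
      simp [timeDir]
    rw [hflow z.1 h5, k3, ← hκ] at h7
    simp only [add_apply, smul_apply,
      ContinuousLinearMap.smulRight_apply, h8, mink_add_left, mink_smul_left, k1,
      mink_comm (point o e ν u z), k2] at h7
    linarith
  -- The situation at the base point.
  have hbase := hgeo.self_of_nhds
  have hspeed0 := hspeed.self_of_nhds
  have hκ0 : κ (t₀, 0) = h (M.proj ((F t₀).toFun (toSph p))) := by rw [hκ, hθ0]
  have hA1 := hA0.self_of_nhds
  rw [hθ0] at hbase hspeed0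
  obtain ⟨b1, σ, b2, b3, b4, b5, b6, v, b7, b8, b9⟩ := hbase
  have hσ : σ = 1 := by
    rw [hν, mink_neg_left, (hN t₀ ht₀).unit] at b3
    linarith
  subst hσ
  have hd1 : ∀ j, d1 u j (t₀, 0) = 0 := fun j => by
    have := b4 j
    rwa [mink_comm, (hN t₀ ht₀).normal, one_mul, eq_comm] at this
  have hA2 : A (t₀, 0) = 1 := by
    have : A (t₀, 0) ^ 2 = 1 := by
      simpa [pointSq, hu0] using b1
    nlinarith
  have hv : ∀ j, v j = E j := fun j => by
    apply (F t₀).injective_diff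
    rw [b7, hu0, hd1, hA2]
    simp [he]
  have hd2 : ∀ i j, d2 u i j (t₀, 0) = if i = j then l i else 0 := fun i j => by
    have := b9 i j
    rw [hv, hv, hl, hA2, one_mul, one_mul] at this
    rw [← this, HypImmersion.firstForm, map_smul, mink_smul_left]
    have := hE i j
    rw [HypImmersion.firstForm] at this
    rw [this, mul_ite, mul_one, mul_zero]
  -- The product `A * σ * (traceHess u - ∂ₜ u)` equals `κ > 0`, so the last factor, which is
  -- continuous and positive at the base point, determines the sign of `σ` nearby; the normals are
  -- not known to be continuous in time.
  have hpos : ∀ z, 0 < κ z := fun z => by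
    rw [hκ]
    exact pos_of_mem_forcingTerms hh _
  have hslow : ∀ᶠ z in 𝓝 (t₀, 0), 0 < traceHess u z - dirDeriv (timeDir n) u z := by
    have hW : normalSq u (t₀, 0) ≠ 0 := fun h0 => by simp [h0] at b2
    have h1 : ContinuousAt (dirDeriv (timeDir n) u) (t₀, 0) :=
      (hu'.dirDeriv (m := 3) _ (by norm_num)).continuousAt
    refine ((continuousAt_traceHess hu hW).sub h1).eventually_const_lt ?_
    have h2 := hspeed0 1 b3 b5 b6
    rw [hA2, one_mul, one_mul] at h2
    rw [Pi.sub_apply, h2]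
    exact hpos _
  have hgraph : ∀ᶠ z in 𝓝 (t₀, 0), dirDeriv (timeDir n) u z =
      traceHess u z - √(normalSq u z * pointSq u z) * κ z := by
    filter_upwards [hgeo, hspeed, hslow, hA0] with z ⟨k1, σ, k2, k3, k4, k5, k6, _⟩ h2 h3 h4
    have h5 := h2 σ k3 k5 k6
    have hσ : 0 < A z * σ := pos_of_mul_pos_left (h5 ▸ hpos z) h3.le
    have h6 : √(normalSq u z * pointSq u z) = (A z * σ)⁻¹ := by
      rw [Real.sqrt_eq_iff_mul_self_eq_of_pos (inv_pos.2 hσ), ← mul_inv, inv_eq_iff_eq_inv]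
      refine eq_inv_of_mul_eq_one_left ?_
      linear_combination (normalSq u z * σ ^ 2) * k1 + k2
    rw [h6, ← h5, inv_mul_cancel_left₀ hσ.ne']
    ring
  have hpin : ∀ᶠ z in 𝓝 (t₀, 0),
      0 ≤ d2 u i₀ i₀ z - (1 / 2) * (traceHess u z * metricDiag u i₀ z) := by
    filter_upwards [hgeo, hspeed, hslow, ht]
      with z ⟨k1, σ, k2, k3, k4, k5, k6, v, k7, k8, k9⟩ h2 h3 h4
    have h5 := h2 σ k3 k5 k6
    have hσ : 0 < A z * σ := pos_of_mul_pos_left (h5 ▸ hpos z) h3.le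
    have h6 := hpinch z.1 h4 (θ z) (v i₀)
    rw [k6, k8, k9] at h6
    by_contra hneg
    nlinarith
  have ho1 : o = ((F t₀).toFun (toSph p) : Mink n) := rfl
  have hκo : κ (t₀, 0) = M.chartRep h o.1 := by
    simp only [κ, hθ0, ho]
  have hjet : ∀ k, HasJet (fun s => κ ((t₀, 0) + s • spaceDir k)) (κ (t₀, 0))
      (fderiv ℝ (M.chartRep h) o.1 (e k).1)
      (M.chartHess h o (e k) + l k * fderiv ℝ (M.chartRep h) o.1 ν.1) := fun k => by
    refine (hasJet_forcing (A := A) (ν := ν) (e := e) (o := o) hh.1 rfl hu2 hu0 (hd1 k) ?_ ?_).cast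
      hκo.symm rfl (by rw [hd2, if_pos rfl])
    · filter_upwards [hA0, hgeo] with z h1 h2 using ⟨h1, h2.1⟩
    · filter_upwards [hrep] with z hz
      rw [← hz]
  have h1 := reaction_le hn (z := (t₀, 0)) rfl hu hu0 hd1 hd2 hH hi₀ hjet hgraph hpin
  rw [hκ0] at h1
  refine absurd h1 (not_le.2 (reaction_pos hn (Q := fun k => M.chartHess h o (e k))
    (two_lt_of_mem_forcingTerms hh ((F t₀).toFun (toSph p))) (fun i => ?_) hH i₀))
  exact abs_chartHess_lt hh ((F t₀).toFun (toSph p)) (hfr.oe i) (by simpa using hfr.ee i i)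

/-- A forced mean curvature flow by weakly pinched immersions consists of strictly pinched ones. -/
theorem isStrictlyPinchedWith_of_flow (hn : 1 ≤ n) {M : HyperbolicManifold n} {h : M.Point → ℝ}
    (hh : h ∈ M.forcingTerms) {F : ℝ → HypImmersion n} {a b : ℝ}
    (hF : ContMDiffOn (𝓘(ℝ, ℝ).prod (𝓡 n)) 𝓘(ℝ, Mink n) ∞
      (fun q : ℝ × Sph n => (F q.1).amb q.2) (Set.Ioo a b ×ˢ Set.univ))
    {N : ℝ → Sph n → Mink n} (hN : ∀ t ∈ Set.Ioo a b, (F t).IsOutwardNormal (N t))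
    (hflow : ∀ t ∈ Set.Ioo a b, ∀ p, mink (deriv (fun s => (F s).amb p) t) (N t p) =
      h (M.proj ((F t).toFun p)) - (F t).meanCurv (N t) p)
    (hpinch : ∀ t ∈ Set.Ioo a b, ∀ p, (F t).PinchedAt (N t) p) {t₀ : ℝ}
    (ht₀ : t₀ ∈ Set.Ioo a b) : (F t₀).IsStrictlyPinchedWith (N t₀) := by
  have key : ∀ p : Sph n, ∀ v : TangentSpace (𝓡 n) p, v ≠ 0 →
      0 < (F t₀).firstForm p ((F t₀).shape (N t₀) p v) v ∧
      (1 / 2) * (F t₀).meanCurv (N t₀) p * (F t₀).firstForm p v v <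
        (F t₀).firstForm p ((F t₀).shape (N t₀) p v) v := by
    intro p
    rw [← toSph_coe p]
    intro v hv
    obtain ⟨E, l, hE, hl, hH⟩ := (hN t₀ ht₀).1.exists_principal_frame
      (toSph (p : EuclideanSpace ℝ (Fin (n + 1))))
    set H := (F t₀).meanCurv (N t₀) (toSph (p : EuclideanSpace ℝ (Fin (n + 1))))
    have hEE : ∀ i, (F t₀).firstForm _ (E i) (E i) = 1 := fun i => by rw [hE, if_pos rfl]
    have hlE : ∀ i, (F t₀).firstForm _ ((F t₀).shape (N t₀) _ (E i)) (E i) = l i := fun i => by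
      rw [hl, HypImmersion.firstForm, map_smul, mink_smul_left]
      exact (congrArg (l i * ·) (hEE i)).trans (mul_one _)
    have hl0 : ∀ i, 0 ≤ l i := fun i => by
      have := (hN t₀ ht₀).2 _ (E i)
      rwa [hlE] at this
    have hlt : ∀ i, (1 / 2) * H < l i := fun i => by
      have h1 := hpinch t₀ ht₀ _ (E i)
      rw [hEE, hlE, mul_one] at h1
      refine lt_of_le_of_ne h1 fun h2 => ?_
      refine principal_curvature_ne hn hh hF (fun t ht => (hN t ht).1) hflow hpinch ht₀ p hE hl hH i ?_
      rw [← h2]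
      ring
    have hH0 : 0 ≤ H := by
      rw [hH]
      exact mul_nonneg (by positivity) (Finset.sum_nonneg fun i _ => hl0 i)
    have hstrict : (1 / 2) * H * (F t₀).firstForm _ v v <
        (F t₀).firstForm _ ((F t₀).shape (N t₀) _ v) v := by
      rw [HypImmersion.firstForm_eq_sum hE, HypImmersion.firstForm_shape_eq_sum hE hl,
        Finset.mul_sum]
      obtain ⟨i, hi⟩ : ∃ i, E.repr v i ≠ 0 := by
        by_contra! h0
        exact hv (E.repr.map_eq_zero_iff.1 (Finsupp.ext h0))
      exact Finset.sum_lt_sum (fun j _ => mul_le_mul_of_nonneg_right (hlt j).le (sq_nonneg _))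
        ⟨i, Finset.mem_univ _, mul_lt_mul_of_pos_right (hlt i) (by positivity)⟩
    refine ⟨lt_of_le_of_lt ?_ hstrict, hstrict⟩
    exact mul_nonneg (by positivity) ((F t₀).firstForm_self_pos _ hv).le
  exact ⟨⟨(hN t₀ ht₀).1, fun p v hv => (key p v hv).1⟩, fun p v hv => (key p v hv).2⟩

end Strict

theorem proposition4p2 (n : ℕ) (hn : 1 ≤ n) (M : HyperbolicManifold n) [CompactSpace M.Point]
    (h : M.Point → ℝ) (hh : h ∈ M.forcingTerms)
    (I : ℝ → M.ImmersionClass) (hI : M.IsTrajectory h I)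
    (hC : ∀ t, I t ∈ closure M.pinchedSpace) :
    ∀ t, ∀ f : HypImmersion n, M.cls f = I t → f.IsLSC ∧ f.IsStrictlyHalfPinched := by
  intro t f hf
  obtain ⟨a, b, hat, htb, F, hF, hflow⟩ := hI t
  choose! hcls N hN hspeed using hflow
  have hstrict := isStrictlyPinchedWith_of_flow hn hh hF hN hspeed
    (fun s hs p => pinchedAt_of_mem_closure hn (hN s hs) (by rw [hcls s hs]; exact hC s) p)
    ⟨hat, htb⟩
  obtain ⟨g, hg, φ, hφ⟩ := exists_deck_of_cls_eq hn ((hcls t ⟨hat, htb⟩).trans hf.symm)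
  have hfs := hstrict.transport (M.map_form g hg) hφ
  exact ⟨⟨_, hfs.1⟩, hfs.isStrictlyHalfPinched⟩

end
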